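/- Let $M$ be a compact complex manifold of dimension $n\ge 1$ with complex structure $J$, $L\to M$ a smooth Hermitian complex line bundle, and $\Omega$ a smooth positive volume form on $M$. For a unitary connection $\nabla$ on $L$ let $F_\nabla$ be $i$ times its curvature, a real closed two-form representing $2\pi c_1(L)$. Let $\mathcal M$ be the space of smooth unitary connections on $L$ such that $F_\nabla^{0,2}=F_\nabla^{2,0}=0$ and $F_\nabla$ is a positive $(1,1)$-form. A tangent vector of $\mathcal M$ is a smooth real one-form $a$ with $da$ of type $(1,1)$, standing for the variation $\nabla-i\varepsilon a$, under which $F_\nabla$ changes by $\varepsilon\,da$; put $(Ia)(v)=-a(Jv)$. Fix $\nabla_0\in\mathcal M$, put $\omega=F_{\nabla_0}$ and assume $\int_M\Omega=\int_M\omega^n$. The gauge group $\mathcal G=C^\infty(M,S^1)$ acts on $\mathcal M$ by $g\cdot\nabla=g^{-1}\circ\nabla\circ g$. A function $\zeta\in C^\infty(M,\mathbb R)=\mathrm{Lie}(\mathcal G)$ generates $t\mapsto e^{-it\zeta}$; let $X_\zeta$ be the induced vector field on $\mathcal M$, let $A_\nabla$ be the real connection one-form of $\nabla$ on the unit circle bundle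 of $L$, normalized so that $dA_\nabla$ is the pull-back of $F_\nabla$, and let $\langle A_\nabla,\zeta\rangle$ be its value on the vertical vector field generated by $\zeta$. Define $$\nu_\nabla(a,b)=\int_M a\wedge b\wedge F_\nabla^{n-1},\qquad \langle\bar\mu(\nabla),\zeta\rangle=\int_M\langle A_\nabla,\zeta\rangle\,(F_\nabla^n-\Omega).$$ 1. $\mathcal G$ preserves $\mathcal M$, and $\nu$ is a $\mathcal G$-invariant symplectic form on $\mathcal M$ (closed and non-degenerate). $I$ preserves the tangent spaces, $\nu(Ia,Ib)=\nu(a,b)$, and $\nu(a,Ia)>0$ for $a\neq0$. 2. $\bar\mu$ is a moment map for the action of $\mathcal G$ on $(\mathcal M,n\nu)$: one has $X_\zeta=d\langle A_\nabla,\zeta\rangle$, this is a tangent vector of $\mathcal M$, $\langle d\bar\mu(\nabla)(b),\zeta\rangle=n\,\nu_\nabla(b,X_\zeta)$ for every tangent vector $b$, and $\bar\mu$ is $\mathcal G$-invariant. Moreover $\bar\mu(\nabla)$ vanishes on constants, and for the inner product $\langle\zeta,\xi\rangle_\nabla=\int_M\zeta\xi F_\nabla^n$ on $\mathrm{Lie}(\mathcal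 G)$ it is represented by the function $\bar\mu^\sharp(\nabla)=(F_\nabla^n-\Omega)/F_\nabla^n$. 3. Let $0<T\le\infty$ and let $a_t$, $t\in[0,T)$, be a family of real one-forms; put $\nabla_t=\nabla_0-ia_t$. The following are equivalent: (i) $a_t$ is smooth in $(t,x)$, $a_0=0$, $\nabla_t\in\mathcal M$ for all $t$, and $\nabla_t$ solves the negative gradient flow $\partial_ta_t=-\tfrac14\,\mathrm{grad}\,\|\bar\mu\|^2$, where the gradient is taken for the Riemannian metric $n\,\nu(\cdot,I\cdot)$ on $\mathcal M$ and, at time $t$, $\|\cdot\|$ is the fixed norm on $\mathrm{Lie}(\mathcal G)^*$ dual to $\langle\cdot,\cdot\rangle_{\nabla_t}$ (it is not differentiated); (ii) $a_t$ is smooth in $(t,x)$, $a_0=0$, $\nabla_t\in\mathcal M$ for all $t$, and $\partial_ta_t=\tfrac12\,I X_{\bar\mu^\sharp(\nabla_t)}$; (iii) there is a solution $\phi_t$, smooth in $(t,x)$ on $[0,T)\times M$, of the $\Omega$-Kähler flow $$\frac{\partial\phi_t}{\partial t}=1-\frac{\Omega}{(\omega+i\partial\bar\partial\phi_t)^n},\qquad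 \phi_0=0,\qquad \omega+i\partial\bar\partial\phi_t>0,$$ such that $a_t=\tfrac12\,I\,d\phi_t$, and hence $F_{\nabla_t}=\omega+i\partial\bar\partial\phi_t$, for all $t\in[0,T)$. In this case $\omega_t=F_{\nabla_t}$ satisfies $\displaystyle\frac{d\omega_t}{dt}=i\partial\bar\partial\Big(\frac{\omega_t^n-\Omega}{\omega_t^n}\Big)$. -/

import Mathlib

open Bundle Set MeasureTheory Topology
open scoped Manifold ContDiff

noncomputable section

namespace KahlerFlow

/-! ### Complex manifolds, tangent spaces, forms

A complex manifold of dimension `n` is a charted space over `ℂⁿ = (Fin n → ℂ)` with holomorphic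
transition maps. Its underlying smooth manifold is modelled on `ℂⁿ` seen as a real vector space. -/

/-- `ℂⁿ` as a real model space. -/
abbrev modelR (n : ℕ) : ModelWithCorners ℝ (Fin n → ℂ) (Fin n → ℂ) := 𝓘(ℝ, Fin n → ℂ)

/-- A complex manifold is a smooth real manifold. -/
instance realStructure {n : ℕ} {M : Type*} [TopologicalSpace M] [ChartedSpace (Fin n → ℂ) M]
    [IsManifold 𝓘(ℂ, Fin n → ℂ) ω M] : IsManifold 𝓘(ℝ, Fin n → ℂ) ∞ M := by
  apply isManifold_of_contDiffOn
  intro e e' he he'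
  have := (contDiffGroupoid ω 𝓘(ℂ, Fin n → ℂ)).compatible he he'
  rw [contDiffGroupoid, mem_groupoid_of_pregroupoid] at this
  have h1 := this.1
  simp only [contDiffPregroupoid] at h1
  simpa using (h1.restrict_scalars ℝ).of_le le_top

section Forms

variable {n : ℕ} {M : Type*} [TopologicalSpace M] [ChartedSpace (Fin n → ℂ) M]

variable (n) in
/-- The real tangent space `T_x M`. In Mathlib this is the model space `ℂⁿ`, a tangent vector
being represented by its coordinates in the preferred chart `chartAt (Fin n → ℂ) x`. -/
abbrev Tan (x : M) : Type := TangentSpace (modelR n) x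

variable (n M) in
/-- One-forms on `M` with values in `W` (no regularity imposed). -/
abbrev OneForm (W : Type*) [NormedAddCommGroup W] [NormedSpace ℝ W] :=
  Π x : M, Tan n x →L[ℝ] W

variable (n M) in
/-- Bilinear forms on the tangent spaces of `M`; all those used below are alternating. -/
abbrev TwoForm (W : Type*) [NormedAddCommGroup W] [NormedSpace ℝ W] :=
  Π x : M, Tan n x →L[ℝ] Tan n x →L[ℝ] W

variable (n M) in
/-- Real forms of top degree `2n`; the `2n` arguments are indexed by `Fin n × Fin 2`. -/
abbrev TopForm := Π x : M, Tan n x [⋀^Fin n × Fin 2]→ₗ[ℝ] ℝ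

variable {W : Type*} [NormedAddCommGroup W] [NormedSpace ℝ W]

/-- The differential at `y ∈ ℂⁿ` of the inverse of the preferred chart at `c`. -/
def chartInvDeriv (c : M) (y : Fin n → ℂ) :
    (Fin n → ℂ) →L[ℝ] Tan n ((chartAt (Fin n → ℂ) c).symm y) :=
  mfderiv 𝓘(ℝ, Fin n → ℂ) (modelR n) (chartAt (Fin n → ℂ) c).symm y

/-- The one-form `α` written in the preferred chart at `c` (pull-back by the inverse chart). -/
def OneForm.inChart (α : OneForm n M W) (c : M) (y : Fin n → ℂ) : (Fin n → ℂ) →L[ℝ] W :=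
  (α ((chartAt (Fin n → ℂ) c).symm y)).comp (chartInvDeriv c y)

/-- Smoothness of a one-form: smooth coefficients in all preferred charts. -/
def OneForm.Smooth (α : OneForm n M W) : Prop :=
  ∀ c : M, ContDiffOn ℝ ∞ (OneForm.inChart α c) (chartAt (Fin n → ℂ) c).target

/-- Exterior derivative of a one-form, `dα(v, w) = ∂_v (α w) - ∂_w (α v)` in coordinates. At the
point `x` it is computed in the preferred chart at `x`, in which `T_x M` is literally `ℂⁿ`. -/
def extD (α : OneForm n M W) : TwoForm n M W := fun x =>
  let A : (Fin n → ℂ) →L[ℝ] (Fin n → ℂ) →L[ℝ] W :=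
    fderiv ℝ (OneForm.inChart α x) (chartAt (Fin n → ℂ) x x)
  (A - A.flip : (Fin n → ℂ) →L[ℝ] (Fin n → ℂ) →L[ℝ] W)

/-- The differential `dφ` of a function. -/
def dFun (φ : M → ℝ) : OneForm n M ℝ := fun x => mvfderiv (modelR n) φ x

/-- The complex structure `J` of `M` (multiplication by `i` in a holomorphic chart). -/
def J (x : M) : Tan n x →L[ℝ] Tan n x :=
  (ContinuousLinearMap.lsmul ℝ ℂ Complex.I : (Fin n → ℂ) →L[ℝ] (Fin n → ℂ))

/-- The linear map `z ↦ Re (i z)`. -/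
def reI : ℂ →L[ℝ] ℝ := -Complex.imCLM

/-- The real bilinear form `Re (i B)`; it is `i B` when `B` takes purely imaginary values. -/
def reITwo {x : M} (B : Tan n x →L[ℝ] Tan n x →L[ℝ] ℂ) : Tan n x →L[ℝ] Tan n x →L[ℝ] ℝ :=
  (ContinuousLinearMap.postcomp (Tan n x) reI).comp B

/-- `∂̄φ`, the part of type `(0,1)` of `dφ`: `∂̄φ(v) = (dφ(v) + i dφ(Jv)) / 2`. -/
def delbar (φ : M → ℝ) : OneForm n M ℂ := fun x =>
  (1 / 2 : ℂ) • (Complex.ofRealCLM.comp (dFun φ x)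
    + Complex.I • Complex.ofRealCLM.comp ((dFun φ x).comp (J x)))

/-- `i∂∂̄φ`, as a real two-form. Since `∂̄∂̄φ = 0`, one has `∂∂̄φ = d(∂̄φ)`, which is purely
imaginary for real `φ`. -/
def iddbar (φ : M → ℝ) : TwoForm n M ℝ := fun x => reITwo (extD (delbar φ) x)

/-- A real two-form is of type `(1,1)`, i.e. its `(0,2)` and `(2,0)` parts vanish, iff it is
`J`-invariant. -/
def IsType11 (F : TwoForm n M ℝ) : Prop :=
  ∀ (x : M) (v w : Tan n x), F x (J x v) (J x w) = F x v w

/-- Positivity of a `(1,1)`-form: `F(v, Jv) > 0` for `v ≠ 0`. -/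
def IsPositive (F : TwoForm n M ℝ) : Prop :=
  ∀ (x : M) (v : Tan n x), v ≠ 0 → 0 < F x v (J x v)

/-- The wedge product of two real covectors, `(a ∧ b)(v, w) = a(v) b(w) - b(v) a(w)`. -/
def wedge11 {x : M} (a b : Tan n x →L[ℝ] ℝ) : Tan n x →L[ℝ] Tan n x →L[ℝ] ℝ :=
  a.smulRight b - b.smulRight a

/-- The multilinear form `v ↦ ∏ j, G_j (v_{(j,0)}, v_{(j,1)})`. -/
def pairProd {x : M} (G : Fin n → (Tan n x →L[ℝ] Tan n x →L[ℝ] ℝ)) :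
    MultilinearMap ℝ (fun _ : Fin n × Fin 2 => Tan n x) ℝ where
  toFun v := ∏ j, G j (v (j, 0)) (v (j, 1))
  map_update_add' := by
    intro dec v i a b
    obtain ⟨j, k⟩ := i
    have hdec : dec = instDecidableEqProd := Subsingleton.elim _ _
    subst hdec
    rw [← Finset.mul_prod_erase _ _ (Finset.mem_univ j),
      ← Finset.mul_prod_erase _ (fun j' => G j' (Function.update v (j, k) a (j', 0)) _)
        (Finset.mem_univ j),
      ← Finset.mul_prod_erase _ (fun j' => G j' (Function.update v (j, k) b (j', 0)) _)
        (Finset.mem_univ j)]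
    have key : ∀ c : Tan n x, ∏ j' ∈ Finset.univ.erase j,
        G j' (Function.update v (j, k) c (j', 0)) (Function.update v (j, k) c (j', 1))
        = ∏ j' ∈ Finset.univ.erase j, G j' (v (j', 0)) (v (j', 1)) := by
      intro c
      refine Finset.prod_congr rfl fun j' hj' => ?_
      have hne : j' ≠ j := (Finset.mem_erase.mp hj').1
      rw [Function.update_of_ne (by simp [hne]), Function.update_of_ne (by simp [hne])]
    rw [key, key, key, ← add_mul]
    congr 1
    fin_cases k <;> simp [Function.update]
  map_update_smul' := by
    intro dec v i c a
    obtain ⟨j, k⟩ := i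
    have hdec : dec = instDecidableEqProd := Subsingleton.elim _ _
    subst hdec
    rw [← Finset.mul_prod_erase _ _ (Finset.mem_univ j),
      ← Finset.mul_prod_erase _ (fun j' => G j' (Function.update v (j, k) a (j', 0)) _)
        (Finset.mem_univ j)]
    have key : ∀ c : Tan n x, ∏ j' ∈ Finset.univ.erase j,
        G j' (Function.update v (j, k) c (j', 0)) (Function.update v (j, k) c (j', 1))
        = ∏ j' ∈ Finset.univ.erase j, G j' (v (j', 0)) (v (j', 1)) := by
      intro c
      refine Finset.prod_congr rfl fun j' hj' => ?_
      have hne : j' ≠ j := (Finset.mem_erase.mp hj').1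
      rw [Function.update_of_ne (by simp [hne]), Function.update_of_ne (by simp [hne])]
    rw [key, key, smul_eq_mul, ← mul_assoc]
    congr 1
    fin_cases k <;> simp [Function.update]

/-- The wedge product `G_0 ∧ ⋯ ∧ G_{n-1}` of `n` two-forms at a point,
`(2!)⁻ⁿ ∑_σ sign(σ) ∏ j, G_j (v_{σ(j,0)}, v_{σ(j,1)})`. With this normalization
`(dx₁ ∧ dy₁) ∧ ⋯ ∧ (dxₙ ∧ dyₙ)` takes the value `1` on `(∂x₁, ∂y₁, …, ∂xₙ, ∂yₙ)`. -/
def wedge {x : M} (G : Fin n → (Tan n x →L[ℝ] Tan n x →L[ℝ] ℝ)) :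
    Tan n x [⋀^Fin n × Fin 2]→ₗ[ℝ] ℝ :=
  ((1 / 2 : ℝ) ^ n) • MultilinearMap.alternatization (pairProd G)

/-- The top-degree form `Fⁿ`. -/
def topPow (F : TwoForm n M ℝ) : TopForm n M := fun x => wedge (fun _ => F x)

/-- The top-degree form `B ∧ F^{n-1}` for a two-form `B` (here `n ≥ 1`). -/
def wedgePow [NeZero n] (B F : TwoForm n M ℝ) : TopForm n M :=
  fun x => wedge (Function.update (fun _ => F x) 0 (B x))

variable (n) in
/-- The canonical oriented real frame `(e_1, i e_1, …, e_n, i e_n)` of `ℂⁿ`. -/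
def frame (p : Fin n × Fin 2) : Fin n → ℂ := Pi.single p.1 (if p.2 = 0 then 1 else Complex.I)

/-- The coefficient of a top-degree form with respect to the coordinates of the preferred
chart at `c`. -/
def TopForm.coeff (η : TopForm n M) (c : M) (y : Fin n → ℂ) : ℝ :=
  η ((chartAt (Fin n → ℂ) c).symm y) fun p => chartInvDeriv c y (frame n p)

/-- The quotient `η / κ` of two top-degree forms (`κ` nowhere zero), a function on `M`. -/
def topRatio (η κ : TopForm n M) (x : M) : ℝ :=
  η x (fun p => (frame n p : Tan n x)) / κ x (fun p => (frame n p : Tan n x))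

/-- A smooth (positive) volume form. -/
structure IsVolumeForm (Om : TopForm n M) : Prop where
  smooth : ∀ c : M, ContDiffOn ℝ ∞ (TopForm.coeff Om c) (chartAt (Fin n → ℂ) c).target
  pos : ∀ x : M, 0 < Om x (fun p => (frame n p : Tan n x))

variable [IsManifold 𝓘(ℂ, Fin n → ℂ) ω M] [T2Space M] [CompactSpace M]

variable (n M) in
/-- A smooth partition of unity subordinate to the preferred charts. -/
def chartPartition : SmoothPartitionOfUnity M (modelR n) M univ :=
  (SmoothPartitionOfUnity.exists_isSubordinate_chartAt_source (modelR n) M).choose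

/-- The integral `∫_M η` of a top-degree form on a compact complex manifold with its complex
orientation: cut `η` into pieces supported in charts by a partition of unity, and integrate the
coefficient of each piece against Lebesgue measure. -/
def integral (η : TopForm n M) : ℝ :=
  ∑ᶠ c : M, ∫ y in (chartAt (Fin n → ℂ) c).target,
    chartPartition n M c ((chartAt (Fin n → ℂ) c).symm y) * TopForm.coeff η c y

end Forms

/-! ### Hermitian line bundles and connections -/

section Bundles

/-- A complex line bundle is a real vector bundle of rank two. -/
instance realBundle {M : Type*} [TopologicalSpace M]
    {V : M → Type*} [TopologicalSpace (TotalSpace ℂ V)] [∀ x, NormedAddCommGroup (V x)]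
    [∀ x, InnerProductSpace ℂ (V x)] [FiberBundle ℂ V] [hV : VectorBundle ℂ ℂ V] :
    VectorBundle ℝ ℂ V := by
  have hlin : ∀ (e : Trivialization ℂ (TotalSpace.proj : TotalSpace ℂ V → M))
      [MemTrivializationAtlas e], e.IsLinear ℝ := by
    intro e he
    have h := VectorBundle.trivialization_linear' (R := ℂ) e
    refine ⟨fun b hb => ⟨fun x y => (h.linear b hb).map_add x y, fun c x => ?_⟩⟩
    have := (h.linear b hb).map_smul (c : ℂ) x
    simpa using this
  refine ⟨hlin, fun e e' he he' => ?_⟩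
  have h1 := VectorBundle.continuousOn_coordChange' (R := ℂ) e e'
  have h2 := (ContinuousLinearMap.restrictScalarsL ℂ ℂ ℂ ℝ ℝ).continuous.comp_continuousOn h1
  refine h2.congr fun b hb => ?_
  ext1
  rw [ContinuousLinearEquiv.coe_coe, Trivialization.coordChangeL_apply _ _ hb]
  exact (Trivialization.coordChangeL_apply (R := ℂ) e e' hb _).symm

variable {n : ℕ} {M : Type*} [TopologicalSpace M] [ChartedSpace (Fin n → ℂ) M]
  {V : M → Type*} [TopologicalSpace (TotalSpace ℂ V)] [∀ x, NormedAddCommGroup (V x)]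
  [∀ x, InnerProductSpace ℂ (V x)] [FiberBundle ℂ V] [VectorBundle ℂ ℂ V]

variable (n V) in
/-- The Hermitian metric of the line bundle is smooth: the inner product of two smooth sections
is a smooth function. -/
def SmoothHermitian : Prop :=
  ∀ σ τ : Π x : M, V x,
    ContMDiff (modelR n) ((modelR n).prod 𝓘(ℝ, ℂ)) ∞ (fun x => TotalSpace.mk' ℂ x (σ x)) →
    ContMDiff (modelR n) ((modelR n).prod 𝓘(ℝ, ℂ)) ∞ (fun x => TotalSpace.mk' ℂ x (τ x)) →
    ContMDiff (modelR n) 𝓘(ℝ, ℂ) ∞ (fun x => inner ℂ (σ x) (τ x))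

/-- Differentiability at `x` of a section. -/
def SecDiffAt (n : ℕ) {M : Type*} [TopologicalSpace M] [ChartedSpace (Fin n → ℂ) M]
    {V : M → Type*} [TopologicalSpace (TotalSpace ℂ V)] [∀ x, NormedAddCommGroup (V x)]
    [FiberBundle ℂ V] (σ : Π x : M, V x) (x : M) : Prop :=
  MDifferentiableAt (modelR n) ((modelR n).prod 𝓘(ℝ, ℂ)) (fun y => TotalSpace.mk' ℂ y (σ y)) x

variable (n V) in
/-- Connections (covariant derivatives) on the underlying real bundle; `∇ σ x v` is the
derivative of the section `σ` at `x` in the direction `v`. -/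
abbrev Conn := CovariantDerivative (modelR n) ℂ V

/-- `∇` is a smooth unitary connection on the Hermitian line bundle: it is complex linear and
compatible with the Hermitian metric. -/
structure IsUnitary [IsManifold 𝓘(ℂ, Fin n → ℂ) ω M] (nab : Conn n V) : Prop where
  smooth : CovariantDerivative.ContMDiffCovariantDerivative nab ∞
  complexLinear : ∀ (σ : Π x : M, V x) (x : M), SecDiffAt n σ x →
    ∀ v : Tan n x, nab (fun y => Complex.I • σ y) x v = Complex.I • nab σ x v
  metric : ∀ (σ τ : Π x : M, V x) (x : M), SecDiffAt n σ x → SecDiffAt n τ x → ∀ v : Tan n x,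
    mvfderiv (modelR n) (fun y => inner ℂ (σ y) (τ y)) x v
      = inner ℂ (nab σ x v) (τ x) + inner ℂ (σ x) (nab τ x v)

/-- The local frame `e` of the line bundle given by the preferred trivialization at `x`. -/
def localFrame (x y : M) : V y := (trivializationAt ℂ V x).symm y 1

/-- The local connection form `θ` of `∇` in the frame `e` around `x`: `∇e = θ ⊗ e`. -/
def localForm (nab : Conn n V) (x : M) : OneForm n M ℂ := fun y =>
  ((trivializationAt ℂ V x).continuousLinearMapAt ℝ y).comp (nab (localFrame x) y)

/-- The curvature of a unitary connection, as a real two-form. The curvature with values in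
`End L = ℂ` is `dθ`, which is imaginary; it is multiplied by `i`, so that `F_∇` represents
`2π c₁(L)`. -/
def curv (nab : Conn n V) : TwoForm n M ℝ := fun x => reITwo (extD (localForm nab x) x)

variable (n V) in
/-- The space `𝓜` of integrable unitary connections whose curvature is a Kähler form. -/
def kahlerConns [IsManifold 𝓘(ℂ, Fin n → ℂ) ω M] : Set (Conn n V) :=
  {nab | IsUnitary nab ∧ IsType11 (curv nab) ∧ IsPositive (curv nab)}

/-- The tangent space of `𝓜` (at any point): real one-forms `a`, standing for the variation
`∇ - i ε a`, which preserve integrability, i.e. `da` is of type `(1,1)`. -/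
def IsTangent (a : OneForm n M ℝ) : Prop := a.Smooth ∧ IsType11 (extD a)

/-- The connection `∇ - i a`. -/
def shift (nab : Conn n V) (a : OneForm n M ℝ) : Conn n V where
  toFun σ x := nab σ x - (a x).smulRight (Complex.I • σ x)
  isCovariantDerivativeOnUniv := by
    constructor
    · intro σ σ' x h h' _
      rw [nab.isCovariantDerivativeOnUniv.add h h']
      ext v
      simp
      abel
    · intro σ g x h hg _
      rw [nab.isCovariantDerivativeOnUniv.leibniz h hg]
      ext v
      simp [smul_sub, smul_comm Complex.I (g x), smul_comm (a x v) (g x)]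
      abel

/-- The real one-form `a` such that `∇' = ∇ - i a`. -/
def connDiff (nab nab' : Conn n V) : OneForm n M ℝ := fun x =>
  reI.comp (localForm nab' x x - localForm nab x x)

/-! ### The gauge group -/

variable (n M) in
/-- The gauge group `𝓖 = C^∞(M, S¹)`. -/
abbrev Gauge := C^∞⟮modelR n, M; 𝓡 1, Circle⟯

variable (n M) in
/-- The Lie algebra of `𝓖`: smooth real functions (see `expGauge` for the exponential map). -/
abbrev LieGauge := C^∞⟮modelR n, M; 𝓘(ℝ, ℝ), ℝ⟯

lemma secDiffAt_smul {σ : Π x : M, V x} {f : M → ℂ} {x : M}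
    (hf : MDifferentiableAt (modelR n) 𝓘(ℝ, ℂ) f x) (h : SecDiffAt n σ x) :
    SecDiffAt n (fun y => f y • σ y) x := by
  unfold SecDiffAt at *
  rw [mdifferentiableAt_section] at h ⊢
  have h2 : MDifferentiableAt (modelR n) 𝓘(ℝ, ℂ)
      (fun y => f y * (trivializationAt ℂ V x ⟨y, σ y⟩).2) x := hf.mul h
  refine h2.congr_of_eventuallyEq ?_
  filter_upwards [(trivializationAt ℂ V x).open_baseSet.mem_nhds
    (mem_baseSet_trivializationAt ℂ V x)] with y hy
  have := ((trivialization_linear ℂ (trivializationAt ℂ V x)).linear y hy).map_smul (f y) (σ y)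
  simpa using this

lemma gauge_mdiff (g : Gauge n M) (x : M) :
    MDifferentiableAt (modelR n) 𝓘(ℝ, ℂ) (fun y => (g y : ℂ)) x := by
  have : Fact (Module.finrank ℝ ℂ = 1 + 1) := finrank_real_complex_fact'
  have h0 : ContMDiff (𝓡 1) 𝓘(ℝ, ℂ) 1 (fun z : Circle => (z : ℂ)) :=
    contMDiff_coe_sphere (E := ℂ) (n := 1)
  have h2 : MDifferentiableAt (𝓡 1) 𝓘(ℝ, ℂ) (fun z : Circle => (z : ℂ)) (g x) :=
    h0.mdifferentiableAt (by simp)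
  have h1 : MDifferentiableAt (modelR n) (𝓡 1) g x :=
    g.contMDiff.mdifferentiableAt (by simp)
  exact h2.comp x h1

/-- The action of gauge transformations on connections, by pull-back:
`g · ∇ = g⁻¹ ∘ ∇ ∘ g`. -/
instance gaugeAction : MulAction (Gauge n M) (Conn n V) where
  smul g nab :=
    { toFun := fun σ x => ((g x : ℂ)⁻¹) • nab (fun y => (g y : ℂ) • σ y) x
      isCovariantDerivativeOnUniv := by
        constructor
        · intro σ σ' x h h' _
          have e : (fun y => (g y : ℂ) • (σ + σ') y)
              = (fun y => (g y : ℂ) • σ y) + (fun y => (g y : ℂ) • σ' y) := by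
            funext y
            simp
          rw [e, nab.isCovariantDerivativeOnUniv.add (secDiffAt_smul (gauge_mdiff g x) h)
            (secDiffAt_smul (gauge_mdiff g x) h'), smul_add]
        · intro σ f x h hf _
          have e : (fun y => (g y : ℂ) • (f • σ) y) = f • (fun y => (g y : ℂ) • σ y) := by
            funext y
            exact smul_comm _ _ _
          rw [e, nab.isCovariantDerivativeOnUniv.leibniz (secDiffAt_smul (gauge_mdiff g x) h) hf]
          ext v
          have hg : (g x : ℂ) ≠ 0 := Circle.coe_ne_zero _
          have h1 : ∀ (r : ℝ) (z : V x), ((g x : ℂ)⁻¹) • r • z = r • ((g x : ℂ)⁻¹) • z :=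
            fun r z => smul_comm _ _ _
          simp only [_root_.smul_apply, _root_.add_apply,
            ContinuousLinearMap.smulRight_apply, smul_add, h1]
          rw [inv_smul_smul₀ hg] }
  one_smul nab := by
    ext σ x v
    change (((1 : Gauge n M) x : ℂ)⁻¹) • nab (fun y => ((1 : Gauge n M) y : ℂ) • σ y) x v = _
    simp
  mul_smul g h nab := by
    ext σ x v
    change (((g * h : Gauge n M) x : ℂ)⁻¹) • nab (fun y => ((g * h : Gauge n M) y : ℂ) • σ y) x v
      = ((g x : ℂ)⁻¹) • ((h x : ℂ)⁻¹) • nab (fun y => (h y : ℂ) • (g y : ℂ) • σ y) x v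
    simp [smul_smul, mul_comm]

lemma gauge_smul_apply (g : Gauge n M) (nab : Conn n V) (σ : Π x : M, V x) (x : M) :
    (g • nab) σ x = ((g x : ℂ)⁻¹) • nab (fun y => (g y : ℂ) • σ y) x := rfl

/-- The exponential map of `𝓖`: the one-parameter group `t ↦ exp(-i t ζ)` generated by the
function `ζ`. (The Lie algebra `iℝ` of `S¹` is identified with `ℝ` through multiplication by `i`,
consistently with the curvature and the connection form.) -/
def expGauge (ζ : LieGauge n M) (t : ℝ) : Gauge n M :=
  ⟨fun x => Circle.exp (-(t * ζ x)),
    contMDiff_circleExp.comp ((contMDiff_const.mul ζ.contMDiff).neg)⟩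

/-- `X` is the value at `∇` of the vector field `X_ζ` on `𝓜` given by the infinitesimal action
of `ζ`. -/
def IsInfinitesimalAction (nab : Conn n V) (ζ : LieGauge n M) (X : OneForm n M ℝ) : Prop :=
  ∀ (x : M) (v : Tan n x),
    HasDerivAt (fun t : ℝ => connDiff nab (expGauge ζ t • nab) x v) (X x v) 0

/-! ### The connection one-form on the circle bundle -/

/-- Tangent spaces of the total space of the line bundle. -/
abbrev TotTan (n : ℕ) {M : Type*} [TopologicalSpace M] [ChartedSpace (Fin n → ℂ) M]
    {V : M → Type*} [TopologicalSpace (TotalSpace ℂ V)] [∀ x, NormedAddCommGroup (V x)]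
    [FiberBundle ℂ V] (p : TotalSpace ℂ V) : Type :=
  TangentSpace ((modelR n).prod 𝓘(ℝ, ℂ)) p

/-- The vertical part of a vector `w` tangent to the total space at `p`, with respect to the
horizontal distribution of `∇`, as an element of the fibre: if `w` is the velocity of a curve
`(x(t), z(t))` in a trivialization with constant sections `s_z`, this is
`s_{z'(0)} + ∇_{x'(0)} s_{z(0)}`. -/
def verticalPart (nab : Conn n V) (p : TotalSpace ℂ V) (w : TotTan n p) : V p.proj :=
  (trivializationAt ℂ V p.proj).symm p.proj
      (mvfderiv ((modelR n).prod 𝓘(ℝ, ℂ)) (fun q => (trivializationAt ℂ V p.proj q).2) p w)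
    + nab (fun y => (trivializationAt ℂ V p.proj).symm y (trivializationAt ℂ V p.proj p).2) p.proj
      (mfderiv ((modelR n).prod 𝓘(ℝ, ℂ)) (modelR n) (TotalSpace.proj (F := ℂ) (E := V)) p w)

/-- The real connection one-form `A_∇` at a point `p` of the unit circle bundle. Its pull-back by
a unit local section `e` is the one-form `a` with `∇e = -i a ⊗ e`, so that `d A_∇` is the
pull-back of `F_∇`. -/
def connForm (nab : Conn n V) (p : TotalSpace ℂ V) (w : TotTan n p) : ℝ :=
  -(inner ℂ p.snd (verticalPart nab p w)).im

/-- The vector at `p` of the vertical vector field on the circle bundle generated by `ζ`, i.e. the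
velocity at `t = 0` of `t ↦ exp(-i t ζ(x)) p`. -/
def vertField (ζ : M → ℝ) (p : TotalSpace ℂ V) : TotTan n p :=
  mfderiv 𝓘(ℝ, ℝ) ((modelR n).prod 𝓘(ℝ, ℂ))
    (fun t : ℝ => (TotalSpace.mk' ℂ p.proj (Complex.exp (-(t * ζ p.proj) * Complex.I) • p.snd)))
    0 (1 : ℝ)

/-- A point of the unit circle bundle over `x`. -/
def unitPoint (x : M) : TotalSpace ℂ V :=
  TotalSpace.mk' ℂ x (((‖localFrame (V := V) x x‖⁻¹ : ℝ) : ℂ) • localFrame (V := V) x x)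

/-- The function `⟨A_∇, ζ⟩` on `M`: the rotation speed, in the fibre of the circle bundle, of the
vertical vector field generated by `ζ`. -/
def angle (nab : Conn n V) (ζ : M → ℝ) (x : M) : ℝ :=
  connForm nab (unitPoint x) (vertField (n := n) ζ (unitPoint x))

/-! ### Symplectic form, moment map, gradient flow -/

/-- The complex structure on the tangent spaces of `𝓜`, `(I a)(v) = -a(J v)`. -/
def compI (a : OneForm n M ℝ) : OneForm n M ℝ := fun x => -((a x).comp (J x))

variable [IsManifold 𝓘(ℂ, Fin n → ℂ) ω M] [T2Space M] [CompactSpace M]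

/-- `ν_∇(a, b) = ∫_M a ∧ b ∧ F_∇^{n-1}`. -/
def nu [NeZero n] (nab : Conn n V) (a b : OneForm n M ℝ) : ℝ :=
  integral (wedgePow (fun x => wedge11 (a x) (b x)) (curv nab))

variable (n V) in
/-- `sigma`, a bilinear form on the tangent space of `𝓜` depending on the point of `𝓜`, is a
symplectic form on `𝓜` (open in an affine space), invariant under the gauge group. -/
structure IsInvariantSymplectic (sigma : Conn n V → OneForm n M ℝ → OneForm n M ℝ → ℝ) :
    Prop where
  add_left : ∀ nab ∈ kahlerConns n V, ∀ a b c, IsTangent a → IsTangent b → IsTangent c →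
    sigma nab (a + b) c = sigma nab a c + sigma nab b c
  smul_left : ∀ nab ∈ kahlerConns n V, ∀ (r : ℝ) (a b), IsTangent a → IsTangent b →
    sigma nab (r • a) b = r * sigma nab a b
  antisymm : ∀ nab ∈ kahlerConns n V, ∀ a b, IsTangent a → IsTangent b →
    sigma nab a b = -sigma nab b a
  nondegenerate : ∀ nab ∈ kahlerConns n V, ∀ a, IsTangent a →
    (∀ b, IsTangent b → sigma nab a b = 0) → a = 0
  /-- The exterior derivative of `sigma` vanishes on constant vector fields. -/
  closed : ∀ nab ∈ kahlerConns n V, ∀ a b c, IsTangent a → IsTangent b → IsTangent c →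
    ∃ da db dc : ℝ,
      HasDerivAt (fun t : ℝ => sigma (shift nab (t • a)) b c) da 0 ∧
      HasDerivAt (fun t : ℝ => sigma (shift nab (t • b)) c a) db 0 ∧
      HasDerivAt (fun t : ℝ => sigma (shift nab (t • c)) a b) dc 0 ∧ da + db + dc = 0
  invariant : ∀ nab ∈ kahlerConns n V, ∀ (g : Gauge n M) (a b), IsTangent a → IsTangent b →
    sigma (g • nab) a b = sigma nab a b

variable (n V) in
/-- `mu : 𝓜 → Lie(𝓖)*` is a moment map for the action of `𝓖` on `𝓜` with symplectic form
`sigma`: `⟨dmu(∇)(b), ζ⟩ = sigma_∇(b, X_ζ)`, and `mu` is equivariant, i.e. invariant since `𝓖` is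
abelian. -/
structure IsMomentMap (sigma : Conn n V → OneForm n M ℝ → OneForm n M ℝ → ℝ)
    (mu : Conn n V → LieGauge n M → ℝ) : Prop where
  add : ∀ nab ∈ kahlerConns n V, ∀ ζ ξ, mu nab (ζ + ξ) = mu nab ζ + mu nab ξ
  smul : ∀ nab ∈ kahlerConns n V, ∀ (r : ℝ) (ζ), mu nab (r • ζ) = r * mu nab ζ
  hamiltonian : ∀ nab ∈ kahlerConns n V, ∀ ζ, ∃ X, IsInfinitesimalAction nab ζ X ∧
    IsTangent X ∧ ∀ b, IsTangent b →
      HasDerivAt (fun t : ℝ => mu (shift nab (t • b)) ζ) (sigma nab b X) 0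
  equivariant : ∀ nab ∈ kahlerConns n V, ∀ (g : Gauge n M) (ζ), mu (g • nab) ζ = mu nab ζ

/-- `μ̄(∇) = ⟨A_∇, ·⟩ (F_∇ⁿ - Ω)`, an element of the dual of the Lie algebra of `𝓖` through
integration over `M`. -/
def muBar (Om : TopForm n M) (nab : Conn n V) (ζ : LieGauge n M) : ℝ :=
  integral (fun x => angle nab ζ x • (topPow (curv nab) x - Om x))

/-- `μ̄(∇)` as a function on `M`, i.e. as an element of `Lie(𝓖)`: `(F_∇ⁿ - Ω) / F_∇ⁿ`. -/
def muSharp (Om : TopForm n M) (nab : Conn n V) : M → ℝ :=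
  topRatio (fun x => topPow (curv nab) x - Om x) (topPow (curv nab))

/-- The inner product `⟨ζ, ξ⟩_∇ = ∫_M ζ ξ F_∇ⁿ` on `Lie(𝓖)`. -/
def lieInner (nab : Conn n V) (ζ ξ : M → ℝ) : ℝ :=
  integral (fun x => (ζ x * ξ x) • topPow (curv nab) x)

/-- The squared norm of `μ̄(∇)` for the norm on `Lie(𝓖)*` dual to `⟨·,·⟩_{∇₁}`: the inner product
represents `μ̄(∇)` by the function `(F_∇ⁿ - Ω) / F_{∇₁}ⁿ`. -/
def muNormSq (Om : TopForm n M) (nab₁ nab : Conn n V) : ℝ :=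
  lieInner nab₁ (topRatio (fun x => topPow (curv nab) x - Om x) (topPow (curv nab₁)))
    (topRatio (fun x => topPow (curv nab) x - Om x) (topPow (curv nab₁)))

/-- `G` is the gradient at `∇` of the function `f` on `𝓜`, for the Riemannian metric
`(a, b) ↦ sigma(a, I b)`. -/
def IsGradient (sigma : Conn n V → OneForm n M ℝ → OneForm n M ℝ → ℝ) (f : Conn n V → ℝ)
    (nab : Conn n V) (G : OneForm n M ℝ) : Prop :=
  IsTangent G ∧ ∀ b, IsTangent b →
    HasDerivAt (fun t : ℝ => f (shift nab (t • b))) (sigma nab G (compI b)) 0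

/-- The time interval `[0, T)`, `0 < T ≤ ∞`. -/
def timeInterval (T : EReal) : Set ℝ := {t | 0 ≤ t ∧ (t : EReal) < T}

/-- A family of one-forms depending smoothly on `(t, x)` for `t ∈ K`. -/
def SmoothFamily (K : Set ℝ) (a : ℝ → OneForm n M ℝ) : Prop :=
  ∀ c : M, ContDiffOn ℝ ∞ (fun q : ℝ × (Fin n → ℂ) => OneForm.inChart (a q.1) c q.2)
    (K ×ˢ (chartAt (Fin n → ℂ) c).target)

/-- `∇_t = ∇₀ - i a_t`, `t ∈ K`, is a smooth curve in `𝓜` starting at `∇₀`. -/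
structure IsCurve (nab₀ : Conn n V) (K : Set ℝ) (a : ℝ → OneForm n M ℝ) : Prop where
  smooth : SmoothFamily K a
  zero : a 0 = 0
  mem : ∀ t ∈ K, shift nab₀ (a t) ∈ kahlerConns n V

/-- `∇_t = ∇₀ - i a_t` is a solution of the (suitably normalized) negative gradient flow of the
squared norm of the moment map, for the metric defined by `sigma`:
`∂_t ∇_t = - (1/4) grad ‖μ̄‖²`, where at the time `t` the norm on `Lie(𝓖)*` is the one
determined by `∇_t`. -/
structure IsNegGradientFlow (sigma : Conn n V → OneForm n M ℝ → OneForm n M ℝ → ℝ)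
    (Om : TopForm n M) (nab₀ : Conn n V) (K : Set ℝ) (a : ℝ → OneForm n M ℝ) : Prop
    extends IsCurve nab₀ K a where
  flow : ∀ t ∈ K, ∃ G, IsGradient sigma (muNormSq Om (shift nab₀ (a t))) (shift nab₀ (a t)) G ∧
    ∀ (x : M) (v : Tan n x), HasDerivWithinAt (fun s => a s x v) (-(1 / 4) * G x v) K t

/-- `∇_t = ∇₀ - i a_t` is a solution of `∂_t A_{∇_t} = (1/2) I X_{μ̄(∇_t)}`. -/
structure IsMomentFlow (Om : TopForm n M) (nab₀ : Conn n V) (K : Set ℝ)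
    (a : ℝ → OneForm n M ℝ) : Prop extends IsCurve nab₀ K a where
  flow : ∀ t ∈ K, ∃ (ζ : LieGauge n M) (X : OneForm n M ℝ),
    (∀ x, ζ x = muSharp Om (shift nab₀ (a t)) x) ∧
    IsInfinitesimalAction (shift nab₀ (a t)) ζ X ∧
    ∀ (x : M) (v : Tan n x), HasDerivWithinAt (fun s => a s x v) (1 / 2 * compI X x v) K t

/-- `φ` is a solution on the time interval `K` of the `Ω`-Kähler flow
`∂φ_t/∂t = 1 - Ω / (w + i∂∂̄φ_t)ⁿ`, `φ_0 = 0`, with `w + i∂∂̄φ_t > 0`, starting at the Kähler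
form `w`. -/
structure IsOmegaKahlerFlow (Om : TopForm n M) (w : TwoForm n M ℝ) (K : Set ℝ)
    (φ : ℝ → M → ℝ) : Prop where
  smooth : ContMDiffOn (𝓘(ℝ, ℝ).prod (modelR n)) 𝓘(ℝ, ℝ) ∞ (fun q : ℝ × M => φ q.1 q.2)
    (K ×ˢ univ)
  zero : φ 0 = 0
  positive : ∀ t ∈ K, IsPositive (w + iddbar (φ t))
  flow : ∀ t ∈ K, ∀ x, HasDerivWithinAt (fun s => φ s x)
    (1 - topRatio Om (topPow (w + iddbar (φ t))) x) K t

end Bundles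
end KahlerFlow
end

noncomputable section

namespace KahlerFlow

/-! ### Exterior algebra of `ℂⁿ` -/

section LinearAlgebra

/-! The objects of the theorem depend on `∇` only through the two-form `F = F_∇`, and the theorem
becomes a calculation with `F` and integration by parts. In a local frame `∇ = d + θ`. Changing the
frame, or applying a gauge transformation, adds a logarithmic differential `G⁻¹ dG` to `θ`, and this
is closed (`fderiv_logDeriv_symm`, `logDeriv_smoothAt`). Hence `F` is well defined, locally exact
and gauge invariant, and passing from `∇` to `∇ - ia` adds `da` to it (`curv_gauge`, `curv_shift`).
For `g = exp(-itζ)` the added term is `-it dζ`, so `X_ζ = dζ` (`isInfinitesimalAction_dFun`). The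
pairing `⟨A_∇, ζ⟩` is `ζ` itself, since the vertical field has no horizontal component (`angle_eq`).

Three tools carry the symplectic part. The first is Stokes' theorem for products with closed
two-forms. A partition of unity reduces it to the vanishing of the integral of a derivative with
compact support, and closedness of the remaining factors enters through three-cycles in the sum over
permutations (`integral_sum_perm_eq_zero`). It yields the closedness of `ν`, from `d(a ∧ b ∧ c) ∧
F^{n-2}`, the identity `∫ ζ db ∧ F^{n-1} = ∫ b ∧ dζ ∧ F^{n-1}` (`integral_mulFun_extD`), and the
fact that `∫ Fⁿ` does not vary with `∇`. The second is pointwise positivity: in a unitary basis for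
`F` every term of `B ∧ F^{n-1}` is nonnegative when `B` is semipositive (`wedgeCoeff_pos`). With `B
= a ∧ Ia` this gives `ν(a, Ia) > 0`, hence non-degeneracy, and with `B = F` it gives `Fⁿ > 0`. The
third is that all functionals are polynomial in `t` along `∇ - itb`, so that differentiation is
extraction of the linear coefficient (`hasDerivAt_integral`).

The moment map identity is then `d/dt ∫ ζ Fⁿ = n ∫ ζ db ∧ F^{n-1} = n ν(b, dζ)`. Similarly, with the
norm frozen, the derivative of `‖μ̄‖²` along `b` is `2n ν(b, dμ̄♯) = n ν(-2 I dμ̄♯, Ib)`. Positivity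
makes the gradient unique, so it is `-2 I dμ̄♯`, and both (i) and (ii) say that `∂ₜa = ½ I dμ̄♯`
(`isNegGradientFlow_iff`, `isMomentFlow_iff`).

To reach (iii), set `φ_t = ∫₀ᵗ μ̄♯(∇_s) ds`. The forms `½ I dφ_t` and `a_t` have the same time
derivative and both vanish at time `0`, so they agree. Since `i∂∂̄φ = d(½ I dφ)` (`iddbar_eq`) and
`μ̄♯ = 1 - Ω/Fⁿ`, the definition of `φ` is the `Ω`-Kähler flow. Conversely, applying `½ I d` to that
flow gives the equation for `a_t`. The exchange of time and space derivatives must hold up to the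
endpoint `t = 0`, which is the purpose of the analysis on products of an interval and an open set.
-/

/-- A positive `J`-invariant two-form on a complex vector space has a unitary basis. -/
lemma exists_unitary_basis {E : Type*} [AddCommGroup E] [Module ℂ E] [Module ℝ E]
    [IsScalarTower ℝ ℂ E] [FiniteDimensional ℂ E] {n : ℕ} (hn : Module.finrank ℂ E = n)
    (F : E →ₗ[ℝ] E →ₗ[ℝ] ℝ) (hanti : ∀ v w, F v w = -F w v)
    (hJ : ∀ v w, F (Complex.I • v) (Complex.I • w) = F v w)
    (hpos : ∀ v, v ≠ 0 → 0 < F v (Complex.I • v)) :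
    ∃ u : Module.Basis (Fin n) ℂ E, (∀ j k, F (u j) (u k) = 0) ∧
      ∀ j k, F (u j) (Complex.I • u k) = if j = k then 1 else 0 := by
  have hII : ∀ v : E, Complex.I • Complex.I • v = -v := fun v => by
    rw [smul_smul, Complex.I_mul_I, neg_one_smul]
  have hJ1 : ∀ v w, F (Complex.I • v) w = -F v (Complex.I • w) := fun v w => by
    rw [← hJ v, hII, map_neg, neg_neg]
  have hre : ∀ (c : ℂ) (v : E), c • v = c.re • v + c.im • (Complex.I • v) := fun c v => by
    have h1 : ∀ (r : ℝ) (v : E), r • v = (r : ℂ) • v := fun r v => by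
      rw [← one_smul ℂ v, ← smul_assoc, ← smul_assoc]; simp
    rw [h1, h1, smul_smul, ← add_smul, Complex.re_add_im]
  -- The Hermitian inner product `F(x, iy) + i F(x, y)`, conjugate linear in `x`. The real and
  -- imaginary parts of orthonormality are the two families of identities required.
  let core : InnerProductSpace.Core ℂ E :=
    { inner := fun x y => (F x (Complex.I • y) : ℂ) + (F x y : ℂ) * Complex.I
      conj_inner_symm := fun x y => by
        have : F y (Complex.I • x) = F x (Complex.I • y) := by
          rw [hanti y, hJ1, neg_neg]
        simp only [map_add, map_mul, Complex.conj_ofReal, Complex.conj_I]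
        rw [this, hanti y x]
        push_cast
        ring
      re_inner_nonneg := fun x => by
        by_cases h : x = 0
        · simp [h]
        · have := (hpos x h).le
          simpa using this
      add_left := fun x y z => by
        simp only [map_add, LinearMap.add_apply]
        push_cast
        ring
      smul_left := fun x y r => by
        rw [hre r x]
        simp only [map_add, map_smul, LinearMap.add_apply, LinearMap.smul_apply, smul_eq_mul, hJ1,
          hII, map_neg]
        apply Complex.ext <;> simp
      definite := fun x h => by
        by_contra hx
        have h1 := congrArg Complex.re h
        have := hpos x hx
        simp at h1
        linarith }
  let _ : NormedAddCommGroup E := core.toNormedAddCommGroup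
  let _ : InnerProductSpace ℂ E := InnerProductSpace.ofCore core.toCore
  let b := (stdOrthonormalBasis ℂ E).reindex (finCongr hn)
  have hb : ∀ j k, (F (b j) (Complex.I • b k) : ℂ) + (F (b j) (b k) : ℂ) * Complex.I
      = if j = k then 1 else 0 := fun j k => orthonormal_iff_ite.mp b.orthonormal j k
  refine ⟨b.toBasis, fun j k => ?_, fun j k => ?_⟩
  · have := congrArg Complex.im (hb j k)
    rw [b.coe_toBasis]
    simp only [Complex.add_im, Complex.ofReal_im, Complex.mul_im, Complex.ofReal_re, Complex.I_im,
      mul_one, Complex.I_re, mul_zero, add_zero, zero_add] at this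
    rw [this]
    split_ifs <;> simp
  · have := congrArg Complex.re (hb j k)
    rw [b.coe_toBasis]
    simp only [Complex.add_re, Complex.ofReal_im, Complex.mul_re, Complex.ofReal_re, Complex.I_im,
      mul_one, Complex.I_re, mul_zero, sub_zero, add_zero] at this
    rw [this]
    split_ifs <;> simp

/-- A permutation of `Fin n × Fin 2` respecting the partition into pairs, as soon as it does so
for all pairs but one. -/
lemma perm_pair_of_ne {n : ℕ} (σ : Equiv.Perm (Fin n × Fin 2)) (j₀ : Fin n)
    (h : ∀ j, j ≠ j₀ → (σ (j, 0)).1 = (σ (j, 1)).1) (j : Fin n) :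
    (σ (j, 0)).1 = (σ (j, 1)).1 := by
  by_cases hj : j = j₀
  swap
  · exact h j hj
  subst hj
  -- The point of the target pair that is not `σ (j, 0)` has a preimage `(i, l)`. If `i ≠ j`, pair
  -- `i` is mapped into that same pair by assumption, which would put three distinct images in a set
  -- of two elements.
  obtain ⟨⟨i, l⟩, hil⟩ := σ.surjective ((σ (j, 0)).1, (σ (j, 0)).2 + 1)
  have hi1 : (σ (i, l)).1 = (σ (j, 0)).1 := by rw [hil]
  have hne2 : (σ (i, l)).2 ≠ (σ (j, 0)).2 := by
    rw [hil]
    intro hh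
    have : ∀ t : Fin 2, t + 1 ≠ t := by decide
    exact this _ hh
  have hij : i = j := by
    by_contra hne
    have hi := h i hne
    have h01 : (σ (i, 0)).1 = (σ (j, 0)).1 ∧ (σ (i, 1)).1 = (σ (j, 0)).1 := by
      have hl : l = 0 ∨ l = 1 := by omega
      rcases hl with rfl | rfl
      · exact ⟨hi1, hi ▸ hi1⟩
      · exact ⟨hi ▸ hi1, hi1⟩
    have e0 : (σ (i, 0)).2 ≠ (σ (j, 0)).2 := fun hh =>
      hne (congrArg Prod.fst (σ.injective (Prod.ext h01.1 hh)))
    have e1 : (σ (i, 1)).2 ≠ (σ (j, 0)).2 := fun hh =>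
      hne (congrArg Prod.fst (σ.injective (Prod.ext h01.2 hh)))
    have e2 : (σ (i, 0)).2 ≠ (σ (i, 1)).2 := fun hh => by
      have := congrArg Prod.snd (σ.injective (Prod.ext hi hh))
      simp at this
    omega
  subst hij
  have hl : l = 1 := by
    have : l = 0 ∨ l = 1 := by omega
    rcases this with rfl | rfl
    · exact absurd rfl hne2
    · rfl
  subst hl
  exact hi1.symm

/-- A permutation respecting the partition of `Fin n × Fin 2` into pairs is a permutation of the
pairs preceded by permutations within the pairs; its sign is that of the latter. -/
lemma perm_pair_decomp {n : ℕ} (σ : Equiv.Perm (Fin n × Fin 2))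
    (h : ∀ j, (σ (j, 0)).1 = (σ (j, 1)).1) :
    ∃ (ρ : Equiv.Perm (Fin n)) (τ : Fin n → Equiv.Perm (Fin 2)),
      (∀ j k, σ (j, k) = (ρ j, τ j k)) ∧ Equiv.Perm.sign σ = ∏ j, Equiv.Perm.sign (τ j) := by
  have h' : ∀ j k, (σ (j, k)).1 = (σ (j, 0)).1 := by
    intro j k
    have : k = 0 ∨ k = 1 := by omega
    rcases this with rfl | rfl
    · rfl
    · exact (h j).symm
  have hτ : ∀ j, Function.Bijective fun k => (σ (j, k)).2 := fun j =>
    Finite.injective_iff_bijective.mp fun k k' hk => by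
      have := σ.injective (Prod.ext ((h' j k).trans (h' j k').symm) hk)
      exact congrArg Prod.snd this
  have hρ : Function.Bijective fun j => (σ (j, 0)).1 := by
    refine Finite.injective_iff_bijective.mp fun j j' hj => ?_
    obtain ⟨k, hk⟩ := (hτ j').surjective (σ (j, 0)).2
    have := σ.injective (Prod.ext (hj.trans (h' j' k).symm) hk.symm : σ (j, 0) = σ (j', k))
    exact congrArg Prod.fst this
  let ρ : Equiv.Perm (Fin n) := Equiv.ofBijective _ hρ
  let τ : Fin n → Equiv.Perm (Fin 2) := fun j => Equiv.ofBijective _ (hτ j)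
  have hσ : ∀ j k, σ (j, k) = (ρ j, τ j k) := fun j k => Prod.ext (h' j k) rfl
  refine ⟨ρ, τ, hσ, ?_⟩
  -- The permutation of the pairs acts once on each of the two copies of `Fin n`, so its sign
  -- appears squared and drops out.
  have : σ = Equiv.prodCongrLeft (fun _ => ρ) * Equiv.prodCongrRight τ := by
    ext1 ⟨j, k⟩
    rw [hσ]
    rfl
  rw [this, map_mul, Equiv.Perm.sign_prodCongrLeft, Equiv.Perm.sign_prodCongrRight]
  simp

lemma sum_sign_smul_comp_even {ι : Type*} [Fintype ι] [DecidableEq ι] {W : Type*}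
    [AddCommGroup W] (c : Equiv.Perm ι) (hc : Equiv.Perm.sign c = 1)
    (f : Equiv.Perm ι → W) :
    ∑ σ, Equiv.Perm.sign σ • f (σ * c) = ∑ σ, Equiv.Perm.sign σ • f σ := by
  refine Fintype.sum_equiv (Equiv.mulRight c) _ _ fun σ => ?_
  simp [hc]

end LinearAlgebra

/-! ### Wedge products of two-forms: determinant rule, symmetry, expansion, positivity -/

section Wedge

variable {n : ℕ}

/-- Bilinear forms on `ℂⁿ`. -/
abbrev Bil (n : ℕ) := (Fin n → ℂ) →L[ℝ] (Fin n → ℂ) →L[ℝ] ℝ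

/-- The value of `G_0 ∧ ⋯ ∧ G_{n-1}` on a `2n`-tuple of vectors. -/
def wedgeVal (G : Fin n → Bil n) (v : Fin n × Fin 2 → Fin n → ℂ) : ℝ :=
  (1 / 2 : ℝ) ^ n * ∑ σ : Equiv.Perm (Fin n × Fin 2),
    Equiv.Perm.sign σ • ∏ j, G j (v (σ (j, 0))) (v (σ (j, 1)))

/-- The value of `G_0 ∧ ⋯ ∧ G_{n-1}` on the canonical frame. -/
abbrev wedgeCoeff (G : Fin n → Bil n) : ℝ := wedgeVal G (frame n)

lemma wedge_apply {M : Type*} [TopologicalSpace M] [ChartedSpace (Fin n → ℂ) M] {x : M}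
    (G : Fin n → (Tan n x →L[ℝ] Tan n x →L[ℝ] ℝ)) (v : Fin n × Fin 2 → Tan n x) :
    wedge G v = wedgeVal (n := n) G v := by
  rw [wedge, AlternatingMap.smul_apply, MultilinearMap.alternatization_apply]
  rfl

variable (n) in
/-- The canonical frame as a real basis. -/
def frameBasis : Module.Basis (Fin n × Fin 2) ℝ (Fin n → ℂ) :=
  Complex.basisOneI.smulTower' (Pi.basisFun ℂ (Fin n))

/-- Top-degree forms transform by the determinant. -/
lemma topForm_comp (η : (Fin n → ℂ) [⋀^Fin n × Fin 2]→ₗ[ℝ] ℝ) (L : (Fin n → ℂ) →ₗ[ℝ] Fin n → ℂ)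
    (v : Fin n × Fin 2 → Fin n → ℂ) : η (fun p => L (v p)) = LinearMap.det L * η v := by
  rw [η.eq_smul_basis_det (frameBasis n), AlternatingMap.smul_apply, AlternatingMap.smul_apply]
  have := (frameBasis n).det_comp L v
  rw [Function.comp_def] at this
  rw [this, smul_eq_mul, smul_eq_mul]
  ring

/-- The real determinant of a complex linear map is the square of the modulus of its complex
determinant. This is why a complex manifold carries a canonical orientation. -/
lemma det_restrictScalars_pos (L : (Fin n → ℂ) ≃ₗ[ℂ] Fin n → ℂ) :
    0 < LinearMap.det ((L : (Fin n → ℂ) →ₗ[ℂ] Fin n → ℂ).restrictScalars ℝ) := by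
  rw [LinearMap.det_restrictScalars, Algebra.norm_complex_eq]
  exact Complex.normSq_pos.mpr (LinearEquiv.isUnit_det' L).ne_zero

/-- `wedgeVal` as an alternating form. -/
def wedgeForm (G : Fin n → Bil n) : (Fin n → ℂ) [⋀^Fin n × Fin 2]→ₗ[ℝ] ℝ :=
  wedge (M := Fin n → ℂ) (x := 0) G

lemma wedgeForm_apply (G : Fin n → Bil n) (v) : wedgeForm G v = wedgeVal G v :=
  wedge_apply (M := Fin n → ℂ) (x := 0) G v

/-- Pull-back of a bilinear form. -/
def Bil.pull {W : Type*} [NormedAddCommGroup W] [NormedSpace ℝ W]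
    (B : (Fin n → ℂ) →L[ℝ] (Fin n → ℂ) →L[ℝ] W) (L : (Fin n → ℂ) →L[ℝ] Fin n → ℂ) :
    (Fin n → ℂ) →L[ℝ] (Fin n → ℂ) →L[ℝ] W := B.bilinearComp L L

@[simp] lemma Bil.pull_apply {W : Type*} [NormedAddCommGroup W] [NormedSpace ℝ W]
    (B : (Fin n → ℂ) →L[ℝ] (Fin n → ℂ) →L[ℝ] W) (L : (Fin n → ℂ) →L[ℝ] Fin n → ℂ)
    (v w : Fin n → ℂ) : Bil.pull B L v w = B (L v) (L w) := rfl

lemma wedgeVal_pull (G : Fin n → Bil n) (L : (Fin n → ℂ) →L[ℝ] Fin n → ℂ) (v) :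
    wedgeVal (fun j => Bil.pull (G j) L) v = wedgeVal G (fun p => L (v p)) := rfl

lemma wedgeCoeff_pull (G : Fin n → Bil n) (L : (Fin n → ℂ) →L[ℝ] Fin n → ℂ) :
    wedgeCoeff (fun j => Bil.pull (G j) L)
      = LinearMap.det (L : (Fin n → ℂ) →ₗ[ℝ] Fin n → ℂ) * wedgeCoeff G := by
  rw [wedgeCoeff, wedgeVal_pull, ← wedgeForm_apply, wedgeCoeff, ← wedgeForm_apply]
  exact topForm_comp _ (L : (Fin n → ℂ) →ₗ[ℝ] Fin n → ℂ) _

/-- The wedge product of two-forms is symmetric. -/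
lemma wedgeVal_perm (G : Fin n → Bil n) (ρ : Equiv.Perm (Fin n)) (v) :
    wedgeVal (fun j => G (ρ j)) v = wedgeVal G v := by
  unfold wedgeVal
  congr 1
  -- Permuting the factors permutes both entries of every pair, which is an even permutation.
  have hc : Equiv.Perm.sign (Equiv.prodCongrLeft (fun _ : Fin 2 => ρ)) = 1 := by
    rw [Equiv.Perm.sign_prodCongrLeft]; simp
  rw [← sum_sign_smul_comp_even _ hc]
  refine Finset.sum_congr rfl fun σ _ => ?_
  congr 1
  exact Equiv.prod_comp ρ (fun j => G j (v (σ (j, 0))) (v (σ (j, 1))))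

/-- Two-forms commute, so the slot occupied by `B` is irrelevant. Differentiating `Fⁿ` therefore
produces `n` equal terms, the origin of the factor in `n ν`. -/
lemma wedgeVal_update_eq [NeZero n] (G : Fin n → Bil n) (F B : Bil n) (hG : ∀ j, G j = F)
    (j : Fin n) (v) :
    wedgeVal (Function.update G j B) v = wedgeVal (Function.update (fun _ => F) 0 B) v := by
  rw [← wedgeVal_perm _ (Equiv.swap 0 j)]
  congr 1
  funext i
  by_cases hi : i = 0
  · subst hi; simp
  · rw [Function.update_of_ne hi]
    by_cases hij : i = j
    · subst hij
      rw [Equiv.swap_apply_right, Function.update_of_ne (Ne.symm hi), hG]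
    · rw [Equiv.swap_apply_of_ne_of_ne hi hij, Function.update_of_ne hij, hG]

/-- Expansion of `(F_0 + tA_0) ∧ ⋯ ∧ (F_{n-1} + tA_{n-1})`. -/
lemma wedgeVal_add_smul (F A : Fin n → Bil n) (t : ℝ) (v) :
    wedgeVal (fun j => F j + t • A j) v
      = ∑ s : Finset (Fin n), t ^ s.card * wedgeVal (s.piecewise A F) v := by
  unfold wedgeVal
  simp_rw [mul_left_comm (t ^ _) ((1 / 2 : ℝ) ^ n)]
  rw [← Finset.mul_sum]
  congr 1
  simp_rw [Finset.mul_sum]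
  rw [Finset.sum_comm]
  refine Finset.sum_congr rfl fun σ _ => ?_
  rw [← Finset.powerset_univ]
  simp_rw [mul_smul_comm]
  rw [← Finset.smul_sum]
  congr 1
  simp only [_root_.add_apply, _root_.smul_apply, smul_eq_mul]
  simp_rw [add_comm (F _ _ _)]
  rw [Finset.prod_add]
  refine Finset.sum_congr rfl fun s _ => ?_
  rw [Finset.prod_mul_distrib, Finset.prod_const, mul_assoc]
  congr 1
  rw [← Finset.prod_mul_prod_compl s (fun j => s.piecewise A F j (v (σ (j, 0))) (v (σ (j, 1)))),
    Finset.compl_eq_univ_sdiff]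
  congr 1
  · exact Finset.prod_congr rfl fun j hj => by rw [Finset.piecewise_eq_of_mem _ _ _ hj]
  · refine Finset.prod_congr rfl fun j hj => ?_
    rw [Finset.piecewise_eq_of_notMem _ _ _ (Finset.mem_sdiff.mp hj).2]

lemma wedgeVal_update (G : Fin n → Bil n) (j : Fin n) (B : Bil n) (v) :
    wedgeVal (Function.update G j B) v = (1 / 2 : ℝ) ^ n *
      ∑ σ : Equiv.Perm (Fin n × Fin 2), Equiv.Perm.sign σ • (B (v (σ (j, 0))) (v (σ (j, 1))) *
        ∏ i ∈ Finset.univ.erase j, G i (v (σ (i, 0))) (v (σ (i, 1)))) := by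
  unfold wedgeVal
  congr 1
  refine Finset.sum_congr rfl fun σ _ => ?_
  rw [← Finset.mul_prod_erase _ _ (Finset.mem_univ j), Function.update_self]
  congr 2
  exact Finset.prod_congr rfl fun i hi => by rw [Function.update_of_ne (Finset.ne_of_mem_erase hi)]

lemma wedgeVal_update_add (G : Fin n → Bil n) (j : Fin n) (B C : Bil n) (v) :
    wedgeVal (Function.update G j (B + C)) v
      = wedgeVal (Function.update G j B) v + wedgeVal (Function.update G j C) v := by
  simp only [wedgeVal_update, ← mul_add, ← Finset.sum_add_distrib, ← smul_add, ← add_mul,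
    _root_.add_apply]

lemma wedgeVal_update_smul (G : Fin n → Bil n) (j : Fin n) (r : ℝ) (B : Bil n) (v) :
    wedgeVal (Function.update G j (r • B)) v = r * wedgeVal (Function.update G j B) v := by
  simp only [wedgeVal_update, _root_.smul_apply, smul_eq_mul, mul_assoc]
  rw [mul_left_comm, Finset.mul_sum _ _ r]
  simp_rw [← mul_smul_comm]

/-! Positivity -/

lemma perm_fin_two (τ : Equiv.Perm (Fin 2)) : τ = 1 ∨ τ = Equiv.swap 0 1 := by
  revert τ; decide

/-- Positivity of `B ∧ F^{n-1}` in terms of a unitary basis for `F`. -/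
lemma wedgeVal_pos_of_unitary [NeZero n] (F B : Bil n)
    (hB : ∀ v w, B v w = -B w v) (u : Fin n × Fin 2 → Fin n → ℂ)
    (hu : ∀ j k l m, F (u (j, l)) (u (k, m))
      = if j = k then (if l = m then 0 else if l = 0 then 1 else -1) else 0)
    (hBu : ∀ j, 0 ≤ B (u (j, 0)) (u (j, 1))) (hBu' : ∃ j, 0 < B (u (j, 0)) (u (j, 1))) :
    0 < wedgeVal (Function.update (fun _ => F) 0 B) u := by
  rw [wedgeVal_update]
  refine mul_pos (by positivity) ?_
  -- For a permutation respecting the pairs, each transposition within a pair changes the sign of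
  -- one factor and also the sign of the permutation. The signs cancel and every such term equals a
  -- diagonal value of `B`.
  have key : ∀ σ : Equiv.Perm (Fin n × Fin 2), ∀ (ρ : Equiv.Perm (Fin n))
      (τ : Fin n → Equiv.Perm (Fin 2)), (∀ j k, σ (j, k) = (ρ j, τ j k)) →
      Equiv.Perm.sign σ = ∏ j, Equiv.Perm.sign (τ j) →
      Equiv.Perm.sign σ • (B (u (σ (0, 0))) (u (σ (0, 1))) *
        ∏ i ∈ Finset.univ.erase 0, F (u (σ (i, 0))) (u (σ (i, 1))))
      = B (u (ρ 0, 0)) (u (ρ 0, 1)) := by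
    intro σ ρ τ h hs
    have hBτ : B (u (σ (0, 0))) (u (σ (0, 1)))
        = ((Equiv.Perm.sign (τ 0) : ℤ) : ℝ) * B (u (ρ 0, 0)) (u (ρ 0, 1)) := by
      rw [h, h]
      rcases perm_fin_two (τ 0) with h0 | h0 <;> rw [h0]
      · simp
      · rw [Equiv.swap_apply_left, Equiv.swap_apply_right, hB,
          Equiv.Perm.sign_swap (by decide)]
        simp
    have hFτ : ∀ i, F (u (σ (i, 0))) (u (σ (i, 1))) = ((Equiv.Perm.sign (τ i) : ℤ) : ℝ) := by
      intro i
      rw [h, h, hu]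
      rcases perm_fin_two (τ i) with h0 | h0 <;> rw [h0]
      · simp
      · rw [Equiv.swap_apply_left, Equiv.swap_apply_right,
          Equiv.Perm.sign_swap (by decide)]
        simp
    rw [hBτ, Finset.prod_congr rfl fun i _ => hFτ i, mul_right_comm,
      Finset.mul_prod_erase Finset.univ (fun i => ((Equiv.Perm.sign (τ i) : ℤ) : ℝ))
        (Finset.mem_univ 0), Units.smul_def, zsmul_eq_mul, ← mul_assoc, hs]
    push_cast
    rw [← Finset.prod_mul_distrib]
    have : ∀ i, ((Equiv.Perm.sign (τ i) : ℤ) : ℝ) * ((Equiv.Perm.sign (τ i) : ℤ) : ℝ) = 1 := by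
      intro i
      rcases Int.units_eq_one_or (Equiv.Perm.sign (τ i)) with h | h <;> simp [h]
    simp [this]
  refine Finset.sum_pos' (fun σ _ => ?_) ?_
  · by_cases hσ : ∀ j, j ≠ 0 → (σ (j, 0)).1 = (σ (j, 1)).1
    · obtain ⟨ρ, τ, h, hs⟩ := perm_pair_decomp σ (perm_pair_of_ne σ 0 hσ)
      rw [key σ ρ τ h hs]
      exact hBu _
    -- Some pair other than the zeroth is sent to vectors attached to two different basis elements;
    -- these are `F`-orthogonal and the term vanishes.
    · push Not at hσ
      obtain ⟨j, hj, hne⟩ := hσ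
      have h0 : F (u (σ (j, 0))) (u (σ (j, 1))) = 0 := by
        have := hu (σ (j, 0)).1 (σ (j, 1)).1 (σ (j, 0)).2 (σ (j, 1)).2
        rwa [if_neg hne] at this
      rw [Finset.prod_eq_zero (Finset.mem_erase.mpr ⟨hj, Finset.mem_univ j⟩) h0, mul_zero,
        smul_zero]
  · obtain ⟨j, hj⟩ := hBu'
    -- Exchanging the whole pairs `0` and `j` places the strictly positive value of `B` in slot `0`.
    refine ⟨Equiv.prodCongrLeft (fun _ => Equiv.swap 0 j), Finset.mem_univ _, ?_⟩
    rw [key _ (Equiv.swap 0 j) (fun _ => 1) (fun _ _ => rfl)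
      (by rw [Equiv.Perm.sign_prodCongrLeft]; simp)]
    rwa [Equiv.swap_apply_left]

/-- Positivity of `B ∧ F^{n-1}` for a positive `(1,1)`-form `F` and a semipositive `B`. -/
lemma wedgeCoeff_pos [NeZero n] (F B : Bil n) (hF : ∀ v w, F v w = -F w v)
    (hFJ : ∀ v w, F (Complex.I • v) (Complex.I • w) = F v w)
    (hFpos : ∀ v, v ≠ 0 → 0 < F v (Complex.I • v))
    (hB : ∀ v w, B v w = -B w v) (hBnn : ∀ v, 0 ≤ B v (Complex.I • v))
    (hBpos : ∀ u : Module.Basis (Fin n) ℂ (Fin n → ℂ), ∃ j, 0 < B (u j) (Complex.I • u j)) :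
    0 < wedgeCoeff (Function.update (fun _ => F) 0 B) := by
  obtain ⟨u, hu0, hu1⟩ := exists_unitary_basis (E := Fin n → ℂ) (n := n) (by simp)
    (ContinuousLinearMap.coeLM ℝ ∘ₗ F.toLinearMap) hF hFJ hFpos
  replace hu0 : ∀ j k, F (u j) (u k) = 0 := hu0
  replace hu1 : ∀ j k, F (u j) (Complex.I • u k) = if j = k then 1 else 0 := hu1
  -- The complex linear map carrying the standard frame to the unitary frame. Its real determinant
  -- is positive, so the sign found on the unitary frame is also the sign on the standard one.
  let L : (Fin n → ℂ) ≃ₗ[ℂ] Fin n → ℂ := (Pi.basisFun ℂ (Fin n)).equiv u (Equiv.refl _)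
  have hL0 : ∀ j, L (frame n (j, 0)) = u j := fun j => by
    have := (Pi.basisFun ℂ (Fin n)).equiv_apply j u (Equiv.refl _)
    simpa [frame] using this
  have hL1 : ∀ j, L (frame n (j, 1)) = Complex.I • u j := fun j => by
    have : frame n (j, 1) = Complex.I • frame n (j, 0) := by
      simp [frame, ← Pi.single_smul]
    rw [this, map_smul, hL0]
  have hpos := wedgeVal_pos_of_unitary F B hB (fun p => L (frame n p))
    (fun j k l m => by
      have hl : l = 0 ∨ l = 1 := by omega
      have hm : m = 0 ∨ m = 1 := by omega
      rcases hl with rfl | rfl <;> rcases hm with rfl | rfl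
      · simp [hL0, hu0]
      · simp [hL0, hL1, hu1]
      · simp only [hL0, hL1]
        rw [hF, hu1]
        by_cases h : j = k
        · simp [h]
        · simp [h, Ne.symm h]
      · simp [hL1, hFJ, hu0])
    (fun j => by rw [hL0, hL1]; exact hBnn _)
    (by
      obtain ⟨j, hj⟩ := hBpos u
      exact ⟨j, by rwa [hL0, hL1]⟩)
  rw [← wedgeForm_apply] at hpos
  have := topForm_comp (wedgeForm (Function.update (fun _ => F) 0 B))
    ((L : (Fin n → ℂ) →ₗ[ℂ] Fin n → ℂ).restrictScalars ℝ) (frame n)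
  rw [wedgeCoeff, ← wedgeForm_apply]
  refine pos_of_mul_pos_right ?_ (det_restrictScalars_pos L).le
  rw [← this]
  exact hpos

lemma wedgeCoeff_pow_pos [NeZero n] (F : Bil n) (hF : ∀ v w, F v w = -F w v)
    (hFJ : ∀ v w, F (Complex.I • v) (Complex.I • w) = F v w)
    (hFpos : ∀ v, v ≠ 0 → 0 < F v (Complex.I • v)) : 0 < wedgeCoeff (fun _ => F) := by
  have := wedgeCoeff_pos F F hF hFJ hFpos hF
    (fun v => by
      by_cases h : v = 0
      · simp [h]
      · exact (hFpos v h).le)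
    (fun u => ⟨0, hFpos _ (u.ne_zero 0)⟩)
  rwa [show Function.update (fun _ : Fin n => F) 0 F = fun _ => F from
    Function.update_eq_self 0 (fun _ : Fin n => F)] at this

/-- `B ∧ F^{n-1}` is unchanged when `J` is applied to `B`, for `F` of type `(1,1)`. -/
lemma wedgeCoeff_update_J [NeZero n] (F B : Bil n) (Jn : (Fin n → ℂ) →L[ℝ] Fin n → ℂ)
    (hJn : ∀ v, Jn v = Complex.I • v)
    (hFJ : ∀ v w, F (Complex.I • v) (Complex.I • w) = F v w) :
    wedgeCoeff (Function.update (fun _ => F) 0 (Bil.pull B Jn))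
      = wedgeCoeff (Function.update (fun _ => F) 0 B) := by
  have h : Function.update (fun _ : Fin n => F) 0 (Bil.pull B Jn)
      = fun j => Bil.pull (Function.update (fun _ : Fin n => F) 0 B j) Jn := by
    funext j
    by_cases hj : j = 0
    · subst hj; simp
    · rw [Function.update_of_ne hj, Function.update_of_ne hj]
      ext v w
      rw [Bil.pull_apply, hJn, hJn, hFJ]
  rw [h, wedgeCoeff_pull]
  -- The real determinant of multiplication by `i` is `|iⁿ|² = 1`.
  have : (Jn : (Fin n → ℂ) →ₗ[ℝ] Fin n → ℂ)
      = (Complex.I • (LinearMap.id : (Fin n → ℂ) →ₗ[ℂ] Fin n → ℂ)).restrictScalars ℝ := by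
    refine LinearMap.ext fun v => ?_
    simp [hJn]
  rw [this, LinearMap.det_restrictScalars, LinearMap.det_smul, LinearMap.det_id,
    Algebra.norm_complex_eq]
  simp

end Wedge

end KahlerFlow

end

noncomputable section

namespace KahlerFlow

/-! ### Analysis on products of an interval and an open set -/

section Families

variable {E W : Type*} [NormedAddCommGroup E] [NormedSpace ℝ E]
  [NormedAddCommGroup W] [NormedSpace ℝ W]

/-- The sets of times considered: non-degenerate intervals containing `0`. -/
structure IsTimeSet (K : Set ℝ) : Prop where
  ordConnected : K.OrdConnected
  zero_mem : (0 : ℝ) ∈ K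
  uniqueDiffOn : UniqueDiffOn ℝ K
  subset_closure : K ⊆ closure (interior K)

variable {K : Set ℝ} {U : Set E}

/-- Restricting the derivative within `K ×ˢ U` to directions tangent to `U` gives a genuine
derivative because `U` is open, also when `t` is an endpoint of `K`. -/
lemma hasFDerivAt_slice (hU : IsOpen U) {a : ℝ → E → W}
    (ha : ContDiffOn ℝ ∞ (fun q : ℝ × E => a q.1 q.2) (K ×ˢ U)) {t : ℝ} {y : E} (ht : t ∈ K)
    (hy : y ∈ U) :
    HasFDerivAt (a t) ((fderivWithin ℝ (fun q : ℝ × E => a q.1 q.2) (K ×ˢ U) (t, y)).comp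
      (ContinuousLinearMap.inr ℝ ℝ E)) y := by
  have h1 := ((ha.differentiableOn (by simp)) (t, y) ⟨ht, hy⟩).hasFDerivWithinAt
  have h2 : HasFDerivAt (fun z : E => (t, z)) (ContinuousLinearMap.inr ℝ ℝ E) y :=
    hasFDerivAt_prodMk_right t y
  exact (h1.comp (s := U) (f := fun z : E => (t, z)) y h2.hasFDerivWithinAt
    (fun z hz => ⟨ht, hz⟩)).hasFDerivAt (hU.mem_nhds hy)

/-- The spatial differential of a smooth family is a smooth family. -/
lemma contDiffOn_fderiv_slice (hK : UniqueDiffOn ℝ K) (hU : IsOpen U) {a : ℝ → E → W}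
    (ha : ContDiffOn ℝ ∞ (fun q : ℝ × E => a q.1 q.2) (K ×ˢ U)) :
    ContDiffOn ℝ ∞ (fun q : ℝ × E => fderiv ℝ (a q.1) q.2) (K ×ˢ U) := by
  have h1 := ha.fderivWithin (m := ∞) (hK.prod hU.uniqueDiffOn) (by simp)
  refine (h1.clm_comp (contDiffOn_const (c := ContinuousLinearMap.inr ℝ ℝ E))).congr ?_
  rintro ⟨t, y⟩ ⟨ht, hy⟩
  exact (hasFDerivAt_slice hU ha ht hy).fderiv

/-- Time and space derivatives of a smooth family commute. -/
lemma hasDerivWithinAt_fderiv_slice (hK : IsTimeSet K) (hU : IsOpen U) {a : ℝ → E → W}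
    {b : E → W}
    (ha : ContDiffOn ℝ ∞ (fun q : ℝ × E => a q.1 q.2) (K ×ˢ U)) {t : ℝ} (ht : t ∈ K)
    (hb : ∀ y ∈ U, HasDerivWithinAt (fun s => a s y) (b y) K t) {y : E} (hy : y ∈ U) :
    HasDerivWithinAt (fun s => fderiv ℝ (a s) y) (fderiv ℝ b y) K t := by
  set A : ℝ × E → W := fun q => a q.1 q.2
  have hS : UniqueDiffOn ℝ (K ×ˢ U) := hK.uniqueDiffOn.prod hU.uniqueDiffOn
  have hA' := ha.fderivWithin (m := ∞) hS (by simp)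
  set A' := fderivWithin ℝ A (K ×ˢ U)
  have hA'd : HasFDerivWithinAt A' (fderivWithin ℝ A' (K ×ˢ U) (t, y)) (K ×ˢ U) (t, y) :=
    ((hA'.differentiableOn (by simp)) (t, y) ⟨ht, hy⟩).hasFDerivWithinAt
  set A'' := fderivWithin ℝ A' (K ×ˢ U) (t, y)
  -- The prescribed time derivative is the total derivative in the direction `(1, 0)`, hence
  -- differentiable in space; its spatial derivative is a mixed second derivative of the family.
  have hb' : ∀ z ∈ U, b z = A' (t, z) (1, 0) := by
    intro z hz
    have h1 := ((ha.differentiableOn (by simp)) (t, z) ⟨ht, hz⟩).hasFDerivWithinAt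
    have h2 : HasDerivWithinAt (fun s : ℝ => (s, z)) ((1 : ℝ), (0 : E)) K t :=
      ((hasDerivAt_id t).prodMk (hasDerivAt_const t z)).hasDerivWithinAt
    have h3 := h1.comp_hasDerivWithinAt t h2 (fun s (hs : s ∈ K) => mk_mem_prod hs hz)
    exact (hK.uniqueDiffOn t ht).eq_deriv _ (hb z hz) h3
  have hbd : HasFDerivAt b (((ContinuousLinearMap.apply ℝ W ((1 : ℝ), (0 : E))).comp A'').comp
      (ContinuousLinearMap.inr ℝ ℝ E)) y := by
    have h2 : HasFDerivAt (fun z : E => (t, z)) (ContinuousLinearMap.inr ℝ ℝ E) y :=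
      hasFDerivAt_prodMk_right t y
    have h3 := ((ContinuousLinearMap.apply ℝ W ((1 : ℝ), (0 : E))).hasFDerivAt.comp_hasFDerivWithinAt
      (t, y) hA'd).comp (s := U) (f := fun z : E => (t, z)) y h2.hasFDerivWithinAt
      (fun z hz => ⟨ht, hz⟩)
    refine (h3.hasFDerivAt (hU.mem_nhds hy)).congr_of_eventuallyEq ?_
    filter_upwards [hU.mem_nhds hy] with z hz
    exact hb' z hz
  have hsl : HasDerivWithinAt (fun s => (A' (s, y)).comp (ContinuousLinearMap.inr ℝ ℝ E))
      ((A'' (1, 0)).comp (ContinuousLinearMap.inr ℝ ℝ E)) K t := by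
    have h2 : HasDerivWithinAt (fun s : ℝ => (s, y)) ((1 : ℝ), (0 : E)) K t :=
      ((hasDerivAt_id t).prodMk (hasDerivAt_const t y)).hasDerivWithinAt
    have h3 := hA'd.comp_hasDerivWithinAt t h2 (fun s (hs : s ∈ K) => mk_mem_prod hs hy)
    exact (((ContinuousLinearMap.compL ℝ E (ℝ × E) W).flip
      (ContinuousLinearMap.inr ℝ ℝ E)).hasFDerivAt.comp_hasDerivWithinAt t h3)
  -- Symmetry of the second derivative persists at boundary points that are limits of interior
  -- points, hence also at time `0`.
  have hsymm : IsSymmSndFDerivWithinAt ℝ A (K ×ˢ U) (t, y) := by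
    refine (ha (t, y) ⟨ht, hy⟩).isSymmSndFDerivWithinAt ?_ hS ?_ ⟨ht, hy⟩
    · simp only [minSmoothness_of_isRCLikeNormedField]
      exact WithTop.coe_le_coe.mpr le_top
    · rw [interior_prod_eq, closure_prod_eq, hU.interior_eq]
      exact ⟨hK.subset_closure ht, subset_closure hy⟩
  have hval : fderiv ℝ b y = (A'' (1, 0)).comp (ContinuousLinearMap.inr ℝ ℝ E) := by
    rw [hbd.fderiv]
    ext v
    exact hsymm (0, v) (1, 0)
  rw [hval]
  refine hsl.congr_of_mem (fun s hs => ?_) ht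
  exact (hasFDerivAt_slice hU ha hs hy).fderiv

variable [FiniteDimensional ℝ E] [CompleteSpace W]

/-- Splitting the integral at `t₀` separates two effects. The moving endpoint contributes `h t₀ y₀`
by continuity, uniformly for nearby `y`; over the fixed interval one differentiates under the
integral sign. -/
lemma hasFDerivWithinAt_timeIntegral (hK : IsTimeSet K) (hU : IsOpen U) {h : ℝ → E → W}
    (hh : ContDiffOn ℝ 1 (fun q : ℝ × E => h q.1 q.2) (K ×ˢ U)) {t₀ : ℝ} {y₀ : E}
    (ht : t₀ ∈ K) (hy : y₀ ∈ U) :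
    HasFDerivWithinAt (fun q : ℝ × E => ∫ s in (0 : ℝ)..q.1, h s q.2)
      ((ContinuousLinearMap.fst ℝ ℝ E).smulRight (h t₀ y₀)
        + (∫ s in (0 : ℝ)..t₀, (fderivWithin ℝ (fun q : ℝ × E => h q.1 q.2) (K ×ˢ U) (s, y₀)).comp
            (ContinuousLinearMap.inr ℝ ℝ E)).comp (ContinuousLinearMap.snd ℝ ℝ E))
      (K ×ˢ U) (t₀, y₀) := by
  have hS : UniqueDiffOn ℝ (K ×ˢ U) := hK.uniqueDiffOn.prod hU.uniqueDiffOn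
  have hcont : ContinuousOn (fun q : ℝ × E => h q.1 q.2) (K ×ˢ U) := hh.continuousOn
  have hD : ContinuousOn (fun q : ℝ × E =>
      (fderivWithin ℝ (fun q : ℝ × E => h q.1 q.2) (K ×ˢ U) q).comp
        (ContinuousLinearMap.inr ℝ ℝ E)) (K ×ˢ U) :=
    (hh.continuousOn_fderivWithin hS le_rfl).clm_comp continuousOn_const
  have hsub : ∀ {s t : ℝ}, s ∈ K → t ∈ K → uIcc s t ⊆ K := fun hs ht =>
    hK.ordConnected.uIcc_subset hs ht
  have hslice : ∀ y ∈ U, ContinuousOn (fun s => h s y) K := fun y hy =>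
    hcont.comp (f := fun s => (s, y)) (by fun_prop) (fun s hs => ⟨hs, hy⟩)
  have hint : ∀ {s t : ℝ}, s ∈ K → t ∈ K → ∀ y ∈ U,
      IntervalIntegrable (fun s => h s y) volume s t := fun hs ht y hy =>
    ((hslice y hy).mono (hsub hs ht)).intervalIntegrable
  have hsplit : ∀ q ∈ K ×ˢ U, ∫ s in (0 : ℝ)..q.1, h s q.2
      = (∫ s in t₀..q.1, h s q.2) + ∫ s in (0 : ℝ)..t₀, h s q.2 := by
    rintro ⟨t, y⟩ ⟨h1, h2⟩
    rw [add_comm, intervalIntegral.integral_add_adjacent_intervals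
      (hint hK.zero_mem ht y h2) (hint ht h1 y h2)]
  refine HasFDerivWithinAt.congr' ?_ hsplit ⟨ht, hy⟩
  refine HasFDerivWithinAt.add ?_ ?_
  · rw [hasFDerivWithinAt_iff_isLittleO, Asymptotics.isLittleO_iff]
    intro ε hε
    have hc := hcont (t₀, y₀) ⟨ht, hy⟩
    rw [Metric.continuousWithinAt_iff] at hc
    obtain ⟨δ, hδ, hc⟩ := hc ε hε
    have : Metric.ball (t₀, y₀) δ ∩ (K ×ˢ U) ∈ 𝓝[K ×ˢ U] (t₀, y₀) := by
      rw [inter_comm]; exact inter_mem_nhdsWithin _ (Metric.ball_mem_nhds _ hδ)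
    filter_upwards [this] with q hq
    obtain ⟨t, y⟩ := q
    obtain ⟨hq1, htK, hyU⟩ := hq
    simp only [intervalIntegral.integral_same, sub_zero, ContinuousLinearMap.smulRight_apply,
      Prod.mk_sub_mk, ContinuousLinearMap.coe_fst']
    have e : (t - t₀) • h t₀ y₀ = ∫ _ in t₀..t, h t₀ y₀ := by
      rw [intervalIntegral.integral_const]
    rw [e, ← intervalIntegral.integral_sub (hint ht htK y hyU) intervalIntegrable_const]
    refine (intervalIntegral.norm_integral_le_of_norm_le_const (C := ε) ?_).trans ?_
    · intro s hs
      have hs' := uIoc_subset_uIcc hs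
      rw [← dist_eq_norm]
      refine (hc (x := (s, y)) ⟨hsub ht htK hs', hyU⟩ ?_).le
      rw [Metric.mem_ball, Prod.dist_eq, max_lt_iff] at hq1
      rw [Prod.dist_eq, max_lt_iff]
      refine ⟨lt_of_le_of_lt ?_ hq1.1, hq1.2⟩
      exact Real.dist_le_of_mem_uIcc hs' left_mem_uIcc |>.trans (by rw [dist_comm])
    · refine mul_le_mul_of_nonneg_left ?_ hε.le
      rw [Prod.norm_def]
      exact le_max_left _ _
  · have h2 : HasFDerivAt (fun y => ∫ s in (0 : ℝ)..t₀, h s y)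
        (∫ s in (0 : ℝ)..t₀, (fderivWithin ℝ (fun q : ℝ × E => h q.1 q.2) (K ×ˢ U) (s, y₀)).comp
            (ContinuousLinearMap.inr ℝ ℝ E)) y₀ := by
      -- On the compact product of the time interval and a small closed ball the spatial derivative
      -- is bounded; that constant is the dominating function.
      obtain ⟨r, hr, hrU⟩ := Metric.nhds_basis_closedBall.mem_iff.mp (hU.mem_nhds hy)
      have hcpt : IsCompact (uIcc 0 t₀ ×ˢ Metric.closedBall y₀ r) :=
        isCompact_uIcc.prod (isCompact_closedBall y₀ r)
      have hsubK : uIcc 0 t₀ ⊆ K := hsub hK.zero_mem ht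
      obtain ⟨C, hC⟩ := hcpt.exists_bound_of_continuousOn
        (hD.mono (prod_mono hsubK hrU))
      have hIoc : uIoc 0 t₀ ⊆ K := uIoc_subset_uIcc.trans hsubK
      refine intervalIntegral.hasFDerivAt_integral_of_dominated_of_fderiv_le
        (F' := fun y s => (fderivWithin ℝ (fun q : ℝ × E => h q.1 q.2) (K ×ˢ U) (s, y)).comp
            (ContinuousLinearMap.inr ℝ ℝ E)) (bound := fun _ => C)
        (Metric.closedBall_mem_nhds y₀ hr) ?_ (hint hK.zero_mem ht y₀ hy) ?_ ?_
        intervalIntegrable_const ?_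
      · filter_upwards [hU.mem_nhds hy] with y hy'
        exact ((hslice y hy').mono hIoc).aestronglyMeasurable measurableSet_uIoc
      · refine ContinuousOn.aestronglyMeasurable ?_ measurableSet_uIoc
        exact hD.comp (f := fun s => (s, y₀)) (by fun_prop) (fun s hs => ⟨hIoc hs, hy⟩)
      · refine Filter.Eventually.of_forall fun s hs y hy' => ?_
        exact hC (s, y) ⟨uIoc_subset_uIcc hs, hy'⟩
      · refine Filter.Eventually.of_forall fun s hs y hy' => ?_
        have h1 := ((hh.differentiableOn one_ne_zero) (s, y) ⟨hIoc hs, hrU hy'⟩).hasFDerivWithinAt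
        have h2 : HasFDerivAt (fun z : E => (s, z)) (ContinuousLinearMap.inr ℝ ℝ E) y :=
          hasFDerivAt_prodMk_right s y
        exact (h1.comp (s := U) (f := fun z : E => (s, z)) y h2.hasFDerivWithinAt
          (fun z hz => ⟨hIoc hs, hz⟩)).hasFDerivAt (hU.mem_nhds (hrU hy'))
    exact (h2.comp (t₀, y₀) (ContinuousLinearMap.snd ℝ ℝ E).hasFDerivAt).hasFDerivWithinAt

end Families

/-! ### Primitives in time of smooth families -/

section TimeIntegral

variable {E : Type} [NormedAddCommGroup E] [NormedSpace ℝ E] [FiniteDimensional ℝ E]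
  {K : Set ℝ} {U : Set E}

/-- The derivative of a time integral is the integrand plus a time integral of its spatial
derivative, which allows induction on `m`. The values of the latter lie in `E →L[ℝ] W`, so the
induction must run over all targets `W`, and `E` and `W` are kept in one universe for this. -/
lemma contDiffOn_timeIntegral_nat (hK : IsTimeSet K) (hU : IsOpen U) (m : ℕ) :
    ∀ (W : Type) [NormedAddCommGroup W] [NormedSpace ℝ W] [CompleteSpace W] (h : ℝ → E → W),
      ContDiffOn ℝ ∞ (fun q : ℝ × E => h q.1 q.2) (K ×ˢ U) →
      ContDiffOn ℝ m (fun q : ℝ × E => ∫ s in (0 : ℝ)..q.1, h s q.2) (K ×ˢ U) := by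
  have hS : UniqueDiffOn ℝ (K ×ˢ U) := hK.uniqueDiffOn.prod hU.uniqueDiffOn
  induction m with
  | zero =>
    intro W _ _ _ h hh
    rw [Nat.cast_zero, contDiffOn_zero]
    rintro ⟨t, y⟩ ⟨ht, hy⟩
    exact (hasFDerivWithinAt_timeIntegral hK hU (hh.of_le (by simp)) ht hy).continuousWithinAt
  | succ m ih =>
    intro W _ _ _ h hh
    rw [Nat.cast_succ, contDiffOn_succ_iff_hasFDerivWithinAt_of_uniqueDiffOn hS]
    refine ⟨by simp, _, ?_, fun q hq => hasFDerivWithinAt_timeIntegral hK hU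
      (hh.of_le (by simp)) hq.1 hq.2⟩
    have h1 := (hh.fderivWithin (m := ∞) hS (by simp)).clm_comp
      (contDiffOn_const (c := ContinuousLinearMap.inr ℝ ℝ E))
    have h2 := ih (E →L[ℝ] W) (fun s y =>
      (fderivWithin ℝ (fun q : ℝ × E => h q.1 q.2) (K ×ˢ U) (s, y)).comp
        (ContinuousLinearMap.inr ℝ ℝ E)) h1
    refine ContDiffOn.add ?_ (h2.clm_comp contDiffOn_const)
    exact contDiffOn_const.smulRight (hh.of_le (by exact_mod_cast le_top))

/-- The primitive in time of a smooth family is smooth. -/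
lemma contDiffOn_timeIntegral (hK : IsTimeSet K) (hU : IsOpen U) {h : ℝ → E → ℝ}
    (hh : ContDiffOn ℝ ∞ (fun q : ℝ × E => h q.1 q.2) (K ×ˢ U)) :
    ContDiffOn ℝ ∞ (fun q : ℝ × E => ∫ s in (0 : ℝ)..q.1, h s q.2) (K ×ˢ U) :=
  contDiffOn_infty.mpr fun m => contDiffOn_timeIntegral_nat hK hU m ℝ h hh

lemma hasDerivWithinAt_timeIntegral (hK : IsTimeSet K) (hU : IsOpen U) {h : ℝ → E → ℝ}
    (hh : ContDiffOn ℝ ∞ (fun q : ℝ × E => h q.1 q.2) (K ×ˢ U)) {t : ℝ} {y : E}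
    (ht : t ∈ K) (hy : y ∈ U) :
    HasDerivWithinAt (fun s => ∫ r in (0 : ℝ)..s, h r y) (h t y) K t := by
  have h2 : HasDerivWithinAt (fun s : ℝ => (s, y)) ((1 : ℝ), (0 : E)) K t :=
    ((hasDerivAt_id t).prodMk (hasDerivAt_const t y)).hasDerivWithinAt
  have := (hasFDerivWithinAt_timeIntegral hK hU (hh.of_le (by simp)) ht
    hy).comp_hasDerivWithinAt t h2 (fun s (hs : s ∈ K) => mk_mem_prod hs hy)
  simpa [Function.comp_def] using this

end TimeIntegral

/-- A function with vanishing derivative on an interval is constant. -/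
lemma IsTimeSet.eq_of_hasDerivWithinAt_eq {K : Set ℝ} (hK : IsTimeSet K) {f g f' : ℝ → ℝ}
    (hf : ∀ t ∈ K, HasDerivWithinAt f (f' t) K t) (hg : ∀ t ∈ K, HasDerivWithinAt g (f' t) K t)
    (h0 : f 0 = g 0) {t : ℝ} (ht : t ∈ K) : f t = g t := by
  have hd : ∀ t ∈ K, HasDerivWithinAt (fun s => f s - g s) 0 K t := fun t ht => by
    have := (hf t ht).fun_sub (hg t ht)
    rwa [sub_self] at this
  have := hK.ordConnected.convex.is_const_of_fderivWithin_eq_zero (𝕜 := ℝ)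
    (f := fun s => f s - g s)
    (fun t ht => (hd t ht).differentiableWithinAt) (fun t ht => by
      have := (hd t ht).hasFDerivWithinAt.fderivWithin (hK.uniqueDiffOn t ht)
      rw [this]; ext; simp) ht hK.zero_mem
  simp only [h0, sub_self] at this
  linarith

/-- The logarithmic differential of a function is closed. -/
lemma fderiv_logDeriv_symm {E : Type*} [NormedAddCommGroup E] [NormedSpace ℝ E] {G : E → ℂ}
    {y : E} (hG : ContDiffAt ℝ 2 G y) (h0 : G y ≠ 0) (v w : E) :
    fderiv ℝ (fun z => (G z)⁻¹ • fderiv ℝ G z) y v w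
      = fderiv ℝ (fun z => (G z)⁻¹ • fderiv ℝ G z) y w v := by
  have hs : IsSymmSndFDerivAt ℝ G y := hG.isSymmSndFDerivAt (by simp)
  have hd : HasFDerivAt G (fderiv ℝ G y) y := (hG.differentiableAt (by simp)).hasFDerivAt
  have hd2 : HasFDerivAt (fderiv ℝ G) (fderiv ℝ (fderiv ℝ G) y) y :=
    ((hG.fderiv_right (m := 1) (by norm_num)).differentiableAt (by simp)).hasFDerivAt
  have hinv : HasFDerivAt (fun z => (G z)⁻¹) (-((G y) ^ 2)⁻¹ • fderiv ℝ G y) y := by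
    have := (hasDerivAt_inv h0).comp_hasFDerivAt_of_eq y hd rfl
    exact this
  -- The derivative is `G⁻¹ D²G - G⁻² dG ⊗ dG`: the first term is symmetric as a second derivative,
  -- the second because multiplication in `ℂ` commutes.
  rw [(hinv.fun_smul hd2).fderiv]
  simp only [_root_.add_apply, _root_.smul_apply, ContinuousLinearMap.smulRight_apply,
    smul_eq_mul]
  rw [hs v w]
  ring

end KahlerFlow

end

noncomputable section

namespace KahlerFlow

/-! ### Stokes' theorem for compactly supported forms on open subsets of `ℂⁿ` -/

section LocalStokes

/-- Integration by parts against the constant function `1`. This is the only analytic source of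
Stokes' theorem below. -/
lemma integral_fderiv_eq_zero {E : Type*} [NormedAddCommGroup E] [NormedSpace ℝ E]
    [FiniteDimensional ℝ E] [MeasurableSpace E] [BorelSpace E] (μ : Measure E)
    [μ.IsAddHaarMeasure] {f : E → ℝ} (hf : ContDiff ℝ 1 f) (hc : HasCompactSupport f) (v : E) :
    ∫ x, fderiv ℝ f x v ∂μ = 0 := by
  have h1 : Integrable (fun x => fderiv ℝ f x v) μ :=
    ((hf.continuous_fderiv one_ne_zero).clm_apply continuous_const).integrable_of_hasCompactSupport
      (hc.fderiv_apply ℝ v)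
  have h2 : Integrable f μ := hf.continuous.integrable_of_hasCompactSupport hc
  have := integral_mul_fderiv_eq_neg_fderiv_mul_of_integrable (μ := μ) (f := fun _ : E => (1 : ℝ))
    (g := f) (v := v) (by simp) (by simpa using h1) (by simpa using h2)
    (fun x _ => differentiableAt_const _) (fun x _ => hf.differentiable one_ne_zero x)
  simpa using this

lemma sum_sign_smul_comp {ι : Type*} [Fintype ι] [DecidableEq ι] (c : Equiv.Perm ι)
    (f : Equiv.Perm ι → ℝ) :
    ∑ σ, Equiv.Perm.sign σ • f (σ * c) = Equiv.Perm.sign c • ∑ σ, Equiv.Perm.sign σ • f σ := by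
  rw [Finset.smul_sum]
  refine Fintype.sum_equiv (Equiv.mulRight c) _ _ fun σ => ?_
  simp only [Equiv.coe_mulRight, map_mul, smul_smul]
  rw [mul_comm (Equiv.Perm.sign c), mul_assoc, Int.units_mul_self, mul_one]

/-- Reindexing by an even permutation does not change the signed sum, so three times the sum is a
signed sum of cyclic sums. It converts the cyclic identity defining a closed two-form into a
cancellation among permutations. -/
lemma sum_sign_smul_eq_zero_of_cyclic {ι : Type*} [Fintype ι] [DecidableEq ι] (c : Equiv.Perm ι)
    (hc : Equiv.Perm.sign c = 1) (f : Equiv.Perm ι → ℝ)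
    (h : ∀ σ, f σ + f (σ * c) + f (σ * (c * c)) = 0) :
    ∑ σ, Equiv.Perm.sign σ • f σ = 0 := by
  have h1 := sum_sign_smul_comp c f
  have h2 := sum_sign_smul_comp (c * c) f
  rw [hc, one_smul] at h1
  rw [map_mul, hc, one_mul, one_smul] at h2
  have h3 : ∑ σ, Equiv.Perm.sign σ • f σ + ∑ σ, Equiv.Perm.sign σ • f (σ * c)
      + ∑ σ, Equiv.Perm.sign σ • f (σ * (c * c)) = 0 := by
    rw [← Finset.sum_add_distrib, ← Finset.sum_add_distrib]
    exact Finset.sum_eq_zero fun σ _ => by rw [← smul_add, ← smul_add, h, smul_zero]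
  rw [h1, h2] at h3
  linarith

variable {E : Type*} [NormedAddCommGroup E] [NormedSpace ℝ E]

/-- A smooth function on an open set extends by zero if it vanishes off a compact subset. -/
lemma contDiff_of_eq_zero_off {U C : Set E} (hU : IsOpen U) (hC : IsClosed C) (hCU : C ⊆ U)
    {f : E → ℝ} (hf : ContDiffOn ℝ ∞ f U) (h0 : ∀ y, y ∉ C → f y = 0) : ContDiff ℝ ∞ f := by
  rw [contDiff_iff_contDiffAt]
  intro y
  by_cases hy : y ∈ U
  · exact hf.contDiffAt (hU.mem_nhds hy)
  · have : f =ᶠ[𝓝 y] fun _ => 0 := by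
      filter_upwards [hC.isOpen_compl.mem_nhds (fun h => hy (hCU h))] with z hz
      exact h0 z hz
    exact contDiffAt_const.congr_of_eventuallyEq this

variable [FiniteDimensional ℝ E] [MeasurableSpace E] [BorelSpace E] (μ : Measure E)
  [μ.IsAddHaarMeasure]

/-- Stokes' theorem, for the product of a compactly supported form with closed two-forms. The
coefficient of the form is `m`, differentiated in the direction number `r`; the closed forms take
the directions `(i, 0)`, `(i, 1)`, `i ∈ S`. -/
lemma integral_sum_perm_eq_zero {n : ℕ} (e : Fin n × Fin 2 → E) {U C : Set E} (hU : IsOpen U)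
    (hC : IsCompact C) (hCU : C ⊆ U) (S : Finset (Fin n)) (r : Fin n × Fin 2) (hr : r.1 ∉ S)
    (m : Equiv.Perm (Fin n × Fin 2) → E → ℝ) (hm : ∀ σ, ContDiffOn ℝ ∞ (m σ) U)
    (hm0 : ∀ σ, ∀ y ∉ C, m σ y = 0)
    (hminv : ∀ σ c : Equiv.Perm (Fin n × Fin 2), (∀ p, p.1 ∉ S → p ≠ r → c p = p) →
      m (σ * c) = m σ)
    (F : Fin n → Fin n × Fin 2 → Fin n × Fin 2 → E → ℝ)
    (hF : ∀ i ∈ S, ∀ p q, ContDiffOn ℝ ∞ (F i p q) U)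
    (hFc : ∀ i ∈ S, ∀ y ∈ U, ∀ p q r, fderiv ℝ (F i q r) y (e p) + fderiv ℝ (F i r p) y (e q)
      + fderiv ℝ (F i p q) y (e r) = 0) :
    ∫ y in U, ∑ σ : Equiv.Perm (Fin n × Fin 2), Equiv.Perm.sign σ •
      (fderiv ℝ (m σ) y (e (σ r)) * ∏ i ∈ S, F i (σ (i, 0)) (σ (i, 1)) y) ∂μ = 0 := by
  let P : Finset (Fin n) → Equiv.Perm (Fin n × Fin 2) → E → ℝ := fun S' σ y =>
    ∏ i ∈ S', F i (σ (i, 0)) (σ (i, 1)) y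
  have hP : ∀ σ, ContDiffOn ℝ ∞ (P S σ) U := fun σ => contDiffOn_prod fun i hi => hF i hi _ _
  have hf : ∀ σ, ContDiff ℝ ∞ (fun y => m σ y * P S σ y) := fun σ =>
    contDiff_of_eq_zero_off hU hC.isClosed hCU ((hm σ).mul (hP σ)) fun y hy => by
      rw [hm0 σ y hy, zero_mul]
  have hcs : ∀ σ, HasCompactSupport (fun y => m σ y * P S σ y) := fun σ =>
    HasCompactSupport.intro hC fun y hy => by rw [hm0 σ y hy, zero_mul]
  have hint0 : ∫ y, ∑ σ, Equiv.Perm.sign σ • fderiv ℝ (fun y => m σ y * P S σ y) y (e (σ r)) ∂μ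
      = 0 := by
    rw [integral_finsetSum]
    · refine Finset.sum_eq_zero fun σ _ => ?_
      simp_rw [Units.smul_def, zsmul_eq_mul]
      rw [integral_const_mul, integral_fderiv_eq_zero μ ((hf σ).of_le (by simp)) (hcs σ), mul_zero]
    · intro σ _
      simp_rw [Units.smul_def, zsmul_eq_mul]
      refine Integrable.const_mul ?_ _
      exact (((hf σ).continuous_fderiv (by simp)).clm_apply
        continuous_const).integrable_of_hasCompactSupport ((hcs σ).fderiv_apply ℝ _)
  rw [← hint0]
  -- Off `U` the coefficients vanish in a whole neighbourhood, since `C` is closed and inside `U`;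
  -- thus their derivatives vanish too and the integral may be taken over all of `E`.
  have hoff : ∀ y ∉ U, ∑ σ : Equiv.Perm (Fin n × Fin 2), Equiv.Perm.sign σ •
      (fderiv ℝ (m σ) y (e (σ r)) * ∏ i ∈ S, F i (σ (i, 0)) (σ (i, 1)) y) = 0 := by
    intro y hy
    refine Finset.sum_eq_zero fun σ _ => ?_
    have : m σ =ᶠ[𝓝 y] fun _ => 0 := by
      filter_upwards [hC.isClosed.isOpen_compl.mem_nhds (fun h => hy (hCU h))] with z hz
      exact hm0 σ z hz
    rw [this.fderiv_eq]
    simp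
  rw [setIntegral_eq_integral_of_forall_compl_eq_zero hoff]
  refine integral_congr_ae (Filter.Eventually.of_forall fun y => ?_)
  by_cases hy : y ∈ U
  swap
  · simp only [hoff y hy]
    symm
    refine Finset.sum_eq_zero fun σ _ => ?_
    have : (fun y => m σ y * P S σ y) =ᶠ[𝓝 y] fun _ => 0 := by
      filter_upwards [hC.isClosed.isOpen_compl.mem_nhds (fun h => hy (hCU h))] with z hz
      rw [hm0 σ z hz, zero_mul]
    rw [this.fderiv_eq]
    simp
  -- Leibniz expansion of the total derivative, whose integral is zero. The first term is the
  -- desired integrand; the remaining ones, with a closed form differentiated, must cancel in the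
  -- sum over permutations.
  have hder : ∀ σ, fderiv ℝ (fun y => m σ y * P S σ y) y (e (σ r))
      = fderiv ℝ (m σ) y (e (σ r)) * P S σ y + ∑ i ∈ S, m σ y * (P (S.erase i) σ y *
        fderiv ℝ (F i (σ (i, 0)) (σ (i, 1))) y (e (σ r))) := by
    intro σ
    have h1 : HasFDerivAt (m σ) (fderiv ℝ (m σ) y) y :=
      (((hm σ).contDiffAt (hU.mem_nhds hy)).differentiableAt (by simp)).hasFDerivAt
    have h2 : HasFDerivAt (P S σ) (∑ i ∈ S, (P (S.erase i) σ y) •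
        fderiv ℝ (F i (σ (i, 0)) (σ (i, 1))) y) y :=
      HasFDerivAt.finsetProd fun i hi =>
        (((hF i hi _ _).contDiffAt (hU.mem_nhds hy)).differentiableAt (by simp)).hasFDerivAt
    rw [(h1.fun_mul h2).fderiv]
    simp only [_root_.add_apply, _root_.smul_apply, smul_eq_mul, _root_.sum_apply,
      Finset.mul_sum]
    rw [add_comm, mul_comm (P S σ y)]
  simp only [hder, smul_add, Finset.sum_add_distrib]
  rw [left_eq_add, Finset.sum_congr rfl fun σ _ => Finset.smul_sum, Finset.sum_comm]
  refine Finset.sum_eq_zero fun i hi => ?_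
  have hri : r ≠ (i, 0) ∧ r ≠ (i, 1) := by
    constructor <;> rintro rfl <;> exact hr hi
  have h01 : ((i, 0) : Fin n × Fin 2) ≠ (i, 1) := by simp
  -- The three-cycle on the differentiated direction and the two entries of factor `i`. It is even
  -- and leaves all other factors alone, so the sum over its powers is the closedness identity of
  -- that factor.
  obtain ⟨c, hcs, hcr, hc0, hc1, hcp⟩ : ∃ c : Equiv.Perm (Fin n × Fin 2),
      Equiv.Perm.sign c = 1 ∧ c r = (i, 0) ∧ c (i, 0) = (i, 1) ∧ c (i, 1) = r ∧
        ∀ p : Fin n × Fin 2, p ≠ r → p.1 ≠ i → c p = p := by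
    refine ⟨Equiv.swap r (i, 0) * Equiv.swap (i, 0) (i, 1), ?_, ?_, ?_, ?_, ?_⟩
    · rw [map_mul, Equiv.Perm.sign_swap hri.1, Equiv.Perm.sign_swap h01]
      rfl
    · rw [Equiv.Perm.mul_apply, Equiv.swap_apply_of_ne_of_ne hri.1 hri.2, Equiv.swap_apply_left]
    · rw [Equiv.Perm.mul_apply, Equiv.swap_apply_left,
        Equiv.swap_apply_of_ne_of_ne hri.2.symm h01.symm]
    · rw [Equiv.Perm.mul_apply, Equiv.swap_apply_right, Equiv.swap_apply_right]
    · intro p hp1 hp2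
      have hp0 : p ≠ (i, 0) := fun h => hp2 (by rw [h])
      have hp0' : p ≠ (i, 1) := fun h => hp2 (by rw [h])
      rw [Equiv.Perm.mul_apply, Equiv.swap_apply_of_ne_of_ne hp0 hp0',
        Equiv.swap_apply_of_ne_of_ne hp1 hp0]
  have hcfix : ∀ p : Fin n × Fin 2, p.1 ∉ S → p ≠ r → c p = p := fun p hp hpr =>
    hcp p hpr fun h => hp (h ▸ hi)
  have hPinv : ∀ σ : Equiv.Perm (Fin n × Fin 2), P (S.erase i) (σ * c) = P (S.erase i) σ := by
    intro σ
    funext z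
    refine Finset.prod_congr rfl fun k hk => ?_
    have hki := Finset.ne_of_mem_erase hk
    have hkr : ∀ l, (k, l) ≠ r := fun l h => hr (h ▸ Finset.mem_of_mem_erase hk)
    rw [Equiv.Perm.mul_apply, Equiv.Perm.mul_apply, hcp _ (hkr 0) hki, hcp _ (hkr 1) hki]
  refine sum_sign_smul_eq_zero_of_cyclic c hcs _ fun σ => ?_
  rw [← mul_assoc σ, hminv (σ * c) c hcfix, hminv σ c hcfix, hPinv, hPinv]
  simp only [Equiv.Perm.mul_apply, hcr, hc0, hc1]
  rw [hPinv, ← mul_add, ← mul_add, ← mul_add, ← mul_add, hFc i hi y hy, mul_zero, mul_zero]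

end LocalStokes

/-! ### Closed two-forms on open sets of a vector space -/

section Closed

variable {E W : Type*} [NormedAddCommGroup E] [NormedSpace ℝ E] [NormedAddCommGroup W]
  [NormedSpace ℝ W]

/-- The antisymmetrization `v, w ↦ A(v, w) - A(w, v)`. -/
def antisymm (A : E →L[ℝ] E →L[ℝ] W) : E →L[ℝ] E →L[ℝ] W := A - A.flip

@[simp] lemma antisymm_apply (A : E →L[ℝ] E →L[ℝ] W) (v w : E) :
    antisymm A v w = A v w - A w v := rfl

/-- A field of bilinear forms is smooth on a set. -/
def SmoothBil (F : E → E →L[ℝ] E →L[ℝ] W) (U : Set E) : Prop :=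
  ∀ v w, ContDiffOn ℝ ∞ (fun y => F y v w) U

/-- A field of bilinear forms is closed on a set. -/
def IsClosedBil (F : E → E →L[ℝ] E →L[ℝ] W) (U : Set E) : Prop :=
  ∀ y ∈ U, ∀ u v w, fderiv ℝ (fun z => F z v w) y u + fderiv ℝ (fun z => F z w u) y v
    + fderiv ℝ (fun z => F z u v) y w = 0

lemma fderiv_apply_vec {α : E → E →L[ℝ] W} {y : E} (hα : DifferentiableAt ℝ α y) (v w : E) :
    fderiv ℝ α y v w = fderiv ℝ (fun z => α z w) y v := by
  have h := (ContinuousLinearMap.apply ℝ W w).hasFDerivAt.comp y hα.hasFDerivAt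
  have h2 : HasFDerivAt (fun z => α z w) ((ContinuousLinearMap.apply ℝ W w).comp (fderiv ℝ α y)) y :=
    h
  rw [h2.fderiv]
  rfl

lemma smoothBil_antisymm_fderiv {U : Set E} (hU : IsOpen U)
    {α : E → E →L[ℝ] W} (hα : ContDiffOn ℝ ∞ α U) :
    SmoothBil (fun y => antisymm (fderiv ℝ α y)) U := by
  intro v w
  have h : ContDiffOn ℝ ∞ (fderiv ℝ α) U := hα.fderiv_of_isOpen hU (by simp)
  have h1 : ∀ v w, ContDiffOn ℝ ∞ (fun y => fderiv ℝ α y v w) U := fun v w =>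
    (h.clm_apply contDiffOn_const).clm_apply contDiffOn_const
  exact (h1 v w).sub (h1 w v)

/-- This is `d² = 0`: the six second derivatives in the cyclic sum cancel in pairs by symmetry. -/
lemma isClosedBil_antisymm_fderiv {U : Set E} (hU : IsOpen U)
    {α : E → E →L[ℝ] W} (hα : ContDiffOn ℝ ∞ α U) :
    IsClosedBil (fun y => antisymm (fderiv ℝ α y)) U := by
  have hc : ∀ w, ∀ y ∈ U, ContDiffAt ℝ ∞ (fun z => α z w) y := fun w y hy =>
    (hα.clm_apply contDiffOn_const).contDiffAt (hU.mem_nhds hy)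
  have hd : ∀ v w, ∀ y ∈ U, HasFDerivAt (fun z => fderiv ℝ (fun z => α z w) z v)
      ((ContinuousLinearMap.apply ℝ W v).comp (fderiv ℝ (fderiv ℝ (fun z => α z w)) y)) y := by
    intro v w y hy
    have h2 : DifferentiableAt ℝ (fderiv ℝ (fun z => α z w)) y :=
      ((hc w y hy).fderiv_right (m := ∞) (by simp)).differentiableAt (by simp)
    exact (ContinuousLinearMap.apply ℝ W v).hasFDerivAt.comp y h2.hasFDerivAt
  have hF : ∀ u v w, ∀ y ∈ U, fderiv ℝ (fun z => antisymm (fderiv ℝ α z) v w) y u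
      = fderiv ℝ (fderiv ℝ (fun z => α z w)) y u v
        - fderiv ℝ (fderiv ℝ (fun z => α z v)) y u w := by
    intro u v w y hy
    have h1 : (fun z => antisymm (fderiv ℝ α z) v w)
        =ᶠ[𝓝 y] fun z => fderiv ℝ (fun z => α z w) z v - fderiv ℝ (fun z => α z v) z w := by
      filter_upwards [hU.mem_nhds hy] with z hz
      have hz' : DifferentiableAt ℝ α z :=
        (hα.contDiffAt (hU.mem_nhds hz)).differentiableAt (by simp)
      rw [antisymm_apply, fderiv_apply_vec hz', fderiv_apply_vec hz']
    rw [h1.fderiv_eq, ((hd v w y hy).fun_sub (hd w v y hy)).fderiv]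
    rfl
  intro y hy u v w
  have hs : ∀ w, IsSymmSndFDerivAt ℝ (fun z => α z w) y := fun w =>
    (hc w y hy).isSymmSndFDerivAt (by
      simp only [minSmoothness_of_isRCLikeNormedField]
      exact WithTop.coe_le_coe.mpr le_top)
  rw [hF _ _ _ y hy, hF _ _ _ y hy, hF _ _ _ y hy, hs w u v, hs v u w, hs u v w]
  abel

end Closed

/-! ### Stokes' theorem for wedge products in a chart -/

section WedgeStokes

variable {n : ℕ}

/-- Exchanging the two entries of pair `j` is odd, so the two halves of the antisymmetrization
contribute equally. Exterior derivatives and wedge products of covectors may thus be replaced by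
plain bilinear forms, up to a factor `2`. -/
lemma wedgeVal_antisymm (G : Fin n → Bil n) (j : Fin n) (A : Bil n)
    (e : Fin n × Fin 2 → Fin n → ℂ) :
    wedgeVal (Function.update G j (antisymm A)) e = 2 * wedgeVal (Function.update G j A) e := by
  rw [wedgeVal_update, wedgeVal_update, mul_left_comm]
  congr 1
  simp only [antisymm_apply, sub_mul, smul_sub, Finset.sum_sub_distrib]
  have h01 : ((j, 0) : Fin n × Fin 2) ≠ (j, 1) := by simp
  have := sum_sign_smul_comp (Equiv.swap ((j, 0) : Fin n × Fin 2) (j, 1))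
    (fun σ => A (e (σ (j, 0))) (e (σ (j, 1))) *
        ∏ i ∈ Finset.univ.erase j, G i (e (σ (i, 0))) (e (σ (i, 1))))
  rw [Equiv.Perm.sign_swap h01] at this
  have h2 : ∀ σ : Equiv.Perm (Fin n × Fin 2),
      ∏ i ∈ Finset.univ.erase j, G i (e (σ (Equiv.swap (j, 0) (j, 1) (i, 0))))
        (e (σ (Equiv.swap (j, 0) (j, 1) (i, 1))))
      = ∏ i ∈ Finset.univ.erase j, G i (e (σ (i, 0))) (e (σ (i, 1))) := by
    intro σ
    refine Finset.prod_congr rfl fun i hi => ?_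
    have hij := Finset.ne_of_mem_erase hi
    rw [Equiv.swap_apply_of_ne_of_ne (by simp [hij]) (by simp [hij]),
      Equiv.swap_apply_of_ne_of_ne (by simp [hij]) (by simp [hij])]
  simp only [Equiv.Perm.mul_apply, Equiv.swap_apply_left, Equiv.swap_apply_right, h2] at this
  rw [this, Units.smul_def]
  simp only [Units.val_neg, Units.val_one, neg_smul, one_smul]
  ring

/-- Stokes' theorem on an open set: `∫ dβ ∧ H = 0` for a compactly supported one-form `β` and a
product `H` of closed two-forms. -/
lemma integral_wedge_fderiv_eq_zero {U C : Set (Fin n → ℂ)} (hU : IsOpen U)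
    (hC : IsCompact C) (hCU : C ⊆ U) (j : Fin n) (β : (Fin n → ℂ) → (Fin n → ℂ) →L[ℝ] ℝ)
    (hβ : ContDiffOn ℝ ∞ β U) (hβ0 : ∀ y ∉ C, β y = 0) (H : Fin n → (Fin n → ℂ) → Bil n)
    (hH : ∀ i, i ≠ j → SmoothBil (H i) U) (hHc : ∀ i, i ≠ j → IsClosedBil (H i) U) :
    ∫ y in U, wedgeCoeff (Function.update (fun i => H i y) j (antisymm (fderiv ℝ β y)))
      = 0 := by
  simp only [wedgeCoeff, wedgeVal_antisymm]
  simp only [wedgeVal_update]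
  rw [integral_const_mul, integral_const_mul]
  -- The first entry of pair `j` is the direction of differentiation, the second the argument of
  -- `β`; all other pairs carry closed forms.
  have h := integral_sum_perm_eq_zero (volume : Measure (Fin n → ℂ)) (frame n) hU hC hCU
    (Finset.univ.erase j) (j, 0) (by simp) (fun σ y => β y (frame n (σ (j, 1))))
    (fun σ => hβ.clm_apply contDiffOn_const) (fun σ y hy => by simp [hβ0 y hy])
    (fun σ c hc => by
      funext y
      rw [Equiv.Perm.mul_apply, hc (j, 1) (by simp) (by simp)])
    (fun i p q y => H i y (frame n p) (frame n q))
    (fun i hi p q => hH i (Finset.ne_of_mem_erase hi) _ _)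
    (fun i hi y hy p q r => hHc i (Finset.ne_of_mem_erase hi) y hy _ _ _)
  refine mul_eq_zero_of_right _ (mul_eq_zero_of_right _ (Eq.trans ?_ h))
  refine setIntegral_congr_fun hU.measurableSet fun y hy => ?_
  refine Finset.sum_congr rfl fun σ _ => ?_
  have hβd : DifferentiableAt ℝ β y :=
    (hβ.contDiffAt (hU.mem_nhds hy)).differentiableAt (by simp)
  simp only [fderiv_apply_vec hβd]

/-- Stokes' theorem on an open set: `∫ d(a ∧ b ∧ c) ∧ H = 0` for one-forms `a`, `b`, `c`, one of
which has compact support, and a product `H` of closed two-forms. -/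
lemma integral_wedge_cyclic_eq_zero {U C : Set (Fin n → ℂ)} (hU : IsOpen U)
    (hC : IsCompact C) (hCU : C ⊆ U) {k j : Fin n} (hjk : k ≠ j)
    (a b c : (Fin n → ℂ) → (Fin n → ℂ) →L[ℝ] ℝ)
    (ha : ContDiffOn ℝ ∞ a U) (hb : ContDiffOn ℝ ∞ b U) (hc : ContDiffOn ℝ ∞ c U)
    (ha0 : ∀ y ∉ C, a y = 0) (H : Fin n → (Fin n → ℂ) → Bil n)
    (hH : ∀ i, SmoothBil (H i) U) (hHc : ∀ i, IsClosedBil (H i) U) :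
    ∫ y in U, (wedgeCoeff (Function.update (Function.update (fun i => H i y) k
          (antisymm ((b y).smulRight (c y)))) j (antisymm (fderiv ℝ a y)))
      + wedgeCoeff (Function.update (Function.update (fun i => H i y) k
          (antisymm ((c y).smulRight (a y)))) j (antisymm (fderiv ℝ b y)))
      + wedgeCoeff (Function.update (Function.update (fun i => H i y) k
          (antisymm ((a y).smulRight (b y)))) j (antisymm (fderiv ℝ c y)))) = 0 := by
  let e := frame n
  let R : (Fin n → ℂ) → Equiv.Perm (Fin n × Fin 2) → ℝ := fun y σ =>
    ∏ i ∈ (Finset.univ.erase j).erase k, H i y (e (σ (i, 0))) (e (σ (i, 1)))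
  let X : ((Fin n → ℂ) → (Fin n → ℂ) →L[ℝ] ℝ) → ((Fin n → ℂ) → (Fin n → ℂ) →L[ℝ] ℝ) →
      ((Fin n → ℂ) → (Fin n → ℂ) →L[ℝ] ℝ) → (Fin n → ℂ) → Equiv.Perm (Fin n × Fin 2) → ℝ :=
    fun a b c y σ => fderiv ℝ a y (e (σ (j, 0))) (e (σ (j, 1))) *
      (b y (e (σ (k, 0))) * c y (e (σ (k, 1))) * R y σ)
  -- The constant `4` collects one factor `2` from the exterior derivative and one from the wedge
  -- product of the two covectors.
  have hX : ∀ (a b c : (Fin n → ℂ) → (Fin n → ℂ) →L[ℝ] ℝ) (y : Fin n → ℂ),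
      wedgeCoeff (Function.update (Function.update (fun i => H i y) k
          (antisymm ((b y).smulRight (c y)))) j (antisymm (fderiv ℝ a y)))
        = 4 * (1 / 2 : ℝ) ^ n * ∑ σ, Equiv.Perm.sign σ • X a b c y σ := by
    intro a b c y
    rw [wedgeCoeff, wedgeVal_antisymm, Function.update_comm hjk, wedgeVal_antisymm,
      Function.update_comm hjk.symm, wedgeVal_update, ← mul_assoc, ← mul_assoc]
    congr 1
    · ring
    · refine Finset.sum_congr rfl fun σ _ => ?_
      rw [← Finset.mul_prod_erase (Finset.univ.erase j) _
        (Finset.mem_erase.mpr ⟨hjk, Finset.mem_univ k⟩), Function.update_self]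
      congr 3
      refine Finset.prod_congr rfl fun i hi => ?_
      rw [Function.update_of_ne (Finset.ne_of_mem_erase hi)]
  simp only [hX, ← mul_add]
  rw [integral_const_mul]
  refine mul_eq_zero_of_right _ ?_
  have hkj : ∀ l m, ((k, l) : Fin n × Fin 2) ≠ (j, m) := fun l m h => hjk (congrArg Prod.fst h)
  have hk01 : ((k, 0) : Fin n × Fin 2) ≠ (k, 1) := by simp
  -- The even cycle on the three entries that receive `a`, `b` and `c`; the entry `(j, 0)`, along
  -- which one differentiates, stays fixed.
  obtain ⟨d, hds, hd0, hdp, hdq, hdj, hdi⟩ : ∃ d : Equiv.Perm (Fin n × Fin 2),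
      Equiv.Perm.sign d = 1 ∧ d (j, 1) = (k, 0) ∧ d (k, 0) = (k, 1) ∧ d (k, 1) = (j, 1) ∧
        d (j, 0) = (j, 0) ∧ ∀ p : Fin n × Fin 2, p.1 ≠ j → p.1 ≠ k → d p = p := by
    refine ⟨Equiv.swap (j, 1) (k, 0) * Equiv.swap (k, 0) (k, 1), ?_, ?_, ?_, ?_, ?_, ?_⟩
    · rw [map_mul, Equiv.Perm.sign_swap (hkj _ _).symm, Equiv.Perm.sign_swap hk01]
      rfl
    · rw [Equiv.Perm.mul_apply, Equiv.swap_apply_of_ne_of_ne (hkj _ _).symm (hkj _ _).symm,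
        Equiv.swap_apply_left]
    · rw [Equiv.Perm.mul_apply, Equiv.swap_apply_left,
        Equiv.swap_apply_of_ne_of_ne (hkj _ _) hk01.symm]
    · rw [Equiv.Perm.mul_apply, Equiv.swap_apply_right, Equiv.swap_apply_right]
    · rw [Equiv.Perm.mul_apply, Equiv.swap_apply_of_ne_of_ne (hkj _ _).symm (hkj _ _).symm,
        Equiv.swap_apply_of_ne_of_ne (by simp) (hkj _ _).symm]
    · intro p hp1 hp2
      have h1 : ∀ m, p ≠ (k, m) := fun m h => hp2 (by rw [h])
      have h2 : ∀ m, p ≠ (j, m) := fun m h => hp1 (by rw [h])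
      rw [Equiv.Perm.mul_apply, Equiv.swap_apply_of_ne_of_ne (h1 _) (h1 _),
        Equiv.swap_apply_of_ne_of_ne (h2 _) (h1 _)]
  have hRd : ∀ y σ, R y (σ * d) = R y σ := by
    intro y σ
    refine Finset.prod_congr rfl fun i hi => ?_
    have hik := Finset.ne_of_mem_erase hi
    have hij := Finset.ne_of_mem_erase (Finset.mem_of_mem_erase hi)
    rw [Equiv.Perm.mul_apply, Equiv.Perm.mul_apply, hdi (i, 0) hij hik, hdi (i, 1) hij hik]
  -- The differentiated coefficient is the product of the values of `a`, `b` and `c` on three of the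
  -- vectors. Pairs `j` and `k` are used up, and the closed forms occupy the others.
  have h := integral_sum_perm_eq_zero (volume : Measure (Fin n → ℂ)) e hU hC hCU
    ((Finset.univ.erase j).erase k) (j, 0) (by simp)
    (fun σ y => a y (e (σ (j, 1))) * (b y (e (σ (k, 0))) * c y (e (σ (k, 1)))))
    (fun σ => (ha.clm_apply contDiffOn_const).mul
      ((hb.clm_apply contDiffOn_const).mul (hc.clm_apply contDiffOn_const)))
    (fun σ y hy => by simp [ha0 y hy])
    (fun σ c hc => by
      have h1 := hc (j, 1) (by simp) (by simp)
      have h2 := hc (k, 0) (by simp) (hkj _ _)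
      have h3 := hc (k, 1) (by simp) (hkj _ _)
      simp only [Equiv.Perm.mul_apply, h1, h2, h3])
    (fun i p q y => H i y (e p) (e q)) (fun i _ p q => hH i _ _)
    (fun i _ y hy p q r => hHc i y hy _ _ _)
  refine Eq.trans ?_ h
  refine setIntegral_congr_fun hU.measurableSet fun y hy => ?_
  have hd : ∀ {α : (Fin n → ℂ) → (Fin n → ℂ) →L[ℝ] ℝ}, ContDiffOn ℝ ∞ α U →
      DifferentiableAt ℝ α y := fun hα => (hα.contDiffAt (hU.mem_nhds hy)).differentiableAt (by simp)
  have hd' : ∀ {α : (Fin n → ℂ) → (Fin n → ℂ) →L[ℝ] ℝ}, ContDiffOn ℝ ∞ α U → ∀ v,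
      DifferentiableAt ℝ (fun z => α z v) y := fun hα v =>
    ((hα.clm_apply contDiffOn_const).contDiffAt (hU.mem_nhds hy)).differentiableAt (by simp)
  -- Rotating the second sum once and the third sum twice lines up the arguments, so that the three
  -- terms become the Leibniz expansion of one product.
  have e2 : ∑ σ, Equiv.Perm.sign σ • X b c a y σ = ∑ σ, Equiv.Perm.sign σ • X b c a y (σ * d) := by
    rw [sum_sign_smul_comp, hds, one_smul]
  have e3 : ∑ σ, Equiv.Perm.sign σ • X c a b y σ
      = ∑ σ, Equiv.Perm.sign σ • X c a b y (σ * d * d) := by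
    rw [sum_sign_smul_comp d (fun σ => X c a b y (σ * d)), sum_sign_smul_comp, hds, one_smul,
      one_smul]
  rw [e2, e3, ← Finset.sum_add_distrib, ← Finset.sum_add_distrib]
  refine Finset.sum_congr rfl fun σ _ => ?_
  rw [← smul_add, ← smul_add]
  congr 1
  have hprod : fderiv ℝ (fun y => a y (e (σ (j, 1))) * (b y (e (σ (k, 0))) * c y (e (σ (k, 1))))) y
      (e (σ (j, 0)))
      = fderiv ℝ (fun z => a z (e (σ (j, 1)))) y (e (σ (j, 0))) * (b y (e (σ (k, 0))) *
          c y (e (σ (k, 1))))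
        + a y (e (σ (j, 1))) * (fderiv ℝ (fun z => b z (e (σ (k, 0)))) y (e (σ (j, 0))) *
          c y (e (σ (k, 1))) + b y (e (σ (k, 0))) *
          fderiv ℝ (fun z => c z (e (σ (k, 1)))) y (e (σ (j, 0)))) := by
    rw [(((hd' ha _).hasFDerivAt).fun_mul
      (((hd' hb _).hasFDerivAt).fun_mul ((hd' hc _).hasFDerivAt))).fderiv]
    simp only [_root_.add_apply, _root_.smul_apply, smul_eq_mul]
    ring
  have hR : ∏ i ∈ (Finset.univ.erase j).erase k, H i y (e (σ (i, 0))) (e (σ (i, 1))) = R y σ := rfl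
  rw [hprod, hR]
  simp only [X, hRd, Equiv.Perm.mul_apply, hd0, hdp, hdq, hdj, fderiv_apply_vec (hd ha),
    fderiv_apply_vec (hd hb), fderiv_apply_vec (hd hc)]
  ring

end WedgeStokes

end KahlerFlow

end

noncomputable section

namespace KahlerFlow

/-! ### Forms in charts -/

section Charts

variable {n : ℕ} {M : Type*} [TopologicalSpace M] [ChartedSpace (Fin n → ℂ) M]

/-- The coordinate change from the preferred chart at `c` to the preferred chart at `d`. -/
def transition (c d : M) (y : Fin n → ℂ) : Fin n → ℂ :=
  chartAt (Fin n → ℂ) d ((chartAt (Fin n → ℂ) c).symm y)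

/-- Where the coordinate change is defined. -/
def overlap (c d : M) : Set (Fin n → ℂ) :=
  (chartAt (Fin n → ℂ) c).target ∩
    (chartAt (Fin n → ℂ) c).symm ⁻¹' (chartAt (Fin n → ℂ) d).source

lemma isOpen_overlap (c d : M) : IsOpen (overlap (n := n) c d) :=
  (chartAt (Fin n → ℂ) c).isOpen_inter_preimage_symm (chartAt (Fin n → ℂ) d).open_source

lemma chartAt_symm_transition {c d : M} {y : Fin n → ℂ} (hy : y ∈ overlap c d) :
    (chartAt (Fin n → ℂ) d).symm (transition c d y) = (chartAt (Fin n → ℂ) c).symm y :=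
  (chartAt (Fin n → ℂ) d).left_inv hy.2

lemma transition_mem {c d : M} {y : Fin n → ℂ} (hy : y ∈ overlap c d) :
    transition c d y ∈ overlap d c := by
  refine ⟨(chartAt (Fin n → ℂ) d).map_source hy.2, ?_⟩
  rw [mem_preimage, chartAt_symm_transition hy]
  exact (chartAt (Fin n → ℂ) c).map_target hy.1

lemma transition_transition {c d : M} {y : Fin n → ℂ} (hy : y ∈ overlap c d) :
    transition d c (transition c d y) = y := by
  rw [transition, chartAt_symm_transition hy]
  exact (chartAt (Fin n → ℂ) c).right_inv hy.1

lemma mem_overlap_self {c : M} {y : Fin n → ℂ} (hy : y ∈ (chartAt (Fin n → ℂ) c).target) :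
    y ∈ overlap c ((chartAt (Fin n → ℂ) c).symm y) :=
  ⟨hy, mem_chart_source _ _⟩

lemma mem_overlap_of_mem {c d : M} {x : M} (hc : x ∈ (chartAt (Fin n → ℂ) c).source)
    (hd : x ∈ (chartAt (Fin n → ℂ) d).source) : chartAt (Fin n → ℂ) c x ∈ overlap c d :=
  ⟨(chartAt (Fin n → ℂ) c).map_source hc, by
    rwa [mem_preimage, (chartAt (Fin n → ℂ) c).left_inv hc]⟩

lemma transition_self {c : M} {y : Fin n → ℂ} (hy : y ∈ (chartAt (Fin n → ℂ) c).target) :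
    fderiv ℝ (transition c c) y = ContinuousLinearMap.id ℝ _ := by
  have : transition c c =ᶠ[𝓝 y] id := by
    filter_upwards [(chartAt (Fin n → ℂ) c).open_target.mem_nhds hy] with z hz
    exact (chartAt (Fin n → ℂ) c).right_inv hz
  rw [this.fderiv_eq, fderiv_id]

variable [IsManifold 𝓘(ℂ, Fin n → ℂ) ω M]

lemma contDiffOn_transition_complex (c d : M) :
    ContDiffOn ℂ ω (transition (n := n) c d) (overlap c d) := by
  have := (contDiffGroupoid ω 𝓘(ℂ, Fin n → ℂ)).compatible (chart_mem_atlas (Fin n → ℂ) c)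
    (chart_mem_atlas (Fin n → ℂ) d)
  rw [contDiffGroupoid, mem_groupoid_of_pregroupoid] at this
  have h1 := this.1
  simp only [contDiffPregroupoid] at h1
  have h2 : ContDiffOn ℂ ω (fun y => chartAt (Fin n → ℂ) d ((chartAt (Fin n → ℂ) c).symm y))
      (overlap c d) := by
    simpa [overlap, Function.comp_def] using h1
  exact h2

lemma contDiffAt_transition {c d : M} {y : Fin n → ℂ} (hy : y ∈ overlap c d) :
    ContDiffAt ℝ ∞ (transition c d) y :=
  ((((contDiffOn_transition_complex c d).restrict_scalars ℝ).of_le le_top).contDiffAt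
    ((isOpen_overlap c d).mem_nhds hy))

lemma differentiableAt_transition {c d : M} {y : Fin n → ℂ} (hy : y ∈ overlap c d) :
    DifferentiableAt ℝ (transition c d) y :=
  (contDiffAt_transition hy).differentiableAt (by simp)

lemma fderiv_transition_I {c d : M} {y : Fin n → ℂ} (hy : y ∈ overlap c d) (v : Fin n → ℂ) :
    fderiv ℝ (transition c d) y (Complex.I • v) = Complex.I • fderiv ℝ (transition c d) y v := by
  have h : DifferentiableAt ℂ (transition c d) y :=
    ((contDiffOn_transition_complex c d).contDiffAt
      ((isOpen_overlap c d).mem_nhds hy)).differentiableAt (by simp)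
  rw [h.fderiv_restrictScalars ℝ]
  simp

lemma fderiv_transition_comp {c d e : M} {y : Fin n → ℂ} (hy : y ∈ overlap c d)
    (hy' : y ∈ overlap c e) :
    (fderiv ℝ (transition d e) (transition c d y)).comp (fderiv ℝ (transition c d) y)
      = fderiv ℝ (transition c e) y := by
  have hde : transition c d y ∈ overlap d e := by
    refine ⟨(transition_mem hy).1, ?_⟩
    rw [mem_preimage, chartAt_symm_transition hy]
    exact hy'.2
  rw [← fderiv_comp y (differentiableAt_transition hde) (differentiableAt_transition hy)]
  refine Filter.EventuallyEq.fderiv_eq ?_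
  filter_upwards [(isOpen_overlap c d).mem_nhds hy] with z hz
  change transition d e (transition c d z) = _
  rw [transition, chartAt_symm_transition hz, transition]

/-- The differential of the coordinate change as a complex linear automorphism. -/
lemma exists_fderiv_transition_equiv {c d : M} {y : Fin n → ℂ} (hy : y ∈ overlap c d) :
    ∃ L : (Fin n → ℂ) ≃ₗ[ℂ] Fin n → ℂ, ∀ v, fderiv ℝ (transition c d) y v = L v := by
  have hcc : y ∈ overlap c c := ⟨hy.1, (chartAt (Fin n → ℂ) c).map_target hy.1⟩
  have hz := transition_mem hy
  have hdd : transition c d y ∈ overlap d d :=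
    ⟨hz.1, (chartAt (Fin n → ℂ) d).map_target hz.1⟩
  have h1 := fderiv_transition_comp hy hcc
  have h2 := fderiv_transition_comp hz hdd
  rw [transition_self hy.1] at h1
  rw [transition_self hz.1, transition_transition hy] at h2
  let f : (Fin n → ℂ) →ₗ[ℂ] Fin n → ℂ :=
    { toFun := fderiv ℝ (transition c d) y
      map_add' := map_add _
      map_smul' := fun r v => by
        have hr : ∀ w : Fin n → ℂ, r • w = r.re • w + r.im • (Complex.I • w) := fun w => by
          ext i
          simp only [Pi.smul_apply, Pi.add_apply, smul_eq_mul, Complex.real_smul]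
          rw [← mul_assoc, ← add_mul, Complex.re_add_im]
        rw [hr v, map_add, map_smul, map_smul, fderiv_transition_I hy, RingHom.id_apply,
          hr (fderiv ℝ (transition c d) y v)] }
  refine ⟨LinearEquiv.ofBijective f ⟨fun v w hvw => ?_, fun v => ?_⟩, fun v => rfl⟩
  · have := congrArg (fderiv ℝ (transition d c) (transition c d y)) hvw
    have e : ∀ v, fderiv ℝ (transition d c) (transition c d y) (f v) = v := fun v =>
      DFunLike.congr_fun h1 v
    rwa [e, e] at this
  · exact ⟨_, DFunLike.congr_fun h2 v⟩

lemma det_fderiv_transition_pos {c d : M} {y : Fin n → ℂ} (hy : y ∈ overlap c d) :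
    0 < LinearMap.det (fderiv ℝ (transition c d) y : (Fin n → ℂ) →ₗ[ℝ] Fin n → ℂ) := by
  obtain ⟨L, hL⟩ := exists_fderiv_transition_equiv hy
  have : (fderiv ℝ (transition c d) y : (Fin n → ℂ) →ₗ[ℝ] Fin n → ℂ)
      = (L : (Fin n → ℂ) →ₗ[ℂ] Fin n → ℂ).restrictScalars ℝ := LinearMap.ext hL
  rw [this]
  exact det_restrictScalars_pos L

/-- The differential of the inverse chart, with the tangent spaces identified with `ℂⁿ`. -/
def jac (c : M) (y : Fin n → ℂ) : (Fin n → ℂ) →L[ℝ] Fin n → ℂ := chartInvDeriv c y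

/-- Tangent vectors at a point are stored in the preferred chart at that very point. The
differential of an inverse chart is therefore the differential of a coordinate change whose target
chart varies with `y`. -/
lemma jac_eq {c : M} {y : Fin n → ℂ} (hy : y ∈ (chartAt (Fin n → ℂ) c).target) :
    jac c y = fderiv ℝ (transition c ((chartAt (Fin n → ℂ) c).symm y)) y := by
  have h : MDifferentiableAt 𝓘(ℝ, Fin n → ℂ) (modelR n) (chartAt (Fin n → ℂ) c).symm y :=
    mdifferentiableAt_atlas_symm (chart_mem_atlas _ _) hy
  rw [jac, chartInvDeriv, h.mfderiv]
  simp only [writtenInExtChartAt, mfld_simps, fderivWithin_univ]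
  rfl

lemma jac_transition {c d : M} {y : Fin n → ℂ} (hy : y ∈ overlap c d) :
    (jac d (transition c d y)).comp (fderiv ℝ (transition c d) y) = jac c y := by
  rw [jac_eq hy.1, jac_eq (transition_mem hy).1]
  simp only [chartAt_symm_transition hy]
  exact fderiv_transition_comp hy (mem_overlap_self hy.1)

lemma jac_self (x : M) : jac x (chartAt (Fin n → ℂ) x x) = ContinuousLinearMap.id ℝ _ := by
  rw [jac_eq (mem_chart_target _ x)]
  simp only [(chartAt (Fin n → ℂ) x).left_inv (mem_chart_source _ x)]
  exact transition_self (mem_chart_target _ x)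

lemma jac_I {c : M} {y : Fin n → ℂ} (hy : y ∈ (chartAt (Fin n → ℂ) c).target)
    (v : Fin n → ℂ) : jac c y (Complex.I • v) = Complex.I • jac c y v := by
  rw [jac_eq hy]
  exact fderiv_transition_I (mem_overlap_self hy) v

lemma det_jac_pos {c : M} {y : Fin n → ℂ} (hy : y ∈ (chartAt (Fin n → ℂ) c).target) :
    0 < LinearMap.det (jac c y : (Fin n → ℂ) →ₗ[ℝ] Fin n → ℂ) := by
  rw [jac_eq hy]
  exact det_fderiv_transition_pos (mem_overlap_self hy)

end Charts

end KahlerFlow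

end

/-! ### One-forms across charts: smoothness and naturality of `d` -/

noncomputable section

namespace KahlerFlow

/-- Naturality of the exterior derivative of one-forms on a vector space. -/
lemma antisymm_fderiv_pullback {E G W : Type*} [NormedAddCommGroup E] [NormedSpace ℝ E]
    [NormedAddCommGroup G] [NormedSpace ℝ G] [NormedAddCommGroup W] [NormedSpace ℝ W]
    {F : G → G →L[ℝ] W} {f : E → G} {y : E} (hF : DifferentiableAt ℝ F (f y))
    (hf : ContDiffAt ℝ 2 f y) (v w : E) :
    antisymm (fderiv ℝ (fun z => (F (f z)).comp (fderiv ℝ f z)) y) v w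
      = antisymm (fderiv ℝ F (f y)) (fderiv ℝ f y v) (fderiv ℝ f y w) := by
  have hf1 : DifferentiableAt ℝ f y := hf.differentiableAt (by simp)
  have hf2 : DifferentiableAt ℝ (fderiv ℝ f) y :=
    (hf.fderiv_right (m := 1) (by norm_num)).differentiableAt (by simp)
  have h1 : HasFDerivAt (fun z => F (f z)) _ y := hF.hasFDerivAt.comp y hf1.hasFDerivAt
  have h2 := h1.clm_comp hf2.hasFDerivAt
  -- The second derivative of the coordinate change is symmetric and disappears on antisymmetrizing.
  have hsymm : fderiv ℝ (fderiv ℝ f) y v w = fderiv ℝ (fderiv ℝ f) y w v :=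
    (hf.isSymmSndFDerivAt (by simp)).eq v w
  rw [antisymm_apply, antisymm_apply, h2.fderiv]
  simp [hsymm]

section Charts

variable {n : ℕ} {M : Type*} [TopologicalSpace M] [ChartedSpace (Fin n → ℂ) M]
  {W : Type*} [NormedAddCommGroup W] [NormedSpace ℝ W]

/-- The value of a one-form at a point, with the tangent space identified with `ℂⁿ`. -/
def OneForm.val (α : OneForm n M W) (x : M) : (Fin n → ℂ) →L[ℝ] W := α x

/-- The value of a two-form at a point, with the tangent space identified with `ℂⁿ`. -/
def TwoForm.val (G : TwoForm n M W) (x : M) : (Fin n → ℂ) →L[ℝ] (Fin n → ℂ) →L[ℝ] W := G x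

lemma OneForm.inChart_eq (α : OneForm n M W) (c : M) (y : Fin n → ℂ) :
    OneForm.inChart α c y
      = (OneForm.val α ((chartAt (Fin n → ℂ) c).symm y)).comp (jac c y) := rfl

/-- Smoothness of a one-form near a point. -/
def OneForm.SmoothAt (α : OneForm n M W) (x : M) : Prop :=
  ContDiffAt ℝ ∞ (OneForm.inChart α x) (chartAt (Fin n → ℂ) x x)

/-- The two-form `G` in the preferred chart at `c`. -/
def TwoForm.inChart (G : TwoForm n M W) (c : M) (y : Fin n → ℂ) :
    (Fin n → ℂ) →L[ℝ] (Fin n → ℂ) →L[ℝ] W :=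
  Bil.pull (TwoForm.val G ((chartAt (Fin n → ℂ) c).symm y)) (jac c y)

lemma TwoForm.inChart_eq (G : TwoForm n M W) (c : M) (y : Fin n → ℂ) :
    TwoForm.inChart G c y
      = Bil.pull (TwoForm.val G ((chartAt (Fin n → ℂ) c).symm y)) (jac c y) := rfl

lemma val_extD (α : OneForm n M W) (x : M) :
    TwoForm.val (extD α) x = antisymm (fderiv ℝ (OneForm.inChart α x) (chartAt (Fin n → ℂ) x x)) := rfl

lemma extD_antisymm (α : OneForm n M W) (x : M) (v w : Tan n x) :
    extD α x v w = -extD α x w v := by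
  have : ∀ A : (Fin n → ℂ) →L[ℝ] (Fin n → ℂ) →L[ℝ] W, ∀ v w,
      antisymm A v w = -antisymm A w v := fun A v w => (neg_sub _ _).symm
  exact this _ v w

lemma OneForm.inChart_smul (r : ℝ) (α : OneForm n M W) (c : M) :
    OneForm.inChart (r • α) c = r • OneForm.inChart α c := rfl

lemma OneForm.SmoothAt.add {α β : OneForm n M W} {x : M} (hα : OneForm.SmoothAt α x)
    (hβ : OneForm.SmoothAt β x) : OneForm.SmoothAt (α + β) x := ContDiffAt.add hα hβ

lemma OneForm.SmoothAt.sub {α β : OneForm n M W} {x : M} (hα : OneForm.SmoothAt α x)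
    (hβ : OneForm.SmoothAt β x) : OneForm.SmoothAt (α - β) x := ContDiffAt.sub hα hβ

lemma OneForm.SmoothAt.clm {W' : Type*} [NormedAddCommGroup W'] [NormedSpace ℝ W'] (l : W →L[ℝ] W')
    {α : OneForm n M W} {x : M} (hα : OneForm.SmoothAt α x) :
    OneForm.SmoothAt (fun x => l.comp (α x)) x := by
  have h : ContDiffAt ℝ ∞ (fun y => l.comp (OneForm.inChart α x y)) (chartAt (Fin n → ℂ) x x) :=
    ContDiffAt.clm_comp contDiffAt_const hα
  exact h

lemma OneForm.SmoothAt.differentiableAt {α : OneForm n M W} {x : M}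
    (hα : OneForm.SmoothAt α x) :
    DifferentiableAt ℝ (OneForm.inChart α x) (chartAt (Fin n → ℂ) x x) :=
  ContDiffAt.differentiableAt hα (by simp)

lemma extD_add {α β : OneForm n M W} {x : M} (hα : OneForm.SmoothAt α x)
    (hβ : OneForm.SmoothAt β x) : extD (α + β) x = extD α x + extD β x := by
  have key : ∀ {f g : (Fin n → ℂ) → (Fin n → ℂ) →L[ℝ] W} {y}, DifferentiableAt ℝ f y →
      DifferentiableAt ℝ g y →
      antisymm (fderiv ℝ (f + g) y) = antisymm (fderiv ℝ f y) + antisymm (fderiv ℝ g y) := by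
    intro f g y hf hg
    rw [fderiv_add hf hg]
    ext v w
    simp only [antisymm_apply, _root_.add_apply]
    abel
  exact key hα.differentiableAt hβ.differentiableAt

lemma extD_smul {α : OneForm n M W} {x : M} (r : ℝ) (hα : OneForm.SmoothAt α x) :
    extD (r • α) x = r • extD α x := by
  have key : ∀ {f : (Fin n → ℂ) → (Fin n → ℂ) →L[ℝ] W} {y}, DifferentiableAt ℝ f y →
      antisymm (fderiv ℝ (r • f) y) = r • antisymm (fderiv ℝ f y) := by
    intro f y hf
    rw [fderiv_const_smul hf]
    ext v w
    simp only [antisymm_apply, _root_.smul_apply, smul_sub]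
  exact key hα.differentiableAt

lemma extD_clm {W' : Type*} [NormedAddCommGroup W'] [NormedSpace ℝ W'] (l : W →L[ℝ] W')
    {α : OneForm n M W} {x : M} (hα : OneForm.SmoothAt α x) (v w : Tan n x) :
    extD (fun x => l.comp (α x)) x v w = l (extD α x v w) := by
  have key : ∀ {f : (Fin n → ℂ) → (Fin n → ℂ) →L[ℝ] W} {y}, DifferentiableAt ℝ f y → ∀ v w,
      antisymm (fderiv ℝ (fun z => l.comp (f z)) y) v w = l (antisymm (fderiv ℝ f y) v w) := by
    intro f y hf v w
    have h := (hasFDerivAt_const l y).clm_comp hf.hasFDerivAt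
    rw [antisymm_apply, antisymm_apply, h.fderiv]
    simp
  exact key hα.differentiableAt v w

variable [IsManifold 𝓘(ℂ, Fin n → ℂ) ω M]

lemma OneForm.inChart_self (α : OneForm n M W) (x : M) :
    OneForm.inChart α x (chartAt (Fin n → ℂ) x x) = OneForm.val α x := by
  rw [OneForm.inChart_eq, jac_self, (chartAt (Fin n → ℂ) x).left_inv (mem_chart_source _ x)]
  rfl

lemma OneForm.inChart_transition (α : OneForm n M W) {c d : M} {y : Fin n → ℂ}
    (hy : y ∈ overlap c d) : OneForm.inChart α c y
      = (OneForm.inChart α d (transition c d y)).comp (fderiv ℝ (transition c d) y) := by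
  rw [OneForm.inChart_eq, OneForm.inChart_eq, ← jac_transition hy, chartAt_symm_transition hy]
  rfl

lemma OneForm.inChart_eventuallyEq (α : OneForm n M W) {c d : M} {y : Fin n → ℂ}
    (hy : y ∈ overlap c d) : OneForm.inChart α c =ᶠ[𝓝 y] fun z =>
      (OneForm.inChart α d (transition c d z)).comp (fderiv ℝ (transition c d) z) := by
  filter_upwards [(isOpen_overlap c d).mem_nhds hy] with z hz
  exact OneForm.inChart_transition α hz

lemma OneForm.contDiffAt_inChart_of (α : OneForm n M W) {c d : M} {y : Fin n → ℂ}
    (hy : y ∈ overlap c d)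
    (h : ContDiffAt ℝ ∞ (OneForm.inChart α d) (transition c d y)) :
    ContDiffAt ℝ ∞ (OneForm.inChart α c) y := by
  refine ContDiffAt.congr_of_eventuallyEq ?_ (OneForm.inChart_eventuallyEq α hy)
  have h1 : ContDiffAt ℝ ∞ (fun z => OneForm.inChart α d (transition c d z)) y :=
    ContDiffAt.comp y h (contDiffAt_transition hy)
  exact h1.clm_comp ((contDiffAt_transition hy).fderiv_right (m := ∞) (by simp))

lemma OneForm.SmoothAt.inChart {α : OneForm n M W} {c : M} {y : Fin n → ℂ}
    (hy : y ∈ (chartAt (Fin n → ℂ) c).target)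
    (h : OneForm.SmoothAt α ((chartAt (Fin n → ℂ) c).symm y)) :
    ContDiffAt ℝ ∞ (OneForm.inChart α c) y :=
  OneForm.contDiffAt_inChart_of α (mem_overlap_self hy) h

lemma OneForm.smoothAt_of_inChart {α : OneForm n M W} {c x : M}
    (hx : x ∈ (chartAt (Fin n → ℂ) c).source)
    (h : ContDiffAt ℝ ∞ (OneForm.inChart α c) (chartAt (Fin n → ℂ) c x)) :
    OneForm.SmoothAt α x := by
  refine OneForm.contDiffAt_inChart_of α (d := c) (mem_overlap_of_mem (mem_chart_source _ x) hx) ?_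
  rwa [transition, (chartAt (Fin n → ℂ) x).left_inv (mem_chart_source _ x)]

/-- Coordinate changes are smooth, so at each point it is enough to test the chart centred there,
which is also the chart that defines `extD`. -/
lemma OneForm.smooth_iff {α : OneForm n M W} :
    α.Smooth ↔ ∀ x, OneForm.SmoothAt α x := by
  refine ⟨fun h x => (h x).contDiffAt ((chartAt _ x).open_target.mem_nhds (mem_chart_target _ x)),
    fun h c y hy => ((h _).inChart hy).contDiffWithinAt⟩

/-- The exterior derivative is computed by the coordinate expression in any preferred chart. -/
lemma extD_inChart {α : OneForm n M W} {c : M} {y : Fin n → ℂ}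
    (hy : y ∈ (chartAt (Fin n → ℂ) c).target)
    (h : OneForm.SmoothAt α ((chartAt (Fin n → ℂ) c).symm y)) (v w : Fin n → ℂ) :
    TwoForm.inChart (extD α) c y v w = antisymm (fderiv ℝ (OneForm.inChart α c) y) v w := by
  rw [TwoForm.inChart_eq, val_extD, Bil.pull_apply, jac_eq hy]
  have h1 := antisymm_fderiv_pullback (f := transition c ((chartAt (Fin n → ℂ) c).symm y))
    (OneForm.SmoothAt.differentiableAt h)
    ((contDiffAt_transition (mem_overlap_self hy)).of_le (WithTop.coe_le_coe.mpr le_top)) v w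
  have h2 := (OneForm.inChart_eventuallyEq α (mem_overlap_self hy)).fderiv_eq (𝕜 := ℝ)
  rw [antisymm_apply] at h1 ⊢
  rw [h2]
  exact h1.symm

end Charts

end KahlerFlow

end

noncomputable section

namespace KahlerFlow

/-! ### Functions, their differentials and the Leibniz rule -/

section Functions

variable {n : ℕ} {M : Type*} [TopologicalSpace M] [ChartedSpace (Fin n → ℂ) M]
  {W : Type*} [NormedAddCommGroup W] [NormedSpace ℝ W]

/-- The differential of a vector-valued function, as a one-form. -/
def vdFun (φ : M → W) : OneForm n M W := fun x => mvfderiv (modelR n) φ x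

lemma dFun_eq_vdFun (φ : M → ℝ) : dFun (n := n) φ = vdFun φ := rfl

/-- The product of a function and a one-form. -/
def OneForm.mulFun (φ : M → ℝ) (α : OneForm n M W) : OneForm n M W := fun x => φ x • α x

lemma OneForm.inChart_mulFun (φ : M → ℝ) (α : OneForm n M W) (c : M) :
    OneForm.inChart (OneForm.mulFun φ α) c
      = fun y => φ ((chartAt (Fin n → ℂ) c).symm y) • OneForm.inChart α c y := rfl

variable [IsManifold 𝓘(ℂ, Fin n → ℂ) ω M]

lemma contMDiffAt_of_chart {φ : M → W} {c x : M} (hx : x ∈ (chartAt (Fin n → ℂ) c).source)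
    (h : ContDiffAt ℝ ∞ (fun y => φ ((chartAt (Fin n → ℂ) c).symm y))
      (chartAt (Fin n → ℂ) c x)) : ContMDiffAt (modelR n) 𝓘(ℝ, W) ∞ φ x := by
  have h1 : ContMDiffOn (modelR n) (modelR n) ∞ (chartAt (Fin n → ℂ) c)
    (chartAt (Fin n → ℂ) c).source := contMDiffOn_chart
  have h2 := h.contMDiffAt.comp x
    (h1.contMDiffAt ((chartAt (Fin n → ℂ) c).open_source.mem_nhds hx))
  refine h2.congr_of_eventuallyEq ?_
  filter_upwards [(chartAt (Fin n → ℂ) c).open_source.mem_nhds hx] with z hz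
  rw [Function.comp_apply, (chartAt (Fin n → ℂ) c).left_inv hz]

lemma contDiffAt_comp_chart_symm {φ : M → W} {c : M} {y : Fin n → ℂ}
    (hy : y ∈ (chartAt (Fin n → ℂ) c).target)
    (h : ContMDiffAt (modelR n) 𝓘(ℝ, W) ∞ φ ((chartAt (Fin n → ℂ) c).symm y)) :
    ContDiffAt ℝ ∞ (fun y => φ ((chartAt (Fin n → ℂ) c).symm y)) y := by
  have h1 : ContMDiffOn (modelR n) (modelR n) ∞ (chartAt (Fin n → ℂ) c).symm
    (chartAt (Fin n → ℂ) c).target := contMDiffOn_chart_symm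
  exact contMDiffAt_iff_contDiffAt.mp (h.comp y
    (h1.contMDiffAt ((chartAt (Fin n → ℂ) c).open_target.mem_nhds hy)))

lemma contMDiff_iff_chart {φ : M → W} : ContMDiff (modelR n) 𝓘(ℝ, W) ∞ φ ↔
    ∀ c, ContDiffOn ℝ ∞ (fun y => φ ((chartAt (Fin n → ℂ) c).symm y))
      (chartAt (Fin n → ℂ) c).target := by
  refine ⟨fun h c y hy => (contDiffAt_comp_chart_symm hy (h _)).contDiffWithinAt,
    fun h x => contMDiffAt_of_chart (mem_chart_source _ x) ?_⟩
  exact (h x).contDiffAt ((chartAt (Fin n → ℂ) x).open_target.mem_nhds (mem_chart_target _ x))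

lemma inChart_vdFun {φ : M → W} {c : M} {y : Fin n → ℂ}
    (hy : y ∈ (chartAt (Fin n → ℂ) c).target)
    (h : MDifferentiableAt (modelR n) 𝓘(ℝ, W) φ ((chartAt (Fin n → ℂ) c).symm y)) :
    OneForm.inChart (vdFun φ) c y
      = fderiv ℝ (fun z => φ ((chartAt (Fin n → ℂ) c).symm z)) y := by
  have h1 : MDifferentiableAt 𝓘(ℝ, Fin n → ℂ) (modelR n) (chartAt (Fin n → ℂ) c).symm y :=
    mdifferentiableAt_atlas_symm (chart_mem_atlas _ _) hy
  have h2 := mfderiv_comp y h h1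
  rw [← mfderiv_eq_fderiv]
  exact h2.symm

lemma inChart_vdFun_eventuallyEq {φ : M → W} {c : M} {y : Fin n → ℂ}
    (hy : y ∈ (chartAt (Fin n → ℂ) c).target)
    (h : ∀ᶠ x in 𝓝 ((chartAt (Fin n → ℂ) c).symm y), MDifferentiableAt (modelR n) 𝓘(ℝ, W) φ x) :
    OneForm.inChart (vdFun φ) c =ᶠ[𝓝 y]
      fderiv ℝ (fun z => φ ((chartAt (Fin n → ℂ) c).symm z)) := by
  filter_upwards [((chartAt (Fin n → ℂ) c).continuousAt_symm hy).eventually h,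
    (chartAt (Fin n → ℂ) c).open_target.mem_nhds hy] with z hz hz'
  exact inChart_vdFun hz' hz

lemma vdFun_smooth {φ : M → W} (h : ContMDiff (modelR n) 𝓘(ℝ, W) ∞ φ) :
    (vdFun (n := n) φ).Smooth := by
  intro c
  refine ((contMDiff_iff_chart.mp h c).fderiv_of_isOpen (m := ∞)
    (chartAt (Fin n → ℂ) c).open_target (by simp)).congr fun y hy => ?_
  exact inChart_vdFun hy ((h _).mdifferentiableAt (by simp))

lemma extD_vdFun {φ : M → W} (h : ContMDiff (modelR n) 𝓘(ℝ, W) ∞ φ) :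
    extD (vdFun (n := n) φ) = 0 := by
  funext x
  have h1 := inChart_vdFun_eventuallyEq (mem_chart_target (Fin n → ℂ) x)
    (Filter.Eventually.of_forall fun z => (h z).mdifferentiableAt (by simp))
  have h2 : ContDiffAt ℝ ∞ (fun y => φ ((chartAt (Fin n → ℂ) x).symm y))
      (chartAt (Fin n → ℂ) x x) := contDiffAt_comp_chart_symm (mem_chart_target _ x) (h _)
  have key : ∀ {f : (Fin n → ℂ) → (Fin n → ℂ) →L[ℝ] W} {g : (Fin n → ℂ) → W} {y},
      f =ᶠ[𝓝 y] fderiv ℝ g → ContDiffAt ℝ ∞ g y → antisymm (fderiv ℝ f y) = 0 := by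
    intro f g y hfg hg
    have hs : IsSymmSndFDerivAt ℝ g y := hg.isSymmSndFDerivAt (by
      simp only [minSmoothness_of_isRCLikeNormedField]
      exact WithTop.coe_le_coe.mpr le_top)
    rw [hfg.fderiv_eq]
    ext v w
    rw [antisymm_apply, hs v w, sub_self]
    rfl
  exact key h1 h2

lemma OneForm.SmoothAt.mulFun {φ : M → ℝ} {α : OneForm n M W} {x : M}
    (hφ : ContMDiffAt (modelR n) 𝓘(ℝ, ℝ) ∞ φ x) (hα : OneForm.SmoothAt α x) :
    OneForm.SmoothAt (OneForm.mulFun φ α) x := by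
  have h : ContDiffAt ℝ ∞ (fun y => φ ((chartAt (Fin n → ℂ) x).symm y))
      (chartAt (Fin n → ℂ) x x) := contDiffAt_comp_chart_symm (mem_chart_target _ x) (by
        rwa [(chartAt (Fin n → ℂ) x).left_inv (mem_chart_source _ x)])
  exact ContDiffAt.smul h hα

lemma extD_mulFun {φ : M → ℝ} {α : OneForm n M W} {x : M}
    (hφ : ContMDiff (modelR n) 𝓘(ℝ, ℝ) ∞ φ) (hα : OneForm.SmoothAt α x) (v w : Tan n x) :
    extD (OneForm.mulFun φ α) x v w
      = φ x • extD α x v w + (dFun φ x v • α x w - dFun φ x w • α x v) := by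
  have h1 : ContDiffAt ℝ ∞ (fun y => φ ((chartAt (Fin n → ℂ) x).symm y))
      (chartAt (Fin n → ℂ) x x) := contDiffAt_comp_chart_symm (mem_chart_target _ x) (hφ _)
  have h2 := inChart_vdFun (mem_chart_target (Fin n → ℂ) x)
    ((hφ _).mdifferentiableAt (by simp))
  have key : ∀ {f : (Fin n → ℂ) → (Fin n → ℂ) →L[ℝ] W} {g : (Fin n → ℂ) → ℝ} {y},
      DifferentiableAt ℝ f y → DifferentiableAt ℝ g y → ∀ v w,
      antisymm (fderiv ℝ (fun z => g z • f z) y) v w = g y • antisymm (fderiv ℝ f y) v w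
        + (fderiv ℝ g y v • f y w - fderiv ℝ g y w • f y v) := by
    intro f g y hf hg v w
    rw [antisymm_apply, antisymm_apply, (hg.hasFDerivAt.fun_smul hf.hasFDerivAt).fderiv]
    simp only [_root_.add_apply, _root_.smul_apply, ContinuousLinearMap.smulRight_apply, smul_sub]
    abel
  have h3 := key hα.differentiableAt (h1.differentiableAt (by simp)) v w
  rw [← h2, OneForm.inChart_self, OneForm.inChart_self,
    (chartAt (Fin n → ℂ) x).left_inv (mem_chart_source _ x)] at h3
  exact h3

end Functions

/-! ### The complex structure in charts -/

section ComplexStructure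

variable {n : ℕ} {M : Type*} [TopologicalSpace M] [ChartedSpace (Fin n → ℂ) M]

variable (n) in
/-- Multiplication by `i` on `ℂⁿ` as a real linear map. -/
def mulI : (Fin n → ℂ) →L[ℝ] Fin n → ℂ := ContinuousLinearMap.lsmul ℝ ℂ Complex.I

lemma mulI_apply (v : Fin n → ℂ) : mulI n v = Complex.I • v := rfl

lemma mulI_mulI (v : Fin n → ℂ) : mulI n (mulI n v) = -v := by
  rw [mulI_apply, mulI_apply, smul_smul, Complex.I_mul_I, neg_one_smul]

lemma val_compI (a : OneForm n M ℝ) (x : M) :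
    OneForm.val (compI a) x = -(OneForm.val a x).comp (mulI n) := rfl

variable [IsManifold 𝓘(ℂ, Fin n → ℂ) ω M]

lemma inChart_compI (a : OneForm n M ℝ) {c : M} {y : Fin n → ℂ}
    (hy : y ∈ (chartAt (Fin n → ℂ) c).target) :
    OneForm.inChart (compI a) c y = -(OneForm.inChart a c y).comp (mulI n) := by
  rw [OneForm.inChart_eq, OneForm.inChart_eq, val_compI]
  ext v
  simp only [ContinuousLinearMap.neg_comp, _root_.neg_apply, ContinuousLinearMap.comp_apply,
    mulI_apply, jac_I hy]

lemma OneForm.Smooth.compI {a : OneForm n M ℝ} (ha : a.Smooth) : (compI a).Smooth := by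
  intro c
  refine ((ha c).clm_comp (contDiffOn_const (c := mulI n))).neg.congr fun y hy => ?_
  exact inChart_compI a hy

lemma OneForm.Smooth.at {W : Type*} [NormedAddCommGroup W] [NormedSpace ℝ W] {α : OneForm n M W}
    (h : α.Smooth) (x : M) : OneForm.SmoothAt α x := OneForm.smooth_iff.mp h x

end ComplexStructure

/-! ### Smooth, closed and locally exact two-forms -/

section TwoForms

variable {n : ℕ} {M : Type*} [TopologicalSpace M] [ChartedSpace (Fin n → ℂ) M]

/-- Smoothness of a two-form. -/
def TwoForm.Smooth (G : TwoForm n M ℝ) : Prop :=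
  ∀ c : M, SmoothBil (TwoForm.inChart G c) (chartAt (Fin n → ℂ) c).target

/-- Closedness of a smooth two-form. -/
def TwoForm.Closed (G : TwoForm n M ℝ) : Prop :=
  ∀ c : M, IsClosedBil (TwoForm.inChart G c) (chartAt (Fin n → ℂ) c).target

/-- A two-form is locally the exterior derivative of a smooth one-form. -/
def TwoForm.LocallyExact (G : TwoForm n M ℝ) : Prop :=
  ∀ x : M, ∃ α : OneForm n M ℝ, ∀ᶠ z in 𝓝 x, OneForm.SmoothAt α z ∧ G z = extD α z

lemma TwoForm.LocallyExact.antisymm {G : TwoForm n M ℝ} (h : G.LocallyExact) (x : M)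
    (v w : Tan n x) : G x v w = -G x w v := by
  obtain ⟨α, hα⟩ := h x
  rw [hα.self_of_nhds.2]
  exact extD_antisymm α x v w

lemma extD_locallyExact [IsManifold 𝓘(ℂ, Fin n → ℂ) ω M] {α : OneForm n M ℝ} (h : α.Smooth) :
    TwoForm.LocallyExact (extD α) :=
  fun _ => ⟨α, Filter.Eventually.of_forall fun z => ⟨h.at z, rfl⟩⟩

lemma wedge11_smooth {a b : OneForm n M ℝ} (ha : a.Smooth) (hb : b.Smooth) :
    TwoForm.Smooth (fun x => wedge11 (a x) (b x)) := by
  intro c v w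
  exact (((ha c).clm_apply contDiffOn_const).mul ((hb c).clm_apply contDiffOn_const)).sub
    (((hb c).clm_apply contDiffOn_const).mul ((ha c).clm_apply contDiffOn_const))

lemma inChart_wedge11 (a b : OneForm n M ℝ) (c : M) (y : Fin n → ℂ) :
    TwoForm.inChart (fun x => wedge11 (a x) (b x)) c y
      = KahlerFlow.antisymm ((OneForm.inChart a c y).smulRight (OneForm.inChart b c y)) := by
  ext v w
  have key : ∀ (f g : (Fin n → ℂ) →L[ℝ] ℝ), f v * g w - g v * f w
      = KahlerFlow.antisymm (f.smulRight g) v w := fun f g => by simp [mul_comm]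
  exact key (OneForm.inChart a c y) (OneForm.inChart b c y)

variable [IsManifold 𝓘(ℂ, Fin n → ℂ) ω M]

/-- Naturality of `d` transports a potential near a point into any chart. Smoothness and closedness
of the curvature follow from this, as the curvature is only given through local potentials. -/
lemma TwoForm.LocallyExact.exists_chart {G : TwoForm n M ℝ} (h : G.LocallyExact) (c : M)
    {y : Fin n → ℂ} (hy : y ∈ (chartAt (Fin n → ℂ) c).target) :
    ∃ U : Set (Fin n → ℂ), IsOpen U ∧ y ∈ U ∧ ∃ A : (Fin n → ℂ) → (Fin n → ℂ) →L[ℝ] ℝ,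
      ContDiffOn ℝ ∞ A U ∧
      ∀ z ∈ U, ∀ v w, TwoForm.inChart G c z v w = KahlerFlow.antisymm (fderiv ℝ A z) v w := by
  obtain ⟨α, hα⟩ := h ((chartAt (Fin n → ℂ) c).symm y)
  have h1 := (((chartAt (Fin n → ℂ) c).continuousAt_symm hy).eventually hα).and
    ((chartAt (Fin n → ℂ) c).open_target.mem_nhds hy)
  obtain ⟨U, hU, hUo, hyU⟩ := eventually_nhds_iff.mp h1
  refine ⟨U, hUo, hyU, OneForm.inChart α c, fun z hz => ?_, fun z hz v w => ?_⟩
  · exact ((hU z hz).1.1.inChart (hU z hz).2).contDiffWithinAt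
  · rw [← extD_inChart (hU z hz).2 (hU z hz).1.1, TwoForm.inChart_eq, TwoForm.inChart_eq]
    have : TwoForm.val G ((chartAt (Fin n → ℂ) c).symm z)
      = TwoForm.val (extD α) ((chartAt (Fin n → ℂ) c).symm z) := (hU z hz).1.2
    rw [this]

lemma TwoForm.LocallyExact.smooth {G : TwoForm n M ℝ} (h : G.LocallyExact) : G.Smooth := by
  intro c v w y hy
  obtain ⟨U, hUo, hyU, A, hA, hG⟩ := h.exists_chart c hy
  refine ((((smoothBil_antisymm_fderiv hUo hA v w).congr fun z hz => hG z hz v w).contDiffAt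
    (hUo.mem_nhds hyU))).contDiffWithinAt

lemma TwoForm.LocallyExact.closed {G : TwoForm n M ℝ} (h : G.LocallyExact) : G.Closed := by
  intro c y hy u v w
  obtain ⟨U, hUo, hyU, A, hA, hG⟩ := h.exists_chart c hy
  have e : ∀ v w, (fun z => TwoForm.inChart G c z v w)
      =ᶠ[𝓝 y] fun z => KahlerFlow.antisymm (fderiv ℝ A z) v w := fun v w => by
    filter_upwards [hUo.mem_nhds hyU] with z hz
    exact hG z hz v w
  rw [(e v w).fderiv_eq, (e w u).fderiv_eq, (e u v).fderiv_eq]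
  exact isClosedBil_antisymm_fderiv hUo hA y hyU u v w

lemma TwoForm.LocallyExact.add_extD {G : TwoForm n M ℝ} (h : G.LocallyExact) {α : OneForm n M ℝ}
    (hα : α.Smooth) : TwoForm.LocallyExact (G + extD α) := by
  intro x
  obtain ⟨β, hβ⟩ := h x
  refine ⟨β + α, hβ.mono fun z hz => ⟨hz.1.add (hα.at z), ?_⟩⟩
  rw [extD_add hz.1 (hα.at z), ← hz.2]
  rfl

end TwoForms

/-! ### Forms of top degree and their quotients -/

section TopForms

variable {n : ℕ} {M : Type*} [TopologicalSpace M] [ChartedSpace (Fin n → ℂ) M]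

/-- The value of a top-degree form at a point, with the tangent space identified with `ℂⁿ`. -/
def TopForm.val (η : TopForm n M) (x : M) : (Fin n → ℂ) [⋀^Fin n × Fin 2]→ₗ[ℝ] ℝ := η x

/-- The wedge product of `n` two-forms. -/
def wedgeTop (G : Fin n → TwoForm n M ℝ) : TopForm n M := fun x => wedge fun j => G j x

/-- Smoothness of a top-degree form. -/
def TopForm.Smooth (η : TopForm n M) : Prop :=
  ∀ c : M, ContDiffOn ℝ ∞ (TopForm.coeff η c) (chartAt (Fin n → ℂ) c).target

lemma topPow_eq (F : TwoForm n M ℝ) : topPow F = wedgeTop fun _ => F := rfl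

lemma wedgePow_eq [NeZero n] (B F : TwoForm n M ℝ) :
    wedgePow B F = wedgeTop (Function.update (fun _ => F) 0 B) := by
  funext x
  refine congrArg wedge (funext fun j => ?_)
  by_cases hj : j = 0
  · subst hj; simp
  · simp [hj]

/-- The Jacobian determinant separates the chart from the point. It is positive, so signs can be
tested on the frame, and it cancels in quotients of top-degree forms. -/
lemma coeff_eq (η : TopForm n M) (c : M) (y : Fin n → ℂ) :
    TopForm.coeff η c y = LinearMap.det (jac c y : (Fin n → ℂ) →ₗ[ℝ] Fin n → ℂ)
      * TopForm.val η ((chartAt (Fin n → ℂ) c).symm y) (frame n) :=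
  topForm_comp (TopForm.val η ((chartAt (Fin n → ℂ) c).symm y)) (jac c y) (frame n)

lemma coeff_wedgeTop (G : Fin n → TwoForm n M ℝ) (c : M) (y : Fin n → ℂ) :
    TopForm.coeff (wedgeTop G) c y = wedgeCoeff fun j => TwoForm.inChart (G j) c y :=
  wedge_apply _ _

lemma wedgeTop_smooth {G : Fin n → TwoForm n M ℝ} (hG : ∀ j, (G j).Smooth) :
    (wedgeTop G).Smooth := by
  intro c
  refine ContDiffOn.congr (f := fun y => wedgeCoeff fun j => TwoForm.inChart (G j) c y) ?_
    fun y _ => coeff_wedgeTop G c y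
  simp only [wedgeCoeff, wedgeVal]
  refine contDiffOn_const.mul (ContDiffOn.sum fun σ _ => ?_)
  refine ContDiffOn.const_smul _ (contDiffOn_prod fun j _ => hG j c _ _)

lemma topRatio_eq (η κ : TopForm n M) (x : M) :
    topRatio η κ x = TopForm.val η x (frame n) / TopForm.val κ x (frame n) := rfl

variable [IsManifold 𝓘(ℂ, Fin n → ℂ) ω M]

lemma coeff_transition (η : TopForm n M) {c d : M} {y : Fin n → ℂ} (hy : y ∈ overlap c d) :
    TopForm.coeff η c y
      = LinearMap.det (fderiv ℝ (transition c d) y : (Fin n → ℂ) →ₗ[ℝ] Fin n → ℂ)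
        * TopForm.coeff η d (transition c d y) := by
  rw [coeff_eq, coeff_eq, ← jac_transition hy, chartAt_symm_transition hy,
    ContinuousLinearMap.toLinearMap_comp, LinearMap.det_comp]
  ring

lemma topRatio_chart (η κ : TopForm n M) {c : M} {y : Fin n → ℂ}
    (hy : y ∈ (chartAt (Fin n → ℂ) c).target) :
    topRatio η κ ((chartAt (Fin n → ℂ) c).symm y)
      = TopForm.coeff η c y / TopForm.coeff κ c y := by
  rw [topRatio_eq, coeff_eq, coeff_eq, mul_div_mul_left _ _ (det_jac_pos hy).ne']

lemma topRatio_smooth {η κ : TopForm n M} (hη : η.Smooth) (hκ : κ.Smooth)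
    (h0 : ∀ x, TopForm.val κ x (frame n) ≠ 0) :
    ContMDiff (modelR n) 𝓘(ℝ, ℝ) ∞ (topRatio η κ) := by
  refine contMDiff_iff_chart.mpr fun c => ?_
  refine ((hη c).div (hκ c) fun y hy => ?_).congr fun y hy => topRatio_chart η κ hy
  rw [coeff_eq]
  exact mul_ne_zero (det_jac_pos hy).ne' (h0 _)

end TopForms

end KahlerFlow

end

noncomputable section

namespace KahlerFlow

/-! ### Integration on a compact complex manifold -/

section Integral

variable {n : ℕ} {M : Type*} [TopologicalSpace M] [ChartedSpace (Fin n → ℂ) M]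

/-- The product of a function and a top-degree form. -/
def TopForm.mulFun (φ : M → ℝ) (η : TopForm n M) : TopForm n M := fun x => φ x • η x

lemma coeff_mulFun (φ : M → ℝ) (η : TopForm n M) (c : M) (y : Fin n → ℂ) :
    TopForm.coeff (TopForm.mulFun φ η) c y
      = φ ((chartAt (Fin n → ℂ) c).symm y) * TopForm.coeff η c y := rfl

lemma coeff_add (η κ : TopForm n M) (c : M) (y : Fin n → ℂ) :
    TopForm.coeff (η + κ) c y = TopForm.coeff η c y + TopForm.coeff κ c y := rfl

lemma coeff_sub (η κ : TopForm n M) (c : M) (y : Fin n → ℂ) :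
    TopForm.coeff (η - κ) c y = TopForm.coeff η c y - TopForm.coeff κ c y := rfl

lemma coeff_smul (r : ℝ) (η : TopForm n M) (c : M) (y : Fin n → ℂ) :
    TopForm.coeff (r • η) c y = r * TopForm.coeff η c y := rfl

lemma coeff_eq_zero {η : TopForm n M} {c : M} {y : Fin n → ℂ}
    (h : η ((chartAt (Fin n → ℂ) c).symm y) = 0) : TopForm.coeff η c y = 0 := by
  rw [TopForm.coeff, h]
  rfl

lemma TopForm.Smooth.add {η κ : TopForm n M} (hη : η.Smooth) (hκ : κ.Smooth) :
    (η + κ).Smooth := fun c => (hη c).add (hκ c)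

lemma TopForm.Smooth.sub {η κ : TopForm n M} (hη : η.Smooth) (hκ : κ.Smooth) :
    (η - κ).Smooth := fun c => (hη c).sub (hκ c)

lemma TopForm.Smooth.smul (r : ℝ) {η : TopForm n M} (hη : η.Smooth) :
    (r • η).Smooth := fun c => contDiffOn_const.mul (hη c)

lemma smooth_sum {ι : Type*} (s : Finset ι) {η : ι → TopForm n M} (h : ∀ i ∈ s, (η i).Smooth) :
    (∑ i ∈ s, η i).Smooth := by
  classical
  induction s using Finset.induction_on with
  | empty => exact fun c => contDiffOn_const
  | insert i s hi ih =>
    rw [Finset.sum_insert hi]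
    exact (h i (by simp)).add (ih fun j hj => h j (by simp [hj]))

/-- The integral over the preferred chart at `c`. -/
def chartIntegral (c : M) (η : TopForm n M) : ℝ :=
  ∫ y in (chartAt (Fin n → ℂ) c).target, TopForm.coeff η c y

lemma isCompact_image_chart {c : M} {S : Set M} (hS : IsCompact S)
    (hSc : S ⊆ (chartAt (Fin n → ℂ) c).source) : IsCompact (chartAt (Fin n → ℂ) c '' S) :=
  hS.image_of_continuousOn ((chartAt (Fin n → ℂ) c).continuousOn.mono hSc)

lemma notMem_of_notMem_image_chart {c : M} {S : Set M} {y : Fin n → ℂ}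
    (hy : y ∈ (chartAt (Fin n → ℂ) c).target) (h : y ∉ chartAt (Fin n → ℂ) c '' S) :
    (chartAt (Fin n → ℂ) c).symm y ∉ S := fun hS =>
  h ⟨_, hS, (chartAt (Fin n → ℂ) c).right_inv hy⟩

lemma image_chart_subset {c : M} {S : Set M} (hSc : S ⊆ (chartAt (Fin n → ℂ) c).source) :
    chartAt (Fin n → ℂ) c '' S ⊆ (chartAt (Fin n → ℂ) c).target := by
  rintro _ ⟨x, hx, rfl⟩
  exact (chartAt (Fin n → ℂ) c).map_source (hSc hx)

/-- The support is compact inside the open chart domain, so the coefficient extends by zero to a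
smooth function with compact support on `ℂⁿ`. -/
lemma exists_extension {η : TopForm n M} (hη : η.Smooth) {c : M} {S : Set M} (hS : IsCompact S)
    (hSc : S ⊆ (chartAt (Fin n → ℂ) c).source) (h0 : ∀ x ∉ S, η x = 0) :
    Continuous ((chartAt (Fin n → ℂ) c).target.indicator (TopForm.coeff η c)) ∧
      Integrable ((chartAt (Fin n → ℂ) c).target.indicator (TopForm.coeff η c)) := by
  have hC := isCompact_image_chart hS hSc
  have hz : ∀ y ∉ chartAt (Fin n → ℂ) c '' S,
      (chartAt (Fin n → ℂ) c).target.indicator (TopForm.coeff η c) y = 0 := by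
    intro y hy
    by_cases hyt : y ∈ (chartAt (Fin n → ℂ) c).target
    · rw [indicator_of_mem hyt]
      exact coeff_eq_zero (h0 _ (notMem_of_notMem_image_chart hyt hy))
    · exact indicator_of_notMem hyt _
  have h1 := contDiff_of_eq_zero_off (chartAt (Fin n → ℂ) c).open_target hC.isClosed
    (image_chart_subset hSc) ((hη c).congr fun y hy => indicator_of_mem hy _) hz
  exact ⟨h1.continuous, h1.continuous.integrable_of_hasCompactSupport
    (HasCompactSupport.intro hC hz)⟩

lemma integrableOn_coeff {η : TopForm n M} (hη : η.Smooth) {c : M} {S : Set M} (hS : IsCompact S)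
    (hSc : S ⊆ (chartAt (Fin n → ℂ) c).source) (h0 : ∀ x ∉ S, η x = 0) :
    IntegrableOn (TopForm.coeff η c) (chartAt (Fin n → ℂ) c).target :=
  (integrable_indicator_iff (chartAt (Fin n → ℂ) c).open_target.measurableSet).mp
    (exists_extension hη hS hSc h0).2

variable [IsManifold 𝓘(ℂ, Fin n → ℂ) ω M]

lemma image_transition_overlap (c d : M) :
    transition (n := n) c d '' overlap c d = overlap d c := by
  ext y
  refine ⟨?_, fun hy => ⟨transition d c y, transition_mem hy, transition_transition hy⟩⟩
  rintro ⟨z, hz, rfl⟩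
  exact transition_mem hz

/-- Independence of the chart of the integral of a form supported in two charts. -/
lemma chartIntegral_eq {η : TopForm n M} {c d : M}
    (hc : ∀ x ∉ (chartAt (Fin n → ℂ) c).source, η x = 0)
    (hd : ∀ x ∉ (chartAt (Fin n → ℂ) d).source, η x = 0) :
    chartIntegral c η = chartIntegral d η := by
  have red : ∀ {c d : M}, (∀ x ∉ (chartAt (Fin n → ℂ) d).source, η x = 0) →
      chartIntegral c η = ∫ y in overlap c d, TopForm.coeff η c y := by
    intro c d hd
    refine setIntegral_eq_of_subset_of_forall_sdiff_eq_zero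
      (chartAt (Fin n → ℂ) c).open_target.measurableSet inter_subset_left fun y hy => ?_
    exact coeff_eq_zero (hd _ fun h => hy.2 ⟨hy.1, h⟩)
  -- Change of variables on the overlap; the absolute value of the Jacobian can be dropped since
  -- coordinate changes preserve orientation.
  rw [red hd, red hc, ← image_transition_overlap c d,
    integral_image_eq_integral_abs_det_fderiv_smul volume (isOpen_overlap c d).measurableSet
      (fun y hy => (differentiableAt_transition hy).hasFDerivAt.hasFDerivWithinAt)
      (fun y hy z hz h => by
        rw [← transition_transition hy, ← transition_transition hz, h])]
  refine setIntegral_congr_fun (isOpen_overlap c d).measurableSet fun y hy => ?_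
  simp only [smul_eq_mul]
  rw [coeff_transition η hy]
  congr 1
  exact (abs_of_pos (det_fderiv_transition_pos hy)).symm

lemma TopForm.Smooth.mulFun {φ : M → ℝ} (hφ : ContMDiff (modelR n) 𝓘(ℝ, ℝ) ∞ φ)
    {η : TopForm n M} (hη : η.Smooth) : (TopForm.mulFun φ η).Smooth :=
  fun c => (contMDiff_iff_chart.mp hφ c).mul (hη c)

variable [T2Space M] [CompactSpace M]

lemma tsupport_chartPartition (c : M) :
    tsupport (chartPartition n M c) ⊆ (chartAt (Fin n → ℂ) c).source :=
  (SmoothPartitionOfUnity.exists_isSubordinate_chartAt_source (modelR n) M).choose_spec c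

variable (n M) in
lemma finite_chartPartition : {c : M | (Function.support (chartPartition n M c)).Nonempty}.Finite :=
  (chartPartition n M).locallyFinite.finite_nonempty_of_compact

variable (n M) in
/-- The finite set of charts used by the partition of unity. -/
def usedCharts : Finset M := (finite_chartPartition n M).toFinset

lemma chartPartition_eq_zero {c : M} (hc : c ∉ usedCharts n M) (x : M) :
    chartPartition n M c x = 0 := by
  by_contra h
  exact hc ((finite_chartPartition n M).mem_toFinset.mpr ⟨x, h⟩)

lemma sum_chartPartition (x : M) : ∑ c ∈ usedCharts n M, chartPartition n M c x = 1 := by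
  have h := (chartPartition n M).sum_eq_one (mem_univ x)
  rw [← h]
  refine (finsum_eq_sum_of_support_subset _ fun c hc => ?_).symm
  by_contra hcu
  exact hc (chartPartition_eq_zero hcu x)

lemma integral_eq_sum (η : TopForm n M) : integral η = ∑ c ∈ usedCharts n M,
    chartIntegral c (TopForm.mulFun (chartPartition n M c) η) := by
  rw [integral]
  refine finsum_eq_sum_of_support_subset _ fun c hc => ?_
  by_contra hcu
  refine hc ?_
  simp [chartPartition_eq_zero hcu]

lemma mulFun_chartPartition_eq_zero (η : TopForm n M) (c : M) {x : M}
    (hx : x ∉ tsupport (chartPartition n M c)) :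
    TopForm.mulFun (chartPartition n M c) η x = 0 := by
  rw [TopForm.mulFun, image_eq_zero_of_notMem_tsupport hx, zero_smul]

lemma smooth_mulFun_chartPartition {η : TopForm n M} (hη : η.Smooth) (c : M) :
    (TopForm.mulFun (chartPartition n M c) η).Smooth :=
  hη.mulFun (chartPartition n M c).contMDiff

lemma integrableOn_mulFun_chartPartition {η : TopForm n M} (hη : η.Smooth) (c : M) :
    IntegrableOn (TopForm.coeff (TopForm.mulFun (chartPartition n M c) η) c)
      (chartAt (Fin n → ℂ) c).target :=
  integrableOn_coeff (smooth_mulFun_chartPartition hη c) (isClosed_tsupport _).isCompact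
    (tsupport_chartPartition c) fun _ hx => mulFun_chartPartition_eq_zero η c hx

/-- The integral of a form supported in one chart. -/
lemma integral_eq_chartIntegral {η : TopForm n M} (hη : η.Smooth) {d : M} {S : Set M}
    (hS : IsCompact S) (hSd : S ⊆ (chartAt (Fin n → ℂ) d).source) (h0 : ∀ x ∉ S, η x = 0) :
    integral η = chartIntegral d η := by
  have h1 : ∀ c, ∀ x ∉ S, TopForm.mulFun (chartPartition n M c) η x = 0 := fun c x hx => by
    rw [TopForm.mulFun, h0 x hx, smul_zero]
  -- Each piece is supported both in its own chart and in the chart at `d`. Moving all pieces to the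
  -- latter lets the partition of unity sum to one under a single integral.
  have h2 : ∀ c, chartIntegral c (TopForm.mulFun (chartPartition n M c) η)
      = chartIntegral d (TopForm.mulFun (chartPartition n M c) η) := fun c =>
    chartIntegral_eq (fun x hx => mulFun_chartPartition_eq_zero η c
      fun h => hx (tsupport_chartPartition c h)) fun x hx => h1 c x fun h => hx (hSd h)
  rw [integral_eq_sum, Finset.sum_congr rfl fun c _ => h2 c]
  unfold chartIntegral
  rw [← integral_finsetSum _ fun c _ =>
    integrableOn_coeff (smooth_mulFun_chartPartition hη c) hS hSd (h1 c)]
  refine setIntegral_congr_fun (chartAt (Fin n → ℂ) d).open_target.measurableSet fun y _ => ?_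
  simp only [coeff_mulFun, ← Finset.sum_mul, sum_chartPartition, one_mul]

lemma integral_add' {η κ : TopForm n M} (hη : η.Smooth) (hκ : κ.Smooth) :
    integral (η + κ) = integral η + integral κ := by
  rw [integral_eq_sum, integral_eq_sum, integral_eq_sum, ← Finset.sum_add_distrib]
  refine Finset.sum_congr rfl fun c _ => ?_
  rw [chartIntegral, chartIntegral, chartIntegral,
    ← MeasureTheory.integral_add (integrableOn_mulFun_chartPartition hη c)
      (integrableOn_mulFun_chartPartition hκ c)]
  simp only [coeff_mulFun, coeff_add, mul_add]

lemma integral_smul' (r : ℝ) (η : TopForm n M) : integral (r • η) = r * integral η := by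
  rw [integral_eq_sum, integral_eq_sum, Finset.mul_sum]
  refine Finset.sum_congr rfl fun c _ => ?_
  rw [chartIntegral, chartIntegral, ← integral_const_mul]
  simp only [coeff_mulFun, coeff_smul, mul_left_comm]

lemma integral_sub' {η κ : TopForm n M} (hη : η.Smooth) (hκ : κ.Smooth) :
    integral (η - κ) = integral η - integral κ := by
  rw [integral_eq_sum, integral_eq_sum, integral_eq_sum, ← Finset.sum_sub_distrib]
  refine Finset.sum_congr rfl fun c _ => ?_
  rw [chartIntegral, chartIntegral, chartIntegral,
    ← MeasureTheory.integral_sub (integrableOn_mulFun_chartPartition hη c)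
      (integrableOn_mulFun_chartPartition hκ c)]
  simp only [coeff_mulFun, coeff_sub, mul_sub]

lemma integral_zero' : integral (0 : TopForm n M) = 0 := by
  have := integral_smul' 0 (0 : TopForm n M)
  rwa [zero_smul, zero_mul] at this

lemma integral_sum' {ι : Type*} (s : Finset ι) {η : ι → TopForm n M} (h : ∀ i ∈ s, (η i).Smooth) :
    integral (∑ i ∈ s, η i) = ∑ i ∈ s, integral (η i) := by
  classical
  induction s using Finset.induction_on with
  | empty => simpa using integral_zero'
  | insert i s hi ih =>
    rw [Finset.sum_insert hi, Finset.sum_insert hi, integral_add' (h i (by simp))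
      (smooth_sum s fun j hj => h j (by simp [hj])), ih fun j hj => h j (by simp [hj])]

/-- All pieces are nonnegative. A chart whose weight at `x₀` is positive yields a continuous
nonnegative coefficient that is nonzero at a point, hence has positive integral. -/
lemma integral_pos {η : TopForm n M} (hη : η.Smooth) (h0 : ∀ x, 0 ≤ TopForm.val η x (frame n))
    {x₀ : M} (hx₀ : 0 < TopForm.val η x₀ (frame n)) : 0 < integral η := by
  have hnn : ∀ c y, y ∈ (chartAt (Fin n → ℂ) c).target →
      0 ≤ TopForm.coeff (TopForm.mulFun (chartPartition n M c) η) c y := fun c y hy => by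
    rw [coeff_mulFun, coeff_eq]
    exact mul_nonneg ((chartPartition n M).nonneg _ _) (mul_nonneg (det_jac_pos hy).le (h0 _))
  obtain ⟨c, hc⟩ := (chartPartition n M).exists_pos_of_mem (mem_univ x₀)
  have hcu : c ∈ usedCharts n M := by
    by_contra h
    exact hc.ne' (chartPartition_eq_zero h x₀)
  have hxc : x₀ ∈ (chartAt (Fin n → ℂ) c).source :=
    tsupport_chartPartition c (subset_tsupport _ hc.ne')
  rw [integral_eq_sum]
  refine Finset.sum_pos' (fun d _ => setIntegral_nonneg
    (chartAt (Fin n → ℂ) d).open_target.measurableSet (hnn d)) ⟨c, hcu, ?_⟩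
  rw [chartIntegral, ← integral_indicator (chartAt (Fin n → ℂ) c).open_target.measurableSet]
  obtain ⟨h1, h2⟩ := exists_extension (smooth_mulFun_chartPartition hη c)
    (isClosed_tsupport _).isCompact (tsupport_chartPartition c)
    fun _ hx => mulFun_chartPartition_eq_zero η c hx
  refine integral_pos_of_integrable_nonneg_nonzero (x := chartAt (Fin n → ℂ) c x₀) h1 h2
    (fun y => indicator_nonneg (hnn c) y) ?_
  rw [indicator_of_mem ((chartAt (Fin n → ℂ) c).map_source hxc), coeff_mulFun, coeff_eq,
    (chartAt (Fin n → ℂ) c).left_inv hxc]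
  exact (mul_pos hc (mul_pos (det_jac_pos ((chartAt (Fin n → ℂ) c).map_source hxc)) hx₀)).ne'

end Integral

/-! ### Stokes' theorem -/

section Stokes

variable {n : ℕ} {M : Type*} [TopologicalSpace M] [ChartedSpace (Fin n → ℂ) M]

lemma update_smooth {G : Fin n → TwoForm n M ℝ} {j : Fin n} {B : TwoForm n M ℝ}
    (hG : ∀ i, i ≠ j → (G i).Smooth) (hB : B.Smooth) (i : Fin n) :
    (Function.update G j B i).Smooth := by
  by_cases hi : i = j
  · subst hi; simpa using hB
  · simpa [hi] using hG i hi

lemma inChart_update (G : Fin n → TwoForm n M ℝ) (j : Fin n) (B : TwoForm n M ℝ) (c : M)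
    (y : Fin n → ℂ) : (fun i => TwoForm.inChart (Function.update G j B i) c y)
      = Function.update (fun i => TwoForm.inChart (G i) c y) j (TwoForm.inChart B c y) := by
  funext i
  by_cases hi : i = j
  · subst hi; simp
  · simp [hi]

lemma val_update (G : Fin n → TwoForm n M ℝ) (j : Fin n) (B : TwoForm n M ℝ) (x : M) :
    (fun i => TwoForm.val (Function.update G j B i) x)
      = Function.update (fun i => TwoForm.val (G i) x) j (TwoForm.val B x) := by
  funext i
  by_cases hi : i = j
  · subst hi; simp
  · simp [hi]

lemma wedgeTop_apply (G : Fin n → TwoForm n M ℝ) (x : M) (v : Fin n × Fin 2 → Fin n → ℂ) :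
    TopForm.val (wedgeTop G) x v = wedgeVal (fun j => TwoForm.val (G j) x) v :=
  wedge_apply _ _

lemma topForm_ext {η κ : TopForm n M} (h : ∀ x v, TopForm.val η x v = TopForm.val κ x v) :
    η = κ := by
  funext x
  exact AlternatingMap.ext (h x)

lemma wedgeTop_update_add (G : Fin n → TwoForm n M ℝ) (j : Fin n) (B C : TwoForm n M ℝ) :
    wedgeTop (Function.update G j (B + C))
      = wedgeTop (Function.update G j B) + wedgeTop (Function.update G j C) := by
  refine topForm_ext fun x v => ?_
  have : TopForm.val (wedgeTop (Function.update G j B) + wedgeTop (Function.update G j C)) x v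
    = TopForm.val (wedgeTop (Function.update G j B)) x v
      + TopForm.val (wedgeTop (Function.update G j C)) x v := rfl
  rw [this, wedgeTop_apply, wedgeTop_apply, wedgeTop_apply, val_update, val_update, val_update,
    ← wedgeVal_update_add]
  rfl

lemma wedgeTop_update_smul (G : Fin n → TwoForm n M ℝ) (j : Fin n) (r : ℝ) (B : TwoForm n M ℝ) :
    wedgeTop (Function.update G j (r • B)) = r • wedgeTop (Function.update G j B) := by
  refine topForm_ext fun x v => ?_
  have : TopForm.val (r • wedgeTop (Function.update G j B)) x v
    = r * TopForm.val (wedgeTop (Function.update G j B)) x v := rfl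
  rw [this, wedgeTop_apply, wedgeTop_apply, val_update, val_update, ← wedgeVal_update_smul]
  rfl

lemma wedgeTop_apply_eq_zero {G : Fin n → TwoForm n M ℝ} {j : Fin n} {x : M} (h : G j x = 0) :
    wedgeTop G x = 0 := by
  have h1 : ∀ v, TopForm.val (wedgeTop G) x v = 0 := fun v => by
    have h2 : (fun i => TwoForm.val (G i) x)
        = Function.update (fun i => TwoForm.val (G i) x) j ((0 : ℝ) • (0 : Bil n)) := by
      funext i
      by_cases hi : i = j
      · subst hi
        have h3 : (0 : ℝ) • (0 : Bil n) = 0 :=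
          ContinuousLinearMap.ext fun _ => ContinuousLinearMap.ext fun _ => mul_zero 0
        rw [Function.update_self, h3]
        exact h
      · rw [Function.update_of_ne hi]
    rw [wedgeTop_apply, h2, wedgeVal_update_smul, zero_mul]
  exact AlternatingMap.ext h1

lemma OneForm.Smooth.add {α β : OneForm n M ℝ} (hα : α.Smooth) (hβ : β.Smooth) :
    (α + β).Smooth := fun c => (hα c).add (hβ c)

lemma OneForm.Smooth.smul (r : ℝ) {α : OneForm n M ℝ} (hα : α.Smooth) :
    (r • α).Smooth := fun c => (hα c).const_smul r

lemma OneForm.zero_smooth : (0 : OneForm n M ℝ).Smooth := by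
  intro c
  have : OneForm.inChart (0 : OneForm n M ℝ) c = fun _ => 0 := by
    funext y
    exact ContinuousLinearMap.zero_comp _
  rw [this]
  exact contDiffOn_const

variable [IsManifold 𝓘(ℂ, Fin n → ℂ) ω M]

lemma extD_congr {W : Type*} [NormedAddCommGroup W] [NormedSpace ℝ W] {α β : OneForm n M W}
    {x : M} (h : ∀ᶠ z in 𝓝 x, α z = β z) : extD α x = extD β x := by
  have h1 : ∀ᶠ y in 𝓝 (chartAt (Fin n → ℂ) x x), OneForm.inChart α x y = OneForm.inChart β x y := by
    have h2 : ContinuousAt (chartAt (Fin n → ℂ) x).symm (chartAt (Fin n → ℂ) x x) :=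
      (chartAt (Fin n → ℂ) x).continuousAt_symm (mem_chart_target _ x)
    have h3 : Filter.Tendsto (chartAt (Fin n → ℂ) x).symm (𝓝 (chartAt (Fin n → ℂ) x x)) (𝓝 x) := by
      have := h2.tendsto
      rwa [(chartAt (Fin n → ℂ) x).left_inv (mem_chart_source _ x)] at this
    filter_upwards [h3.eventually h] with y hy
    have : OneForm.val α ((chartAt (Fin n → ℂ) x).symm y)
      = OneForm.val β ((chartAt (Fin n → ℂ) x).symm y) := hy
    rw [OneForm.inChart_eq, OneForm.inChart_eq, this]
  have h4 : TwoForm.val (extD α) x = TwoForm.val (extD β) x := by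
    rw [val_extD, val_extD, Filter.EventuallyEq.fderiv_eq h1]
  exact h4

lemma extD_zero : extD (0 : OneForm n M ℝ) = 0 := by
  funext x
  have h : OneForm.SmoothAt (0 : OneForm n M ℝ) x := OneForm.zero_smooth.at x
  have := extD_add h h
  rw [add_zero] at this
  exact left_eq_add.mp this

lemma OneForm.Smooth.mulFun {φ : M → ℝ} (hφ : ContMDiff (modelR n) 𝓘(ℝ, ℝ) ∞ φ)
    {α : OneForm n M ℝ} (hα : α.Smooth) : (OneForm.mulFun φ α).Smooth :=
  OneForm.smooth_iff.mpr fun x => OneForm.SmoothAt.mulFun (hφ x) (hα.at x)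

lemma extD_smooth {α : OneForm n M ℝ} (hα : α.Smooth) : (extD α).Smooth :=
  (extD_locallyExact hα).smooth

variable [T2Space M] [CompactSpace M]

/-- A functional which is additive on smooth one-forms vanishes on `α` if it vanishes on the
pieces of `α` cut out by the partition of unity. -/
lemma eq_zero_of_forall_chartPartition {Φ : OneForm n M ℝ → ℝ}
    (hΦ : ∀ α β : OneForm n M ℝ, α.Smooth → β.Smooth → Φ (α + β) = Φ α + Φ β)
    {α : OneForm n M ℝ} (hα : α.Smooth)
    (h : ∀ c, Φ (OneForm.mulFun (chartPartition n M c) α) = 0) : Φ α = 0 := by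
  have hα1 : α = ∑ c ∈ usedCharts n M, OneForm.mulFun (chartPartition n M c) α := by
    funext x
    rw [Finset.sum_apply]
    simp only [OneForm.mulFun]
    rw [← Finset.sum_smul, sum_chartPartition, one_smul]
  have key : ∀ s : Finset M, (∑ c ∈ s, OneForm.mulFun (chartPartition n M c) α).Smooth ∧
      Φ (∑ c ∈ s, OneForm.mulFun (chartPartition n M c) α) = 0 := by
    classical
    intro s
    have h00 : (0 : OneForm n M ℝ).Smooth := OneForm.zero_smooth
    induction s using Finset.induction_on with
    | empty =>
      refine ⟨h00, ?_⟩
      have := hΦ 0 0 h00 h00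
      rw [add_zero] at this
      simpa using this
    | insert c s hc ih =>
      have hs : (OneForm.mulFun (chartPartition n M c) α).Smooth :=
        hα.mulFun (chartPartition n M c).contMDiff
      rw [Finset.sum_insert hc]
      exact ⟨hs.add ih.1, by rw [hΦ _ _ hs ih.1, h, ih.2, add_zero]⟩
  rw [hα1]
  exact (key _).2

lemma extD_mulFun_chartPartition_eq_zero (α : OneForm n M ℝ) (c : M) {x : M}
    (hx : x ∉ tsupport (chartPartition n M c)) :
    extD (OneForm.mulFun (chartPartition n M c) α) x = 0 := by
  have : ∀ᶠ z in 𝓝 x, OneForm.mulFun (chartPartition n M c) α z = (0 : OneForm n M ℝ) z := by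
    filter_upwards [(isClosed_tsupport _).isOpen_compl.mem_nhds hx] with z hz
    rw [OneForm.mulFun, image_eq_zero_of_notMem_tsupport hz, zero_smul]
    rfl
  rw [extD_congr this, extD_zero]
  rfl

lemma inChart_mulFun_chartPartition_eq_zero (α : OneForm n M ℝ) (c : M) {y : Fin n → ℂ}
    (hyt : y ∈ (chartAt (Fin n → ℂ) c).target)
    (hy : y ∉ chartAt (Fin n → ℂ) c '' tsupport (chartPartition n M c)) :
    OneForm.inChart (OneForm.mulFun (chartPartition n M c) α) c y = 0 := by
  rw [OneForm.inChart_mulFun]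
  simp only
  rw [image_eq_zero_of_notMem_tsupport (notMem_of_notMem_image_chart hyt hy), zero_smul]

/-- **Stokes' theorem**: `∫ dβ ∧ H = 0` for a product `H` of closed two-forms. -/
theorem integral_extD_wedge_eq_zero {H : Fin n → TwoForm n M ℝ} (j : Fin n)
    (hH : ∀ i, i ≠ j → (H i).Smooth) (hHc : ∀ i, i ≠ j → (H i).Closed)
    {β : OneForm n M ℝ} (hβ : β.Smooth) :
    integral (wedgeTop (Function.update H j (extD β))) = 0 := by
  have hsm : ∀ {β : OneForm n M ℝ}, β.Smooth →
      (wedgeTop (Function.update H j (extD β))).Smooth := fun hβ =>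
    wedgeTop_smooth (update_smooth hH (extD_smooth hβ))
  refine eq_zero_of_forall_chartPartition
    (Φ := fun β => integral (wedgeTop (Function.update H j (extD β)))) ?_ hβ fun c => ?_
  · intro α β hα hβ
    have : extD (α + β) = extD α + extD β := funext fun x => extD_add (hα.at x) (hβ.at x)
    rw [this, wedgeTop_update_add, integral_add' (hsm hα) (hsm hβ)]
  · set γ := OneForm.mulFun (chartPartition n M c) β with hγ
    have hγs : γ.Smooth := hβ.mulFun (chartPartition n M c).contMDiff
    have hS : IsCompact (tsupport (chartPartition n M c)) := (isClosed_tsupport _).isCompact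
    have hSc := tsupport_chartPartition (n := n) c
    rw [integral_eq_chartIntegral (hsm hγs) hS hSc fun x hx =>
      wedgeTop_apply_eq_zero (j := j) (by
        rw [Function.update_self]; exact extD_mulFun_chartPartition_eq_zero β c hx)]
    rw [chartIntegral]
    have hU := (chartAt (Fin n → ℂ) c).open_target
    -- The local theorem asks for vanishing off a compact set everywhere in `ℂⁿ`, while the chart
    -- expression is meaningful on the chart target only; hence the cut-off.
    let b : (Fin n → ℂ) → (Fin n → ℂ) →L[ℝ] ℝ :=
      (chartAt (Fin n → ℂ) c).target.indicator (OneForm.inChart γ c)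
    have hbeq : EqOn b (OneForm.inChart γ c) (chartAt (Fin n → ℂ) c).target := fun y hy =>
      indicator_of_mem hy _
    refine Eq.trans ?_ (integral_wedge_fderiv_eq_zero hU (isCompact_image_chart hS hSc)
      (image_chart_subset hSc) j b ((hγs c).congr hbeq) (fun y hy => ?_)
      (fun i => TwoForm.inChart (H i) c) (fun i hi => hH i hi c) (fun i hi => hHc i hi c))
    · refine setIntegral_congr_fun hU.measurableSet fun y hy => ?_
      have hd : fderiv ℝ b y = fderiv ℝ (OneForm.inChart γ c) y :=
        (Filter.eventuallyEq_of_mem (hU.mem_nhds hy) hbeq).fderiv_eq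
      have he : TwoForm.inChart (extD γ) c y = antisymm (fderiv ℝ (OneForm.inChart γ c) y) := by
        ext v w
        exact extD_inChart hy (hγs.at _) v w
      simp only [coeff_wedgeTop, hd, inChart_update, he]
    · by_cases hyt : y ∈ (chartAt (Fin n → ℂ) c).target
      · rw [hbeq hyt]
        exact inChart_mulFun_chartPartition_eq_zero β c hyt hy
      · exact indicator_of_notMem hyt _

end Stokes

end KahlerFlow

end

noncomputable section

namespace KahlerFlow

/-! ### Derivatives of integrals that are polynomial in `t` -/

section Polynomial

variable {n : ℕ} {M : Type*} [TopologicalSpace M] [ChartedSpace (Fin n → ℂ) M]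

lemma val_add (η κ : TopForm n M) (x : M) (v) :
    TopForm.val (η + κ) x v = TopForm.val η x v + TopForm.val κ x v := rfl

lemma val_sub (η κ : TopForm n M) (x : M) (v) :
    TopForm.val (η - κ) x v = TopForm.val η x v - TopForm.val κ x v := rfl

lemma val_smul (r : ℝ) (η : TopForm n M) (x : M) (v) :
    TopForm.val (r • η) x v = r * TopForm.val η x v := rfl

lemma val_mulFun (φ : M → ℝ) (η : TopForm n M) (x : M) (v) :
    TopForm.val (TopForm.mulFun φ η) x v = φ x * TopForm.val η x v := rfl

lemma val_sum {ι : Type*} (s : Finset ι) (η : ι → TopForm n M) (x : M) (v) :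
    TopForm.val (∑ i ∈ s, η i) x v = ∑ i ∈ s, TopForm.val (η i) x v := by
  classical
  induction s using Finset.induction_on with
  | empty => rfl
  | insert i s hi ih => rw [Finset.sum_insert hi, Finset.sum_insert hi, val_add, ih]

lemma val_wedgeTop_add_smul (F A : Fin n → TwoForm n M ℝ) (t : ℝ) (x : M) (v) :
    TopForm.val (wedgeTop fun j => F j + t • A j) x v
      = ∑ s : Finset (Fin n), t ^ s.card * TopForm.val (wedgeTop (s.piecewise A F)) x v := by
  rw [wedgeTop_apply]
  refine (wedgeVal_add_smul (fun j => TwoForm.val (F j) x) (fun j => TwoForm.val (A j) x) t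
    v).trans (Finset.sum_congr rfl fun s _ => ?_)
  rw [wedgeTop_apply]
  congr 2
  funext j
  by_cases hj : j ∈ s
  · rw [Finset.piecewise_eq_of_mem _ _ _ hj, Finset.piecewise_eq_of_mem _ _ _ hj]
  · rw [Finset.piecewise_eq_of_notMem _ _ _ hj, Finset.piecewise_eq_of_notMem _ _ _ hj]

lemma piecewise_smooth {F A : Fin n → TwoForm n M ℝ} (hF : ∀ j, (F j).Smooth)
    (hA : ∀ j, (A j).Smooth) (s : Finset (Fin n)) : (wedgeTop (s.piecewise A F)).Smooth := by
  refine wedgeTop_smooth fun j => ?_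
  by_cases hj : j ∈ s
  · simpa [hj] using hA j
  · simpa [hj] using hF j

lemma sum_ite_card_eq_one {ι : Type*} [Fintype ι] [DecidableEq ι] (c : Finset ι → ℝ) :
    (∑ s : Finset ι, if s.card = 1 then c s else 0) = ∑ j, c {j} := by
  rw [← Finset.sum_filter, ← Finset.powerset_univ, ← Finset.powersetCard_eq_filter,
    Finset.powersetCard_one, Finset.sum_map]
  rfl

/-- In a product of two expansions over subsets, total degree one means that one subset is a
singleton and the other is empty. This picks out the linear term of a square. -/
lemma sum_ite_card_add_eq_one {ι : Type*} [Fintype ι] [DecidableEq ι]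
    (c : Finset ι × Finset ι → ℝ) :
    (∑ p : Finset ι × Finset ι, if p.1.card + p.2.card = 1 then c p else 0)
      = ∑ j, (c ({j}, ∅) + c (∅, {j})) := by
  have h : ∀ p : Finset ι × Finset ι, (if p.1.card + p.2.card = 1 then c p else 0)
      = (if p.2 = ∅ then (if p.1.card = 1 then c p else 0) else 0)
        + if p.1 = ∅ then (if p.2.card = 1 then c p else 0) else 0 := by
    rintro ⟨s, s'⟩
    simp only [← Finset.card_eq_zero]
    by_cases h1 : s.card = 0 <;> by_cases h2 : s'.card = 0
    · simp [h1, h2]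
    · simp [h1, h2]
    · simp [h1, h2]
    · have : s.card + s'.card ≠ 1 := by omega
      simp [h1, h2, this]
  simp_rw [h]
  rw [Finset.sum_add_distrib, Fintype.sum_prod_type, Fintype.sum_prod_type_right]
  simp only [Finset.sum_ite_eq', Finset.mem_univ, if_true]
  rw [sum_ite_card_eq_one fun s => c (s, ∅), sum_ite_card_eq_one fun s => c (∅, s),
    Finset.sum_add_distrib]

variable [IsManifold 𝓘(ℂ, Fin n → ℂ) ω M] [T2Space M] [CompactSpace M]

lemma integral_congr_frame {η κ : TopForm n M}
    (h : ∀ x, TopForm.val η x (frame n) = TopForm.val κ x (frame n)) :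
    integral η = integral κ := by
  simp only [integral, coeff_eq, h]

/-- Differentiation under the integral sign for a polynomial family of top-degree forms. -/
lemma hasDerivAt_integral {ι : Type*} [Fintype ι] (e : ι → ℕ) {ξ : ι → TopForm n M}
    (hξ : ∀ i, (ξ i).Smooth) {η : ℝ → TopForm n M}
    (hη : ∀ t x, TopForm.val (η t) x (frame n)
      = ∑ i, t ^ e i * TopForm.val (ξ i) x (frame n)) :
    HasDerivAt (fun t => integral (η t)) (∑ i, if e i = 1 then integral (ξ i) else 0) 0 := by
  have h1 : (fun t => integral (η t)) = fun t => ∑ i, t ^ e i * integral (ξ i) := by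
    funext t
    have : integral (η t) = integral (∑ i, t ^ e i • ξ i) := by
      refine integral_congr_frame fun x => ?_
      rw [hη, val_sum]
      rfl
    rw [this, integral_sum' _ fun i _ => (hξ i).smul _]
    simp only [integral_smul']
  rw [h1]
  refine HasDerivAt.fun_sum fun i _ => ?_
  have h2 := (hasDerivAt_pow (e i) (0 : ℝ)).mul_const (integral (ξ i))
  -- At `t = 0` only exponent one survives. For exponent zero the truncated `0 - 1` is harmless,
  -- because the factor in front is zero.
  have h3 : (e i * (0 : ℝ) ^ (e i - 1)) * integral (ξ i) = if e i = 1 then integral (ξ i) else 0 := ?_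
  · rwa [h3] at h2
  rcases Nat.lt_trichotomy (e i) 1 with h | h | h
  · have : e i = 0 := by omega
    simp [this]
  · simp [h]
  · have h3 : e i ≠ 1 := by omega
    have h4 : e i - 1 ≠ 0 := by omega
    simp [h3, h4]

/-- The subset `s` in the expansion records which slots take the increment and has degree `s.card`
in `t`; the derivative comes from the singletons. -/
lemma hasDerivAt_integral_wedgeTop {φ : M → ℝ} (hφ : ContMDiff (modelR n) 𝓘(ℝ, ℝ) ∞ φ)
    {F A : Fin n → TwoForm n M ℝ} (hF : ∀ j, (F j).Smooth) (hA : ∀ j, (A j).Smooth) :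
    HasDerivAt (fun t : ℝ => integral (TopForm.mulFun φ (wedgeTop fun j => F j + t • A j)))
      (∑ j, integral (TopForm.mulFun φ (wedgeTop (Function.update F j (A j))))) 0 := by
  have h := hasDerivAt_integral (fun s : Finset (Fin n) => s.card)
    (ξ := fun s => TopForm.mulFun φ (wedgeTop (s.piecewise A F)))
    (η := fun t => TopForm.mulFun φ (wedgeTop fun j => F j + t • A j))
    (fun s => (piecewise_smooth hF hA s).mulFun hφ) (fun t x => by
      rw [val_mulFun, val_wedgeTop_add_smul, Finset.mul_sum]
      refine Finset.sum_congr rfl fun s _ => ?_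
      rw [val_mulFun]
      ring)
  rw [sum_ite_card_eq_one fun s => integral (TopForm.mulFun φ (wedgeTop (s.piecewise A F)))] at h
  simpa only [Finset.piecewise_singleton] using h

lemma integral_mulFun_update_eq [NeZero n] (φ : M → ℝ) (F B : TwoForm n M ℝ) (j : Fin n) :
    integral (TopForm.mulFun φ (wedgeTop (Function.update (fun _ => F) j B)))
      = integral (TopForm.mulFun φ (wedgePow B F)) := by
  refine integral_congr_frame fun x => ?_
  rw [val_mulFun, val_mulFun, wedgePow_eq, wedgeTop_apply, wedgeTop_apply, val_update, val_update,
    wedgeVal_update_eq _ (TwoForm.val F x) _ (fun _ => rfl)]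

/-- All `n` singletons contribute the same integral, by the symmetry of the wedge product. -/
lemma hasDerivAt_integral_topPow [NeZero n] {φ : M → ℝ}
    (hφ : ContMDiff (modelR n) 𝓘(ℝ, ℝ) ∞ φ) {F A : TwoForm n M ℝ} (hF : F.Smooth)
    (hA : A.Smooth) :
    HasDerivAt (fun t : ℝ => integral (TopForm.mulFun φ (topPow (F + t • A))))
      (n * integral (TopForm.mulFun φ (wedgePow A F))) 0 := by
  have h := hasDerivAt_integral_wedgeTop hφ (fun _ : Fin n => hF) (fun _ : Fin n => hA)
  simp only [integral_mulFun_update_eq, Finset.sum_const, Finset.card_univ, Fintype.card_fin,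
    nsmul_eq_mul] at h
  exact h

/-- The derivative of `∫ ((F + tA)ⁿ - Ω)² / Fⁿ` at `t = 0`. -/
lemma hasDerivAt_integral_sq [NeZero n] {F A : TwoForm n M ℝ} (hF : F.Smooth) (hA : A.Smooth)
    {Om : TopForm n M} (hOm : Om.Smooth)
    (h0 : ∀ x, TopForm.val (topPow F) x (frame n) ≠ 0) :
    HasDerivAt (fun t : ℝ => integral (TopForm.mulFun
        (fun x => topRatio (topPow (F + t • A) - Om) (topPow F) x
          * topRatio (topPow (F + t • A) - Om) (topPow F) x) (topPow F)))
      (2 * (n * integral (TopForm.mulFun (topRatio (topPow F - Om) (topPow F))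
        (wedgePow A F)))) 0 := by
  let κ := topPow F
  have hκ : κ.Smooth := wedgeTop_smooth fun _ => hF
  -- Coefficients of `(F + tA)ⁿ - Ω`: the fixed volume form changes only the constant term, indexed
  -- by the empty set.
  let ξ : Finset (Fin n) → TopForm n M := fun s =>
    wedgeTop (s.piecewise (fun _ => A) fun _ => F) - if s = ∅ then Om else 0
  have hz : (0 : TopForm n M).Smooth := fun c => contDiffOn_const
  have hξ : ∀ s, (ξ s).Smooth := fun s => by
    refine (piecewise_smooth (fun _ => hF) (fun _ => hA) s).sub ?_
    split_ifs
    exacts [hOm, hz]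
  have hexp : ∀ t x, TopForm.val (topPow (F + t • A) - Om) x (frame n)
      = ∑ s, t ^ s.card * TopForm.val (ξ s) x (frame n) := fun t x => by
    have h1 := val_wedgeTop_add_smul (fun _ => F) (fun _ => A) t x (frame n)
    have h2 : ∑ s : Finset (Fin n), t ^ s.card
        * TopForm.val (if s = ∅ then Om else 0 : TopForm n M) x (frame n)
        = TopForm.val Om x (frame n) := by
      rw [Finset.sum_eq_single ∅ (fun s _ hs => by
        rw [if_neg hs]
        exact mul_zero _) (by simp)]
      simp
    rw [val_sub, ← h2, topPow_eq]
    refine (congrArg₂ _ h1 rfl).trans ?_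
    rw [← Finset.sum_sub_distrib]
    simp only [ξ, val_sub, mul_sub]
  have hr : ∀ s, ContMDiff (modelR n) 𝓘(ℝ, ℝ) ∞ (topRatio (ξ s) κ) := fun s =>
    topRatio_smooth (hξ s) hκ h0
  have h := hasDerivAt_integral
    (fun p : Finset (Fin n) × Finset (Fin n) => p.1.card + p.2.card)
    (ξ := fun p => TopForm.mulFun (fun x => topRatio (ξ p.1) κ x * topRatio (ξ p.2) κ x) κ)
    (η := fun t => TopForm.mulFun (fun x => topRatio (topPow (F + t • A) - Om) κ x
          * topRatio (topPow (F + t • A) - Om) κ x) κ)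
    (fun p => hκ.mulFun ((hr p.1).mul (hr p.2))) (fun t x => by
      rw [val_mulFun, topRatio_eq, hexp, Finset.sum_div, Finset.sum_mul_sum, Finset.sum_mul,
        Fintype.sum_prod_type]
      refine Finset.sum_congr rfl fun s _ => ?_
      rw [Finset.sum_mul]
      refine Finset.sum_congr rfl fun s' _ => ?_
      rw [val_mulFun, topRatio_eq, topRatio_eq]
      ring)
  rw [sum_ite_card_add_eq_one fun p => integral (TopForm.mulFun
    (fun x => topRatio (ξ p.1) κ x * topRatio (ξ p.2) κ x) κ)] at h
  -- A cross term is the linear coefficient times the constant one over `(Fⁿ)²`, multiplied by `Fⁿ`;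
  -- one denominator cancels. The two orders of the factors give the `2`.
  have hj : ∀ j : Fin n, integral (TopForm.mulFun
      (fun x => topRatio (ξ {j}) κ x * topRatio (ξ ∅) κ x) κ)
      = integral (TopForm.mulFun (topRatio (topPow F - Om) (topPow F)) (wedgePow A F)) := by
    intro j
    rw [← integral_mulFun_update_eq _ F A j]
    refine integral_congr_frame fun x => ?_
    have e1 : ξ ∅ = topPow F - Om := by
      simp only [ξ, if_true, Finset.piecewise_empty]
      rfl
    have e2 : ξ {j} = wedgeTop (Function.update (fun _ => F) j A) := by
      simp only [ξ, Finset.piecewise_singleton, Finset.singleton_ne_empty, if_false]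
      exact sub_zero _
    rw [val_mulFun, val_mulFun, e1, e2, topRatio_eq _ κ]
    have := h0 x
    change _ / TopForm.val (topPow F) x (frame n) * topRatio (topPow F - Om) (topPow F) x
      * TopForm.val (topPow F) x (frame n) = _
    field_simp
  have hj' : ∀ j : Fin n, integral (TopForm.mulFun
      (fun x => topRatio (ξ ∅) κ x * topRatio (ξ {j}) κ x) κ)
      = integral (TopForm.mulFun (topRatio (topPow F - Om) (topPow F)) (wedgePow A F)) := by
    intro j
    rw [← hj j]
    simp only [mul_comm]
  simp only [hj, hj', Finset.sum_const, Finset.card_univ, Fintype.card_fin, nsmul_eq_mul,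
    ← two_mul] at h
  rw [mul_left_comm]
  exact h

end Polynomial

/-! ### Complex structure and Kähler forms -/

section Kahler

variable {n : ℕ} {M : Type*} [TopologicalSpace M] [ChartedSpace (Fin n → ℂ) M]

/-- The two-form `a ∧ b`. -/
def wedgeForms (a b : OneForm n M ℝ) : TwoForm n M ℝ := fun x => wedge11 (a x) (b x)

lemma wedgeForms_apply (a b : OneForm n M ℝ) (x : M) (v w : Fin n → ℂ) :
    TwoForm.val (wedgeForms a b) x v w
      = OneForm.val a x v * OneForm.val b x w - OneForm.val b x v * OneForm.val a x w := rfl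

lemma twoForm_ext {G H : TwoForm n M ℝ} (h : ∀ x v w, TwoForm.val G x v w = TwoForm.val H x v w) :
    G = H := by
  funext x
  exact ContinuousLinearMap.ext fun v => ContinuousLinearMap.ext fun w => h x v w

lemma oneForm_ext {a b : OneForm n M ℝ} (h : ∀ x v, OneForm.val a x v = OneForm.val b x v) :
    a = b := by
  funext x
  exact ContinuousLinearMap.ext fun v => h x v

lemma wedgeForms_add_left (a b c : OneForm n M ℝ) :
    wedgeForms (a + b) c = wedgeForms a c + wedgeForms b c := twoForm_ext fun x v w => by
  change (OneForm.val a x v + OneForm.val b x v) * OneForm.val c x w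
    - OneForm.val c x v * (OneForm.val a x w + OneForm.val b x w)
    = (OneForm.val a x v * OneForm.val c x w - OneForm.val c x v * OneForm.val a x w)
    + (OneForm.val b x v * OneForm.val c x w - OneForm.val c x v * OneForm.val b x w)
  ring

lemma wedgeForms_smul_left (r : ℝ) (a b : OneForm n M ℝ) :
    wedgeForms (r • a) b = r • wedgeForms a b := twoForm_ext fun x v w => by
  change (r * OneForm.val a x v) * OneForm.val b x w
    - OneForm.val b x v * (r * OneForm.val a x w)
    = r * (OneForm.val a x v * OneForm.val b x w - OneForm.val b x v * OneForm.val a x w)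
  ring

lemma wedgeForms_antisymm (a b : OneForm n M ℝ) :
    wedgeForms a b = (-1 : ℝ) • wedgeForms b a := twoForm_ext fun x v w => by
  change OneForm.val a x v * OneForm.val b x w - OneForm.val b x v * OneForm.val a x w
    = -1 * (OneForm.val b x v * OneForm.val a x w - OneForm.val a x v * OneForm.val b x w)
  ring

lemma wedgeForms_compI (a b : OneForm n M ℝ) (x : M) :
    TwoForm.val (wedgeForms (compI a) (compI b)) x
      = Bil.pull (TwoForm.val (wedgeForms a b) x) (mulI n) := by
  ext v w
  rw [wedgeForms_apply, Bil.pull_apply, wedgeForms_apply, val_compI, val_compI]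
  simp only [_root_.neg_apply, ContinuousLinearMap.comp_apply]
  ring

lemma wedgeForms_smooth {a b : OneForm n M ℝ} (ha : a.Smooth) (hb : b.Smooth) :
    (wedgeForms a b).Smooth := wedge11_smooth ha hb

/-- A Kähler form: a closed positive form of type `(1,1)`. -/
structure IsKahler (F : TwoForm n M ℝ) : Prop where
  locallyExact : F.LocallyExact
  type11 : IsType11 F
  positive : IsPositive F

lemma wedgePow_add [NeZero n] (B C F : TwoForm n M ℝ) :
    wedgePow (B + C) F = wedgePow B F + wedgePow C F := by
  rw [wedgePow_eq, wedgePow_eq, wedgePow_eq, wedgeTop_update_add]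

lemma wedgePow_smul [NeZero n] (r : ℝ) (B F : TwoForm n M ℝ) :
    wedgePow (r • B) F = r • wedgePow B F := by
  rw [wedgePow_eq, wedgePow_eq, wedgeTop_update_smul]

lemma val_wedgePow [NeZero n] (B F : TwoForm n M ℝ) (x : M) :
    TopForm.val (wedgePow B F) x (frame n)
      = wedgeCoeff (Function.update (fun _ => TwoForm.val F x) 0 (TwoForm.val B x)) := by
  rw [wedgePow_eq, wedgeTop_apply, val_update]

lemma wedgePow_smooth [NeZero n] {B F : TwoForm n M ℝ} (hB : B.Smooth) (hF : F.Smooth) :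
    (wedgePow B F).Smooth := by
  rw [wedgePow_eq]
  exact wedgeTop_smooth (update_smooth (fun _ _ => hF) hB)

lemma IsKahler.topPow_pos [NeZero n] {F : TwoForm n M ℝ} (hF : IsKahler F) (x : M) :
    0 < TopForm.val (topPow F) x (frame n) := by
  rw [topPow_eq, wedgeTop_apply]
  exact wedgeCoeff_pow_pos (TwoForm.val F x) (hF.locallyExact.antisymm x) (hF.type11 x)
    (hF.positive x)

lemma topPow_smooth {F : TwoForm n M ℝ} (hF : F.Smooth) : (topPow F).Smooth :=
  wedgeTop_smooth fun _ => hF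

/-- Since `(a ∧ Ia)(v, Jv) = a(v)² + a(Jv)²`, the form is semipositive. If these values vanished for
all members of a complex basis, the real covector would vanish on a real basis, so strictness
follows from `wedgeCoeff_pos`. -/
lemma IsKahler.wedge_compI_nonneg [NeZero n] {F : TwoForm n M ℝ} (hF : IsKahler F)
    (a : OneForm n M ℝ) (x : M) :
    0 ≤ TopForm.val (wedgePow (wedgeForms a (compI a)) F) x (frame n) ∧
      (a x ≠ 0 → 0 < TopForm.val (wedgePow (wedgeForms a (compI a)) F) x (frame n)) := by
  have hB : ∀ v w, TwoForm.val (wedgeForms a (compI a)) x v w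
      = OneForm.val a x (Complex.I • v) * OneForm.val a x w
        - OneForm.val a x v * OneForm.val a x (Complex.I • w) := fun v w => by
    rw [wedgeForms_apply, val_compI]
    simp only [_root_.neg_apply, ContinuousLinearMap.comp_apply, mulI_apply]
    ring
  have hBI : ∀ v, TwoForm.val (wedgeForms a (compI a)) x v (Complex.I • v)
      = OneForm.val a x v ^ 2 + OneForm.val a x (Complex.I • v) ^ 2 := fun v => by
    rw [hB, smul_smul, Complex.I_mul_I, neg_one_smul, map_neg]
    ring
  by_cases ha : a x = 0
  · refine ⟨?_, fun h => absurd ha h⟩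
    have h0 : wedgeForms a (compI a) x = 0 := by
      have : ∀ v w, TwoForm.val (wedgeForms a (compI a)) x v w = 0 := fun v w => by
        have h1 : OneForm.val a x = 0 := ha
        rw [hB, h1]
        simp
      exact ContinuousLinearMap.ext fun v => ContinuousLinearMap.ext fun w => this v w
    rw [wedgePow_eq]
    have : wedgeTop (Function.update (fun _ => F) 0 (wedgeForms a (compI a))) x = 0 :=
      wedgeTop_apply_eq_zero (j := 0) (by rw [Function.update_self]; exact h0)
    rw [TopForm.val, this]
    rfl
  · have hpos : 0 < TopForm.val (wedgePow (wedgeForms a (compI a)) F) x (frame n) := by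
      rw [val_wedgePow]
      refine wedgeCoeff_pos (TwoForm.val F x) _ (hF.locallyExact.antisymm x) (hF.type11 x)
        (hF.positive x) (fun v w => by rw [hB, hB]; ring) (fun v => by rw [hBI]; positivity) ?_
      intro u
      by_contra hcon
      push Not at hcon
      have h1 : ∀ j, OneForm.val a x (u j) = 0 ∧ OneForm.val a x (Complex.I • u j) = 0 := by
        intro j
        have := hcon j
        rw [hBI] at this
        have h2 := sq_nonneg (OneForm.val a x (u j))
        have h3 := sq_nonneg (OneForm.val a x (Complex.I • u j))
        exact ⟨pow_eq_zero_iff two_ne_zero |>.mp (by linarith),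
          pow_eq_zero_iff two_ne_zero |>.mp (by linarith)⟩
      refine ha ?_
      have h4 : OneForm.val a x = 0 := by
        ext v
        rw [← u.sum_repr v, map_sum]
        refine Finset.sum_eq_zero fun j _ => ?_
        have : (u.repr v j) • u j
            = (u.repr v j).re • u j + (u.repr v j).im • (Complex.I • u j) := by
          ext i
          simp only [Pi.smul_apply, Pi.add_apply, smul_eq_mul, Complex.real_smul]
          rw [← mul_assoc, ← add_mul, Complex.re_add_im]
        rw [this, map_add, map_smul, map_smul, (h1 j).1, (h1 j).2]
        simp
      exact h4
    exact ⟨hpos.le, fun _ => hpos⟩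

variable [IsManifold 𝓘(ℂ, Fin n → ℂ) ω M]

/-- `I` preserves the tangent spaces. -/
lemma isTangent_compI {a : OneForm n M ℝ} (ha : IsTangent a) : IsTangent (compI a) := by
  refine ⟨ha.1.compI, fun x => ?_⟩
  have h1 : ∀ᶠ y in 𝓝 (chartAt (Fin n → ℂ) x x), OneForm.inChart (compI a) x y
      = -(OneForm.inChart a x y).comp (mulI n) := by
    filter_upwards [(chartAt (Fin n → ℂ) x).open_target.mem_nhds (mem_chart_target _ x)] with y hy
    exact inChart_compI a hy
  have key : ∀ {f g : (Fin n → ℂ) → (Fin n → ℂ) →L[ℝ] ℝ} {y}, DifferentiableAt ℝ f y →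
      (g =ᶠ[𝓝 y] fun z => -(f z).comp (mulI n)) →
      (∀ v w, antisymm (fderiv ℝ f y) (mulI n v) (mulI n w) = antisymm (fderiv ℝ f y) v w) →
      ∀ v w, antisymm (fderiv ℝ g y) (mulI n v) (mulI n w) = antisymm (fderiv ℝ g y) v w := by
    intro f g y hf hg hJ v w
    have h2 : ∀ v w, fderiv ℝ g y v w = -fderiv ℝ f y v (mulI n w) := by
      intro v w
      rw [hg.fderiv_eq, (hf.hasFDerivAt.clm_comp (hasFDerivAt_const (mulI n) y)).fun_neg.fderiv]
      simp
    -- The `J`-invariance of `da` at `(Jv, w)` is, after using `J² = -1`, the `J`-invariance of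
    -- `d(Ia)` at `(v, w)`.
    have h3 := hJ (mulI n v) w
    simp only [antisymm_apply, h2, mulI_mulI, map_neg, _root_.neg_apply, neg_neg] at h3 ⊢
    linarith
  exact key (ha.1.at x).differentiableAt h1 (ha.2 x)

lemma isTangent_smul (r : ℝ) {a : OneForm n M ℝ} (ha : IsTangent a) : IsTangent (r • a) := by
  refine ⟨ha.1.smul r, fun x v w => ?_⟩
  rw [extD_smul r (ha.1.at x)]
  exact congrArg (r * ·) (ha.2 x v w)

lemma isTangent_add {a b : OneForm n M ℝ} (ha : IsTangent a) (hb : IsTangent b) :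
    IsTangent (a + b) := by
  refine ⟨ha.1.add hb.1, fun x v w => ?_⟩
  rw [extD_add (ha.1.at x) (hb.1.at x)]
  exact congrArg₂ (· + ·) (ha.2 x v w) (hb.2 x v w)

lemma isTangent_dFun {φ : M → ℝ} (h : ContMDiff (modelR n) 𝓘(ℝ, ℝ) ∞ φ) :
    IsTangent (dFun (n := n) φ) := by
  refine ⟨vdFun_smooth h, fun x v w => ?_⟩
  rw [dFun_eq_vdFun, extD_vdFun h]
  rfl

/-- `i∂∂̄φ = d(½ I dφ)`. -/
lemma iddbar_eq {φ : M → ℝ} (h : ContMDiff (modelR n) 𝓘(ℝ, ℝ) ∞ φ) :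
    iddbar (n := n) φ = extD ((1 / 2 : ℝ) • compI (dFun φ)) := by
  -- The constants come from `∂̄φ = ½ dφ - (i/2) I dφ`. The first term is killed by `d`, and `Re(i
  -- ·)` turns `-i/2` into `½`.
  let l₁ : ℝ →L[ℝ] ℂ := (1 / 2 : ℂ) • Complex.ofRealCLM
  let l₂ : ℝ →L[ℝ] ℂ := (-Complex.I / 2) • Complex.ofRealCLM
  have ht := isTangent_dFun (n := n) h
  have hc := isTangent_compI ht
  have h1 : delbar (n := n) φ
      = (fun x => l₁.comp (dFun φ x)) + fun x => l₂.comp (compI (dFun φ) x) := by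
    funext x
    have h2 : ∀ v, delbar (n := n) φ x v = l₁ (OneForm.val (dFun φ) x v)
        + l₂ (OneForm.val (compI (dFun φ)) x v) := fun v => by
      have h3 : ∀ p q : ℝ, (1 / 2 : ℂ) * (p + Complex.I * q)
          = 1 / 2 * p + -Complex.I / 2 * ((-q : ℝ) : ℂ) := fun p q => by
        push_cast
        ring
      exact h3 (OneForm.val (dFun φ) x v) (OneForm.val (dFun φ) x (mulI n v))
    exact ContinuousLinearMap.ext h2
  refine twoForm_ext fun x v w => ?_
  have h4 : TwoForm.val (iddbar (n := n) φ) x v w = reI (extD (delbar φ) x v w) := rfl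
  have h5 : extD (dFun (n := n) φ) x v w = 0 := by
    rw [dFun_eq_vdFun, extD_vdFun h]
    rfl
  have h6 := extD_add (OneForm.SmoothAt.clm l₁ (ht.1.at x)) (OneForm.SmoothAt.clm l₂ (hc.1.at x))
  have h7 : extD (delbar (n := n) φ) x v w = l₁ (extD (dFun (n := n) φ) x v w)
      + l₂ (extD (compI (dFun (n := n) φ)) x v w) := by
    rw [h1, h6]
    exact congrArg₂ (· + ·) (extD_clm l₁ (ht.1.at x) v w) (extD_clm l₂ (hc.1.at x) v w)
  have h8 : TwoForm.val (extD ((1 / 2 : ℝ) • compI (dFun (n := n) φ))) x v w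
      = 1 / 2 * extD (compI (dFun (n := n) φ)) x v w := by
    rw [TwoForm.val, extD_smul _ (hc.1.at x)]
    rfl
  rw [h4, h7, h5, map_zero, zero_add, h8]
  generalize extD (compI (dFun (n := n) φ)) x v w = r
  have h9 : (l₂ r : ℂ) = -Complex.I / 2 * r := rfl
  rw [h9]
  simp [reI]
  ring

/-! ### The form `ν` attached to a two-form: algebra, positivity, integration by parts, closedness
-/

variable [T2Space M] [CompactSpace M]

/-- `∫ a ∧ b ∧ F^{n-1}`. -/
def nuForm [NeZero n] (F : TwoForm n M ℝ) (a b : OneForm n M ℝ) : ℝ :=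
  integral (wedgePow (wedgeForms a b) F)

section

variable [NeZero n] {F : TwoForm n M ℝ}

lemma nuForm_add_left (hF : F.Smooth) {a b c : OneForm n M ℝ} (ha : a.Smooth) (hb : b.Smooth)
    (hc : c.Smooth) : nuForm F (a + b) c = nuForm F a c + nuForm F b c := by
  rw [nuForm, wedgeForms_add_left, wedgePow_add, integral_add'
    (wedgePow_smooth (wedgeForms_smooth ha hc) hF) (wedgePow_smooth (wedgeForms_smooth hb hc) hF)]
  rfl

lemma nuForm_smul_left (r : ℝ) (a b : OneForm n M ℝ) :
    nuForm F (r • a) b = r * nuForm F a b := by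
  rw [nuForm, wedgeForms_smul_left, wedgePow_smul, integral_smul']
  rfl

lemma nuForm_antisymm (a b : OneForm n M ℝ) : nuForm F a b = -nuForm F b a := by
  rw [nuForm, wedgeForms_antisymm, wedgePow_smul, integral_smul', nuForm]
  ring

/-- The form `Ia ∧ Ib` is the pull-back of `a ∧ b` by `J`, which also preserves `F` and has
determinant one; the integrands agree pointwise. -/
lemma nuForm_compI (hF : IsType11 F) (a b : OneForm n M ℝ) :
    nuForm F (compI a) (compI b) = nuForm F a b := by
  refine integral_congr_frame fun x => ?_
  rw [val_wedgePow, val_wedgePow, wedgeForms_compI]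
  exact wedgeCoeff_update_J _ _ _ mulI_apply (hF x)

lemma nuForm_pos (hF : IsKahler F) {a : OneForm n M ℝ} (ha : a.Smooth) (h0 : a ≠ 0) :
    0 < nuForm F a (compI a) := by
  obtain ⟨x, hx⟩ := Function.ne_iff.mp h0
  exact integral_pos (wedgePow_smooth (wedgeForms_smooth ha ha.compI) hF.locallyExact.smooth)
    (fun x => (hF.wedge_compI_nonneg a x).1) ((hF.wedge_compI_nonneg a x).2 hx)

/-- `∫ ζ db ∧ F^{n-1} = ∫ b ∧ dζ ∧ F^{n-1}`. -/
lemma integral_mulFun_extD (hF : F.LocallyExact) {φ : M → ℝ}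
    (hφ : ContMDiff (modelR n) 𝓘(ℝ, ℝ) ∞ φ) {b : OneForm n M ℝ} (hb : b.Smooth) :
    integral (TopForm.mulFun φ (wedgePow (extD b) F)) = nuForm F b (dFun φ) := by
  -- Stokes' theorem for `φ b`; the Leibniz rule splits the zero integral into the two sides of the
  -- identity.
  have h1 := integral_extD_wedge_eq_zero (H := fun _ => F) 0 (fun _ _ => hF.smooth)
    (fun _ _ => hF.closed) (hb.mulFun hφ)
  have h2 : extD (OneForm.mulFun φ b)
      = (fun x => φ x • extD b x) + wedgeForms (dFun φ) b := by
    refine twoForm_ext fun x v w => ?_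
    refine (extD_mulFun hφ (hb.at x) v w).trans ?_
    have h3 : ∀ p q r s t u : ℝ, p * q + (r * s - t * u) = p * q + (r * s - u * t) := by
      intros; ring
    exact h3 _ _ _ _ _ _
  have h4 : wedgePow (fun x => φ x • extD b x) F = TopForm.mulFun φ (wedgePow (extD b) F) := by
    refine topForm_ext fun x v => ?_
    rw [val_mulFun, wedgePow_eq, wedgePow_eq, wedgeTop_apply, wedgeTop_apply, val_update,
      val_update, ← wedgeVal_update_smul]
    rfl
  have hd : (dFun (n := n) φ).Smooth := vdFun_smooth hφ
  rw [h2, wedgeTop_update_add, ← wedgePow_eq, ← wedgePow_eq, h4, integral_add'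
    ((wedgePow_smooth (extD_smooth hb) hF.smooth).mulFun hφ)
    (wedgePow_smooth (wedgeForms_smooth hd hb) hF.smooth)] at h1
  have h5 : nuForm F (dFun φ) b = integral (wedgePow (wedgeForms (dFun φ) b) F) := rfl
  rw [nuForm_antisymm, h5]
  linarith

/-- The total volume of a Kähler form depends only on its class. -/
lemma integral_topPow_add_extD (hF : F.LocallyExact) {b : OneForm n M ℝ} (hb : b.Smooth) :
    integral (topPow (F + extD b)) = integral (topPow F) := by
  have h1 : ContMDiff (modelR n) 𝓘(ℝ, ℝ) ∞ (fun _ : M => (1 : ℝ)) := contMDiff_const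
  have hone : ∀ η : TopForm n M, TopForm.mulFun (fun _ => 1) η = η := fun η => by
    funext x
    exact one_smul ℝ (η x)
  -- Along the segment `F + t db` the derivative is `n ∫ db ∧ (F + t db)^{n-1}`, zero by Stokes.
  -- Only local exactness is needed here, so the segment may leave the set of positive forms.
  have hd : ∀ t : ℝ, HasDerivAt (fun t : ℝ => integral (topPow (F + t • extD b))) 0 t := by
    intro t
    have hFt : TwoForm.LocallyExact (F + t • extD b) := by
      have : t • extD b = extD (t • b) := funext fun x => (extD_smul t (hb.at x)).symm
      rw [this]
      exact hF.add_extD (hb.smul t)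
    have h2 := hasDerivAt_integral_topPow h1 hFt.smooth (extD_smooth hb)
    have h3 := integral_extD_wedge_eq_zero (H := fun _ => F + t • extD b) 0
      (fun _ _ => hFt.smooth) (fun _ _ => hFt.closed) hb
    rw [hone, wedgePow_eq, h3, mul_zero] at h2
    simp only [hone] at h2
    -- The derivative is known at parameter zero for the base form `F + t db`; translating the
    -- parameter gives it at `t`.
    have h4 : HasDerivAt (fun s : ℝ => s - t) 1 t := (hasDerivAt_id t).sub_const t
    have h5 : HasDerivAt ((fun s : ℝ => integral (topPow (F + t • extD b + s • extD b)))
        ∘ fun s => s - t) (0 * 1) t := by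
      refine HasDerivAt.comp t ?_ h4
      rw [sub_self]
      exact h2
    rw [zero_mul] at h5
    refine h5.congr_of_eventuallyEq (Filter.Eventually.of_forall fun s => ?_)
    simp only [Function.comp_apply]
    congr 2
    rw [add_assoc]
    congr 1
    refine twoForm_ext fun x v w => ?_
    change s * TwoForm.val (extD b) x v w
      = t * TwoForm.val (extD b) x v w + (s - t) * TwoForm.val (extD b) x v w
    ring
  have h6 := is_const_of_deriv_eq_zero (fun t => (hd t).differentiableAt) (fun t => (hd t).deriv) 1 0
  have e1 : F + (1 : ℝ) • extD b = F + extD b := twoForm_ext fun x v w => by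
    change TwoForm.val F x v w + 1 * TwoForm.val (extD b) x v w
      = TwoForm.val F x v w + TwoForm.val (extD b) x v w
    ring
  have e0 : F + (0 : ℝ) • extD b = F := twoForm_ext fun x v w => by
    change TwoForm.val F x v w + 0 * TwoForm.val (extD b) x v w = TwoForm.val F x v w
    ring
  simpa only [e1, e0] using h6

/-- Stokes' theorem for `a ∧ b ∧ c ∧ F^{n-2}`: the three terms are `d` applied to each covector in
turn. They must be treated together, since separately they need not vanish. -/
lemma integral_cyclic_eq_zero (hF : F.LocallyExact) {j : Fin n} (hj : 0 ≠ j)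
    {a b c : OneForm n M ℝ} (ha : a.Smooth) (hb : b.Smooth) (hc : c.Smooth) :
    integral (wedgeTop (Function.update (Function.update (fun _ => F) 0 (wedgeForms b c)) j
        (extD a)))
      + integral (wedgeTop (Function.update (Function.update (fun _ => F) 0 (wedgeForms c a)) j
        (extD b)))
      + integral (wedgeTop (Function.update (Function.update (fun _ => F) 0 (wedgeForms a b)) j
        (extD c))) = 0 := by
  let T : TwoForm n M ℝ → TwoForm n M ℝ → TopForm n M := fun B A =>
    wedgeTop (Function.update (Function.update (fun _ => F) 0 B) j A)
  have hT1 : ∀ B A A', T B (A + A') = T B A + T B A' := fun B A A' => wedgeTop_update_add _ _ _ _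
  have hT2 : ∀ B B' A, T (B + B') A = T B A + T B' A := fun B B' A => by
    have : ∀ B, T B A = wedgeTop (Function.update (Function.update (fun _ => F) j A) 0 B) :=
      fun B => by simp only [T]; rw [Function.update_comm hj]
    rw [this, this, this, wedgeTop_update_add]
  have hTs : ∀ {B A : TwoForm n M ℝ}, B.Smooth → A.Smooth → (T B A).Smooth := fun hB hA =>
    wedgeTop_smooth (update_smooth (fun i _ => update_smooth (fun _ _ => hF.smooth) hB i) hA)
  have hT0 : ∀ {B A : TwoForm n M ℝ} {x : M}, A x = 0 → T B A x = 0 := fun h =>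
    wedgeTop_apply_eq_zero (j := j) (by rw [Function.update_self]; exact h)
  have hT0' : ∀ {B A : TwoForm n M ℝ} {x : M}, B x = 0 → T B A x = 0 := fun h =>
    wedgeTop_apply_eq_zero (j := 0) (by
      rw [Function.update_of_ne hj, Function.update_self]; exact h)
  change integral (T (wedgeForms b c) (extD a)) + integral (T (wedgeForms c a) (extD b))
    + integral (T (wedgeForms a b) (extD c)) = 0
  -- Cutting off `a` alone is enough: the whole expression is additive in `a`, and each of its terms
  -- contains `a` or `da`, so all three become supported in one chart.
  refine eq_zero_of_forall_chartPartition (Φ := fun a => integral (T (wedgeForms b c) (extD a))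
    + integral (T (wedgeForms c a) (extD b)) + integral (T (wedgeForms a b) (extD c))) ?_ ha
    fun d => ?_
  · intro α β hα hβ
    have h1 : extD (α + β) = extD α + extD β := funext fun x => extD_add (hα.at x) (hβ.at x)
    have h2 : wedgeForms c (α + β) = wedgeForms c α + wedgeForms c β := twoForm_ext fun x v w => by
      change OneForm.val c x v * (OneForm.val α x w + OneForm.val β x w)
        - (OneForm.val α x v + OneForm.val β x v) * OneForm.val c x w
        = (OneForm.val c x v * OneForm.val α x w - OneForm.val α x v * OneForm.val c x w)
        + (OneForm.val c x v * OneForm.val β x w - OneForm.val β x v * OneForm.val c x w)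
      ring
    beta_reduce
    rw [h1, h2, wedgeForms_add_left, hT1, hT2, hT2,
      integral_add' (hTs (wedgeForms_smooth hb hc) (extD_smooth hα))
        (hTs (wedgeForms_smooth hb hc) (extD_smooth hβ)),
      integral_add' (hTs (wedgeForms_smooth hc hα) (extD_smooth hb))
        (hTs (wedgeForms_smooth hc hβ) (extD_smooth hb)),
      integral_add' (hTs (wedgeForms_smooth hα hb) (extD_smooth hc))
        (hTs (wedgeForms_smooth hβ hb) (extD_smooth hc))]
    ring
  · set γ := OneForm.mulFun (chartPartition n M d) a with hγ
    have hγs : γ.Smooth := ha.mulFun (chartPartition n M d).contMDiff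
    have hS : IsCompact (tsupport (chartPartition n M d)) := (isClosed_tsupport _).isCompact
    have hSd := tsupport_chartPartition (n := n) d
    have hγ0 : ∀ x ∉ tsupport (chartPartition n M d), OneForm.val γ x = 0 := fun x hx => by
      have : γ x = 0 := by
        rw [hγ, OneForm.mulFun, image_eq_zero_of_notMem_tsupport hx, zero_smul]
      exact this
    have z1 : ∀ x ∉ tsupport (chartPartition n M d), T (wedgeForms b c) (extD γ) x = 0 :=
      fun x hx => hT0 (extD_mulFun_chartPartition_eq_zero a d hx)
    have z2 : ∀ x ∉ tsupport (chartPartition n M d), T (wedgeForms c γ) (extD b) x = 0 :=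
      fun x hx => hT0' (by
        refine ContinuousLinearMap.ext fun v => ContinuousLinearMap.ext fun w => ?_
        change OneForm.val c x v * OneForm.val γ x w - OneForm.val γ x v * OneForm.val c x w = 0
        rw [hγ0 x hx]
        change OneForm.val c x v * 0 - 0 * OneForm.val c x w = 0
        ring)
    have z3 : ∀ x ∉ tsupport (chartPartition n M d), T (wedgeForms γ b) (extD c) x = 0 :=
      fun x hx => hT0' (by
        refine ContinuousLinearMap.ext fun v => ContinuousLinearMap.ext fun w => ?_
        change OneForm.val γ x v * OneForm.val b x w - OneForm.val b x v * OneForm.val γ x w = 0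
        rw [hγ0 x hx]
        change 0 * OneForm.val b x w - OneForm.val b x v * 0 = 0
        ring)
    have s1 := hTs (wedgeForms_smooth hb hc) (extD_smooth hγs)
    have s2 := hTs (wedgeForms_smooth hc hγs) (extD_smooth hb)
    have s3 := hTs (wedgeForms_smooth hγs hb) (extD_smooth hc)
    have i1 := integrableOn_coeff s1 hS hSd z1
    have i2 := integrableOn_coeff s2 hS hSd z2
    have i3 := integrableOn_coeff s3 hS hSd z3
    have i12 : IntegrableOn (fun y => TopForm.coeff (T (wedgeForms b c) (extD γ)) d y
      + TopForm.coeff (T (wedgeForms c γ) (extD b)) d y) (chartAt (Fin n → ℂ) d).target := i1.add i2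
    rw [integral_eq_chartIntegral s1 hS hSd z1, integral_eq_chartIntegral s2 hS hSd z2,
      integral_eq_chartIntegral s3 hS hSd z3, chartIntegral, chartIntegral, chartIntegral,
      ← MeasureTheory.integral_add i1 i2, ← MeasureTheory.integral_add i12 i3]
    have hU := (chartAt (Fin n → ℂ) d).open_target
    let g : (Fin n → ℂ) → (Fin n → ℂ) →L[ℝ] ℝ :=
      (chartAt (Fin n → ℂ) d).target.indicator (OneForm.inChart γ d)
    have hgeq : EqOn g (OneForm.inChart γ d) (chartAt (Fin n → ℂ) d).target := fun y hy =>
      indicator_of_mem hy _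
    refine Eq.trans ?_ (integral_wedge_cyclic_eq_zero hU (isCompact_image_chart hS hSd)
      (image_chart_subset hSd) hj g (OneForm.inChart b d) (OneForm.inChart c d)
      ((hγs d).congr hgeq) (hb d) (hc d) (fun y hy => ?_)
      (fun _ => TwoForm.inChart F d) (fun _ => hF.smooth d) (fun _ => hF.closed d))
    · refine setIntegral_congr_fun hU.measurableSet fun y hy => ?_
      have hd : fderiv ℝ g y = fderiv ℝ (OneForm.inChart γ d) y :=
        (Filter.eventuallyEq_of_mem (hU.mem_nhds hy) hgeq).fderiv_eq
      have he : ∀ {γ : OneForm n M ℝ}, γ.Smooth → TwoForm.inChart (extD γ) d y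
          = antisymm (fderiv ℝ (OneForm.inChart γ d) y) := fun hγs => by
        ext v w
        exact extD_inChart hy (hγs.at _) v w
      have hw : ∀ a b : OneForm n M ℝ, TwoForm.inChart (wedgeForms a b) d y
          = antisymm ((OneForm.inChart a d y).smulRight (OneForm.inChart b d y)) := fun a b =>
        inChart_wedge11 a b d y
      simp only [T, coeff_wedgeTop, hd, inChart_update, he hγs, he hb, he hc, hw, hgeq hy]
    · by_cases hyt : y ∈ (chartAt (Fin n → ℂ) d).target
      · rw [hgeq hyt]
        exact inChart_mulFun_chartPartition_eq_zero a d hyt hy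
      · exact indicator_of_notMem hyt _

/-- `ν` is closed. -/
lemma exists_hasDerivAt_nuForm (hF : F.LocallyExact) {a b c : OneForm n M ℝ} (ha : a.Smooth)
    (hb : b.Smooth) (hc : c.Smooth) : ∃ da db dc : ℝ,
      HasDerivAt (fun t : ℝ => nuForm (F + t • extD a) b c) da 0 ∧
      HasDerivAt (fun t : ℝ => nuForm (F + t • extD b) c a) db 0 ∧
      HasDerivAt (fun t : ℝ => nuForm (F + t • extD c) a b) dc 0 ∧ da + db + dc = 0 := by
  -- Slot `0` holds the wedge of the two fixed covectors and does not vary with `t`, hence its zero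
  -- increment; the slots with `F` carry the exterior derivative.
  let A : TwoForm n M ℝ → Fin n → TwoForm n M ℝ := fun B => Function.update (fun _ => B) 0 0
  let D : OneForm n M ℝ → OneForm n M ℝ → OneForm n M ℝ → Fin n → ℝ := fun a b c j =>
    integral (wedgeTop (Function.update (Function.update (fun _ => F) 0 (wedgeForms b c)) j
      (A (extD a) j)))
  have hz : (0 : TwoForm n M ℝ).Smooth := fun c v w => contDiffOn_const
  have h1 : ContMDiff (modelR n) 𝓘(ℝ, ℝ) ∞ (fun _ : M => (1 : ℝ)) := contMDiff_const
  have hone : ∀ η : TopForm n M, TopForm.mulFun (fun _ => 1) η = η := fun η => by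
    funext x
    exact one_smul ℝ (η x)
  have key : ∀ {a b c : OneForm n M ℝ}, a.Smooth → b.Smooth → c.Smooth →
      HasDerivAt (fun t : ℝ => nuForm (F + t • extD a) b c) (∑ j, D a b c j) 0 := by
    intro a b c ha hb hc
    have h2 := hasDerivAt_integral_wedgeTop h1
      (update_smooth (j := 0) (G := fun _ => F) (fun _ _ => hF.smooth) (wedgeForms_smooth hb hc))
      (update_smooth (j := 0) (G := fun _ => extD a) (fun _ _ => extD_smooth ha) hz)
    simp only [hone] at h2
    refine h2.congr_of_eventuallyEq (Filter.Eventually.of_forall fun t => ?_)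
    simp only [nuForm, wedgePow_eq]
    congr 2
    funext i
    by_cases hi : i = 0
    · subst hi
      simp only [Function.update_self]
      refine twoForm_ext fun x v w => ?_
      change TwoForm.val (wedgeForms b c) x v w = TwoForm.val (wedgeForms b c) x v w + t * 0
      ring
    · simp only [Function.update_of_ne hi]
  refine ⟨_, _, _, key ha hb hc, key hb hc ha, key hc ha hb, ?_⟩
  rw [← Finset.sum_add_distrib, ← Finset.sum_add_distrib]
  refine Finset.sum_eq_zero fun j _ => ?_
  -- The derivative in slot `0` is zero. For any other slot the three directions form the cyclic sum
  -- of Stokes' theorem; for `n = 1` there is no such slot.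
  by_cases hj : j = 0
  · subst hj
    have hD : ∀ a b c, D a b c 0 = 0 := fun a b c => by
      have : wedgeTop (Function.update (Function.update (fun _ => F) 0 (wedgeForms b c)) 0
          (A (extD a) 0)) = 0 := by
        funext x
        refine wedgeTop_apply_eq_zero (j := 0) ?_
        simp only [A, Function.update_self]
        rfl
      simp only [D, this, integral_zero']
    rw [hD, hD, hD]
    simp
  · have hD : ∀ a b c, D a b c j = integral (wedgeTop (Function.update
        (Function.update (fun _ => F) 0 (wedgeForms b c)) j (extD a))) := fun a b c => by
      simp only [D, A, Function.update_of_ne hj]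
    rw [hD, hD, hD]
    exact integral_cyclic_eq_zero hF (Ne.symm hj) ha hb hc

end

end Kahler

end KahlerFlow

end

noncomputable section

namespace KahlerFlow

/-! ### The line bundle: frames, local connection forms, curvature, gauge action -/

section LineBundle

variable {n : ℕ} {M : Type*} [TopologicalSpace M] [ChartedSpace (Fin n → ℂ) M]
  {V : M → Type*} [TopologicalSpace (TotalSpace ℂ V)] [∀ x, NormedAddCommGroup (V x)]
  [∀ x, InnerProductSpace ℂ (V x)] [FiberBundle ℂ V] [VectorBundle ℂ ℂ V]

variable (V) in
/-- The domain of the local frame at `x`. -/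
def frameSet (x : M) : Set M := (trivializationAt ℂ V x).baseSet

lemma isOpen_frameSet (x : M) : IsOpen (frameSet V x) := (trivializationAt ℂ V x).open_baseSet

lemma mem_frameSet (x : M) : x ∈ frameSet V x := mem_baseSet_trivializationAt ℂ V x

/-- The coordinate on the fibre over `y` given by the local frame at `x`. -/
def coordAt (x y : M) : V y →L[ℝ] ℂ := (trivializationAt ℂ V x).continuousLinearMapAt ℝ y

lemma coordAt_apply {x y : M} (hy : y ∈ frameSet V x) (p : V y) :
    coordAt x y p = (trivializationAt ℂ V x ⟨y, p⟩).2 := by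
  rw [coordAt, Trivialization.continuousLinearMapAt_apply, Trivialization.coe_linearMapAt_of_mem _ hy]

lemma coordAt_smul {x y : M} (hy : y ∈ frameSet V x) (z : ℂ) (p : V y) :
    coordAt x y (z • p) = z * coordAt x y p := by
  rw [coordAt_apply hy, coordAt_apply hy]
  exact ((trivialization_linear ℂ (trivializationAt ℂ V x)).linear y hy).map_smul z p

lemma coordAt_localFrame {x y : M} (hy : y ∈ frameSet V x) :
    coordAt x y (localFrame (V := V) x y) = 1 := by
  rw [coordAt_apply hy, localFrame, Trivialization.apply_mk_symm _ hy]

lemma coordAt_injective {x y : M} (hy : y ∈ frameSet V x) {p q : V y}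
    (h : coordAt x y p = coordAt x y q) : p = q := by
  rw [coordAt_apply hy, coordAt_apply hy] at h
  rw [← (trivializationAt ℂ V x).symm_apply_apply_mk hy p, h,
    (trivializationAt ℂ V x).symm_apply_apply_mk hy q]

lemma coordAt_smul_localFrame {x y : M} (hy : y ∈ frameSet V x) (p : V y) :
    coordAt x y p • localFrame x y = p :=
  coordAt_injective hy (by rw [coordAt_smul hy, coordAt_localFrame hy, mul_one])

lemma localFrame_ne_zero {x y : M} (hy : y ∈ frameSet V x) : localFrame (V := V) x y ≠ 0 := by
  intro h
  have := coordAt_localFrame hy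
  rw [h, map_zero] at this
  exact zero_ne_one this

lemma coordAt_localFrame_ne_zero {x z y : M} (hx : y ∈ frameSet V x) (hz : y ∈ frameSet V z) :
    coordAt x y (localFrame (V := V) z y) ≠ 0 := fun h =>
  localFrame_ne_zero hz (coordAt_injective hx (by rw [h, map_zero]))

/-- A form with values in the line bundle, written in the local frame at `x`. -/
def coordForm (B : Π y : M, Tan n y →L[ℝ] V y) (x : M) : OneForm n M ℂ := fun y =>
  (coordAt x y).comp (B y)

lemma localForm_eq_coordForm (nab : Conn n V) (x : M) :
    localForm nab x = coordForm (nab (localFrame x)) x := rfl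

lemma localForm_apply (nab : Conn n V) (x y : M) (v : Tan n y) :
    localForm nab x y v = coordAt x y (nab (localFrame x) y v) := rfl

variable [IsManifold 𝓘(ℂ, Fin n → ℂ) ω M]

lemma contMDiffAt_section_iff_coordAt [ContMDiffVectorBundle ∞ ℂ V (modelR n)] {σ : Π x : M, V x}
    {x z : M} (hz : z ∈ frameSet V x) :
    ContMDiffAt (modelR n) ((modelR n).prod 𝓘(ℝ, ℂ)) ∞ (fun y => TotalSpace.mk' ℂ y (σ y)) z ↔
      ContMDiffAt (modelR n) 𝓘(ℝ, ℂ) ∞ (fun y => coordAt x y (σ y)) z := by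
  rw [Trivialization.contMDiffAt_section_iff (trivializationAt ℂ V x) hz]
  refine Filter.EventuallyEq.contMDiffAt_iff ?_
  filter_upwards [(isOpen_frameSet x).mem_nhds hz] with y hy
  rw [coordAt_apply hy]

lemma secDiffAt_iff_coordAt [ContMDiffVectorBundle ∞ ℂ V (modelR n)] {σ : Π x : M, V x} {x z : M}
    (hz : z ∈ frameSet V x) : SecDiffAt n σ z ↔
      MDifferentiableAt (modelR n) 𝓘(ℝ, ℂ) (fun y => coordAt x y (σ y)) z := by
  rw [SecDiffAt, Trivialization.mdifferentiableAt_section_iff _ (trivializationAt ℂ V x) _ hz]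
  refine Filter.EventuallyEq.mdifferentiableAt_iff ?_
  filter_upwards [(isOpen_frameSet x).mem_nhds hz] with y hy
  rw [coordAt_apply hy]

/-- The tangent trivialization centred at `x` is the differential of the inverse chart. Smoothness
of a bundle-valued covector field is therefore smoothness of its chart coefficients once a frame is
chosen. -/
lemma contMDiffAt_hom_iff [ContMDiffVectorBundle ∞ ℂ V (modelR n)]
    {B : Π y : M, Tan n y →L[ℝ] V y} {x z : M} (hz : z ∈ frameSet V x)
    (hz' : z ∈ (chartAt (Fin n → ℂ) x).source) :
    ContMDiffAt (modelR n) ((modelR n).prod 𝓘(ℝ, (Fin n → ℂ) →L[ℝ] ℂ)) ∞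
      (fun y => (⟨y, B y⟩ : TotalSpace ((Fin n → ℂ) →L[ℝ] ℂ) fun y => Tan n y →L[ℝ] V y)) z ↔
      OneForm.SmoothAt (coordForm B x) z := by
  rw [Trivialization.contMDiffAt_section_iff
    (trivializationAt ((Fin n → ℂ) →L[ℝ] ℂ) (fun y => Tan n y →L[ℝ] V y) x) (by
      rw [hom_trivializationAt_baseSet]
      exact ⟨hz', hz⟩)]
  have h1 : (fun y => (trivializationAt ((Fin n → ℂ) →L[ℝ] ℂ) (fun y => Tan n y →L[ℝ] V y) x
      ⟨y, B y⟩).2) =ᶠ[𝓝 z] fun y => OneForm.inChart (coordForm B x) x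
        (chartAt (Fin n → ℂ) x y) := by
    filter_upwards [(chartAt (Fin n → ℂ) x).open_source.mem_nhds hz'] with y hy
    rw [hom_trivializationAt_apply]
    change ((coordAt x y).comp (B y)).comp _ = _
    have h2 : (trivializationAt (Fin n → ℂ) (Tan n) x).symmL ℝ y
        = jac x (chartAt (Fin n → ℂ) x y) := by
      rw [TangentBundle.symmL_trivializationAt hy]
      simp only [modelWithCornersSelf_coe, range_id, mfderivWithin_univ]
      rfl
    rw [OneForm.inChart_eq, (chartAt (Fin n → ℂ) x).left_inv hy, ← h2]
    rfl
  rw [h1.contMDiffAt_iff]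
  constructor
  · intro h
    refine OneForm.smoothAt_of_inChart hz' ?_
    have h2 : ContMDiffOn (modelR n) (modelR n) ∞ (chartAt (Fin n → ℂ) x).symm
      (chartAt (Fin n → ℂ) x).target := contMDiffOn_chart_symm
    have h3 := (h2.contMDiffAt ((chartAt (Fin n → ℂ) x).open_target.mem_nhds
      ((chartAt (Fin n → ℂ) x).map_source hz')))
    have h4 := ContMDiffAt.comp (chartAt (Fin n → ℂ) x z) (by
      rwa [(chartAt (Fin n → ℂ) x).left_inv hz']) h3
    refine (contMDiffAt_iff_contDiffAt.mp h4).congr_of_eventuallyEq ?_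
    filter_upwards [(chartAt (Fin n → ℂ) x).open_target.mem_nhds
      ((chartAt (Fin n → ℂ) x).map_source hz')] with y hy
    rw [Function.comp_apply, (chartAt (Fin n → ℂ) x).right_inv hy]
  · intro h
    have h3 := OneForm.SmoothAt.inChart ((chartAt (Fin n → ℂ) x).map_source hz')
      (α := coordForm B x) (by rwa [(chartAt (Fin n → ℂ) x).left_inv hz'])
    have h1 : ContMDiffOn (modelR n) (modelR n) ∞ (chartAt (Fin n → ℂ) x)
      (chartAt (Fin n → ℂ) x).source := contMDiffOn_chart
    exact h3.contMDiffAt.comp z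
      (h1.contMDiffAt ((chartAt (Fin n → ℂ) x).open_source.mem_nhds hz'))

/-- The product of a complex function and a complex one-form. -/
def OneForm.cmul (f : M → ℂ) (α : OneForm n M ℂ) : OneForm n M ℂ := fun y => f y • α y

lemma OneForm.SmoothAt.cmul {f : M → ℂ} {α : OneForm n M ℂ} {x : M}
    (hf : ContMDiffAt (modelR n) 𝓘(ℝ, ℂ) ∞ f x) (hα : OneForm.SmoothAt α x) :
    OneForm.SmoothAt (OneForm.cmul f α) x := by
  have h : ContDiffAt ℝ ∞ (fun y => f ((chartAt (Fin n → ℂ) x).symm y))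
      (chartAt (Fin n → ℂ) x x) := contDiffAt_comp_chart_symm (mem_chart_target _ x) (by
        rwa [(chartAt (Fin n → ℂ) x).left_inv (mem_chart_source _ x)])
  exact ContDiffAt.smul h hα

lemma eventually_chart_symm {x : M} {p : M → Prop} (h : ∀ᶠ z in 𝓝 x, p z) :
    ∀ᶠ y in 𝓝 (chartAt (Fin n → ℂ) x x), p ((chartAt (Fin n → ℂ) x).symm y) := by
  have h2 : ContinuousAt (chartAt (Fin n → ℂ) x).symm (chartAt (Fin n → ℂ) x x) :=
    (chartAt (Fin n → ℂ) x).continuousAt_symm (mem_chart_target _ x)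
  have h3 : Filter.Tendsto (chartAt (Fin n → ℂ) x).symm (𝓝 (chartAt (Fin n → ℂ) x x)) (𝓝 x) := by
    have := h2.tendsto
    rwa [(chartAt (Fin n → ℂ) x).left_inv (mem_chart_source _ x)] at this
  exact h3.eventually h

lemma OneForm.SmoothAt.congr {W : Type*} [NormedAddCommGroup W] [NormedSpace ℝ W]
    {α β : OneForm n M W} {x : M} (hβ : OneForm.SmoothAt β x) (h : ∀ᶠ z in 𝓝 x, α z = β z) :
    OneForm.SmoothAt α x := by
  refine ContDiffAt.congr_of_eventuallyEq hβ ?_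
  filter_upwards [eventually_chart_symm h] with y hy
  rw [OneForm.inChart, OneForm.inChart, hy]

/-- The logarithmic derivative of a nonvanishing function is smooth and closed. -/
lemma logDeriv_smoothAt {G : M → ℂ} {x : M}
    (hG : ∀ᶠ z in 𝓝 x, ContMDiffAt (modelR n) 𝓘(ℝ, ℂ) ∞ G z) (h0 : G x ≠ 0) :
    OneForm.SmoothAt (OneForm.cmul (fun y => (G y)⁻¹) (vdFun (n := n) G)) x ∧
      extD (OneForm.cmul (fun y => (G y)⁻¹) (vdFun (n := n) G)) x = 0 := by
  have h1 : ContDiffAt ℝ ∞ (fun y => G ((chartAt (Fin n → ℂ) x).symm y))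
      (chartAt (Fin n → ℂ) x x) := contDiffAt_comp_chart_symm (mem_chart_target _ x) (by
        rw [(chartAt (Fin n → ℂ) x).left_inv (mem_chart_source _ x)]
        exact hG.self_of_nhds)
  have h2 : OneForm.inChart (OneForm.cmul (fun y => (G y)⁻¹) (vdFun (n := n) G)) x
      =ᶠ[𝓝 (chartAt (Fin n → ℂ) x x)] fun y => (G ((chartAt (Fin n → ℂ) x).symm y))⁻¹ •
        fderiv ℝ (fun z => G ((chartAt (Fin n → ℂ) x).symm z)) y := by
    filter_upwards [inChart_vdFun_eventuallyEq (mem_chart_target (Fin n → ℂ) x) (φ := G) (by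
      rw [(chartAt (Fin n → ℂ) x).left_inv (mem_chart_source _ x)]
      exact hG.mono fun z hz => hz.mdifferentiableAt (by simp))] with y hy
    rw [← hy]
    rfl
  have h3 : G ((chartAt (Fin n → ℂ) x).symm (chartAt (Fin n → ℂ) x x)) ≠ 0 := by
    rwa [(chartAt (Fin n → ℂ) x).left_inv (mem_chart_source _ x)]
  constructor
  · exact ContDiffAt.congr_of_eventuallyEq
      ((h1.inv h3).smul (h1.fderiv_right (m := ∞) (by simp))) h2
  · have key : ∀ {f : (Fin n → ℂ) → (Fin n → ℂ) →L[ℝ] ℂ} {g : (Fin n → ℂ) → ℂ} {y},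
        f =ᶠ[𝓝 y] (fun z => (g z)⁻¹ • fderiv ℝ g z) → ContDiffAt ℝ ∞ g y → g y ≠ 0 →
        antisymm (fderiv ℝ f y) = 0 := by
      intro f g y hfg hg hg0
      rw [hfg.fderiv_eq]
      ext v w
      rw [antisymm_apply, fderiv_logDeriv_symm (hg.of_le (WithTop.coe_le_coe.mpr le_top)) hg0,
        sub_self]
      rfl
    exact key h2 h1 h3

lemma vdFun_clm {W W' : Type*} [NormedAddCommGroup W] [NormedSpace ℝ W] [NormedAddCommGroup W']
    [NormedSpace ℝ W'] (l : W →L[ℝ] W') {f : M → W} {x : M}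
    (hf : MDifferentiableAt (modelR n) 𝓘(ℝ, W) f x) (v : Tan n x) :
    vdFun (fun y => l (f y)) x v = l (vdFun f x v) := by
  have h := (l.hasFDerivAt (x := f x)).hasMFDerivAt.comp x hf.hasMFDerivAt
  have h1 : mfderiv (modelR n) 𝓘(ℝ, W') (fun y => l (f y)) x = _ := h.mfderiv
  change mfderiv (modelR n) 𝓘(ℝ, W') (fun y => l (f y)) x v = _
  rw [h1]
  rfl

variable [ContMDiffVectorBundle ∞ ℂ V (modelR n)]

lemma secDiffAt_localFrame {x z : M} (hz : z ∈ frameSet V x) :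
    SecDiffAt n (localFrame (V := V) x) z := by
  rw [secDiffAt_iff_coordAt hz]
  refine (mdifferentiableAt_const (c := (1 : ℂ))).congr_of_eventuallyEq ?_
  filter_upwards [(isOpen_frameSet x).mem_nhds hz] with y hy using coordAt_localFrame hy

lemma contMDiffAt_localFrame {x z : M} (hz : z ∈ frameSet V x) :
    ContMDiffAt (modelR n) ((modelR n).prod 𝓘(ℝ, ℂ)) ∞
      (fun y => TotalSpace.mk' ℂ y (localFrame (V := V) x y)) z := by
  rw [contMDiffAt_section_iff_coordAt hz]
  refine (contMDiffAt_const (c := (1 : ℂ))).congr_of_eventuallyEq ?_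
  filter_upwards [(isOpen_frameSet x).mem_nhds hz] with y hy using coordAt_localFrame hy

lemma contMDiffAt_smul_section {f : M → ℂ} {σ : Π x : M, V x} {x : M}
    (hf : ContMDiffAt (modelR n) 𝓘(ℝ, ℂ) ∞ f x)
    (hσ : ContMDiffAt (modelR n) ((modelR n).prod 𝓘(ℝ, ℂ)) ∞ (fun y => TotalSpace.mk' ℂ y (σ y)) x) :
    ContMDiffAt (modelR n) ((modelR n).prod 𝓘(ℝ, ℂ)) ∞
      (fun y => TotalSpace.mk' ℂ y (f y • σ y)) x := by
  rw [contMDiffAt_section_iff_coordAt (mem_frameSet x)] at hσ ⊢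
  have h1 : ContDiff ℝ ∞ (fun p : ℂ × ℂ => p.1 * p.2) := contDiff_fst.mul contDiff_snd
  refine (h1.contMDiff.contMDiffAt.comp x (hf.prodMk_space hσ)).congr_of_eventuallyEq ?_
  filter_upwards [(isOpen_frameSet (V := V) x).mem_nhds (mem_frameSet x)] with y hy
  exact coordAt_smul hy _ _

variable {nab nab' : Conn n V}

/-- The Leibniz rule for complex functions. -/
lemma IsUnitary.leibniz (h : IsUnitary nab) {f : M → ℂ} {σ : Π x : M, V x} {x : M}
    (hf : MDifferentiableAt (modelR n) 𝓘(ℝ, ℂ) f x) (hσ : SecDiffAt n σ x) (v : Tan n x) :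
    nab (fun y => f y • σ y) x v = vdFun (n := n) f x v • σ x + f x • nab σ x v := by
  have hI : SecDiffAt n (fun y => Complex.I • σ y) x :=
    secDiffAt_smul (f := fun _ => Complex.I) mdifferentiableAt_const hσ
  have hcl : ∀ l : ℂ →L[ℝ] ℝ, MDifferentiableAt (modelR n) 𝓘(ℝ, ℝ) (fun y => l (f y)) x :=
    fun l => l.differentiableAt.mdifferentiableAt.comp x hf
  have hsm : ∀ (l : ℂ →L[ℝ] ℝ) {τ : Π x : M, V x}, SecDiffAt n τ x →
      SecDiffAt n ((fun y => l (f y)) • τ) x := by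
    intro l τ hτ
    have h1 := secDiffAt_smul (f := fun y => ((l (f y) : ℝ) : ℂ))
      (Complex.ofRealCLM.differentiableAt.mdifferentiableAt.comp x (hcl l)) hτ
    simp only [Complex.coe_smul] at h1
    exact h1
  -- The built-in Leibniz rule is for real functions. It is applied to the real and imaginary parts
  -- of `f`, and complex linearity of `∇` recombines them.
  have e : (fun y => f y • σ y) = (fun y => Complex.reCLM (f y)) • σ
      + (fun y => Complex.imCLM (f y)) • (fun y => Complex.I • σ y) := by
    funext y
    change f y • σ y = (f y).re • σ y + (f y).im • Complex.I • σ y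
    rw [← Complex.coe_smul (f y).re, ← Complex.coe_smul (f y).im, smul_smul, ← add_smul,
      Complex.re_add_im]
  have e2 := nab.isCovariantDerivativeOnUniv.leibniz hσ (hcl Complex.reCLM)
  have e3 := nab.isCovariantDerivativeOnUniv.leibniz hI (hcl Complex.imCLM)
  rw [e, nab.isCovariantDerivativeOnUniv.add (hsm _ hσ) (hsm _ hI), e2, e3]
  have h1 := vdFun_clm Complex.reCLM hf v
  have h2 := vdFun_clm Complex.imCLM hf v
  change ((f x).re • nab σ x v + vdFun (fun y => Complex.reCLM (f y)) x v • σ x)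
    + ((f x).im • nab (fun y => Complex.I • σ y) x v
      + vdFun (fun y => Complex.imCLM (f y)) x v • Complex.I • σ x) = _
  rw [h1, h2, h.complexLinear σ x hσ v]
  have key : ∀ (z w : ℂ) (p q : V x), (z.re • p + w.re • q) + (z.im • Complex.I • p
      + w.im • Complex.I • q) = w • q + z • p := by
    intro z w p q
    have key2 : ∀ (z : ℂ) (p : V x), z • p = z.re • p + z.im • Complex.I • p := by
      intro z p
      rw [← Complex.coe_smul z.re, ← Complex.coe_smul z.im, smul_smul, ← add_smul,
        Complex.re_add_im]
    rw [key2 z p, key2 w q]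
    abel
  exact key _ _ _ _

/-- The formula `∇ = d + θ` in a frame: a section is a function times the frame near the point, and
`∇` depends only on the germ. -/
lemma IsUnitary.coordAt_apply_section (h : IsUnitary nab) {σ : Π x : M, V x} {x z : M}
    (hz : z ∈ frameSet V x) (hσ : SecDiffAt n σ z) (v : Tan n z) :
    coordAt x z (nab σ z v) = vdFun (n := n) (fun y => coordAt x y (σ y)) z v
      + coordAt x z (σ z) * localForm nab x z v := by
  have hf := (secDiffAt_iff_coordAt hz).mp hσ
  have h1 : nab σ z = nab (fun y => coordAt x y (σ y) • localFrame x y) z := by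
    refine nab.isCovariantDerivativeOnUniv.congr_of_eventuallyEq hσ
      (secDiffAt_smul hf (secDiffAt_localFrame hz)) Filter.univ_mem ?_
    filter_upwards [(isOpen_frameSet x).mem_nhds hz] with y hy
      using (coordAt_smul_localFrame hy _).symm
  rw [h1, h.leibniz hf (secDiffAt_localFrame hz), map_add, coordAt_smul hz, coordAt_smul hz,
    coordAt_localFrame hz, mul_one, localForm_apply]

/-- Change of frame. -/
lemma IsUnitary.localForm_change (h : IsUnitary nab) {x x' z : M} (hz : z ∈ frameSet V x)
    (hz' : z ∈ frameSet V x') : localForm nab x' z = localForm nab x z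
      + OneForm.cmul (fun y => (coordAt x y (localFrame (V := V) x' y))⁻¹)
          (vdFun (n := n) (fun y => coordAt x y (localFrame (V := V) x' y))) z := by
  ext v
  have h1 := h.coordAt_apply_section hz (secDiffAt_localFrame hz') v
  have h2 : coordAt x z (nab (localFrame x') z v)
      = localForm nab x' z v * coordAt x z (localFrame (V := V) x' z) := by
    rw [← coordAt_smul hz, localForm_apply, coordAt_smul_localFrame hz']
  have h0 : coordAt x z (localFrame (V := V) x' z) ≠ 0 := coordAt_localFrame_ne_zero hz hz'
  rw [h2] at h1
  change localForm nab x' z v = localForm nab x z v + (coordAt x z (localFrame (V := V) x' z))⁻¹ * _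
  rw [← mul_right_inj' h0, mul_add, mul_inv_cancel_left₀ h0, mul_comm, h1, add_comm]
  rfl

/-- The Leibniz rule for `g` times the frame adds the logarithmic differential `g⁻¹ dg`. Being
closed, it does not affect the curvature. -/
lemma IsUnitary.localForm_gauge (h : IsUnitary nab) (g : Gauge n M) {x z : M}
    (hz : z ∈ frameSet V x) : localForm (g • nab) x z = localForm nab x z
      + OneForm.cmul (fun y => (g y : ℂ)⁻¹) (vdFun (n := n) (fun y => (g y : ℂ))) z := by
  ext v
  have h0 : (g z : ℂ) ≠ 0 := Circle.coe_ne_zero _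
  have h1 : localForm (g • nab) x z v
      = coordAt x z ((g z : ℂ)⁻¹ • nab (fun y => (g y : ℂ) • localFrame x y) z v) := rfl
  rw [h1, h.leibniz (gauge_mdiff g z) (secDiffAt_localFrame hz), coordAt_smul hz, map_add,
    coordAt_smul hz, coordAt_smul hz, coordAt_localFrame hz, mul_one, mul_add,
    inv_mul_cancel_left₀ h0, add_comm]
  rfl

lemma localForm_shift (nab : Conn n V) (a : OneForm n M ℝ) {x z : M} (hz : z ∈ frameSet V x)
    (v : Tan n z) : localForm (shift nab a) x z v = localForm nab x z v - (a z v) * Complex.I := by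
  have h1 : localForm (shift nab a) x z v
      = coordAt x z (nab (localFrame x) z v - a z v • Complex.I • localFrame x z) := rfl
  rw [h1, map_sub, map_smul, coordAt_smul hz, coordAt_localFrame hz, mul_one, localForm_apply]
  rfl

lemma eventually_contMDiffAt_coordAt_localFrame {x x' z : M} (hz : z ∈ frameSet V x)
    (hz' : z ∈ frameSet V x') : ∀ᶠ y in 𝓝 z, ContMDiffAt (modelR n) 𝓘(ℝ, ℂ) ∞
      (fun y => coordAt x y (localFrame (V := V) x' y)) y := by
  filter_upwards [(isOpen_frameSet x).mem_nhds hz, (isOpen_frameSet x').mem_nhds hz'] with y hy hy'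
  exact (contMDiffAt_section_iff_coordAt hy).mp (contMDiffAt_localFrame hy')

/-- A local frame agrees near any point of its domain with a global smooth section. -/
lemma exists_section_eventuallyEq_localFrame [T2Space M] {x z : M} (hz : z ∈ frameSet V x) :
    ∃ σ : Π x : M, V x,
      ContMDiff (modelR n) ((modelR n).prod 𝓘(ℝ, ℂ)) ∞ (fun y => TotalSpace.mk' ℂ y (σ y)) ∧
      ∀ᶠ y in 𝓝 z, σ y = localFrame x y := by
  obtain ⟨f, -, hf⟩ := (SmoothBumpFunction.nhds_basis_tsupport (I := modelR n) z).mem_iff.mp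
    ((isOpen_frameSet x).mem_nhds hz)
  refine ⟨fun y => ((f y : ℝ) : ℂ) • localFrame x y, fun y => ?_, ?_⟩
  · by_cases hy : y ∈ tsupport f
    · refine contMDiffAt_smul_section ?_ (contMDiffAt_localFrame (hf hy))
      exact (Complex.ofRealCLM.contDiff.contMDiff.contMDiffAt).comp y f.contMDiffAt
    · rw [contMDiffAt_section_iff_coordAt (mem_frameSet y)]
      refine (contMDiffAt_const (c := (0 : ℂ))).congr_of_eventuallyEq ?_
      filter_upwards [(isClosed_tsupport f).isOpen_compl.mem_nhds hy] with w hw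
      rw [image_eq_zero_of_notMem_tsupport hw, Complex.ofReal_zero, zero_smul, map_zero]
  · filter_upwards [f.eventuallyEq_one] with y hy
    rw [hy, Pi.one_apply, Complex.ofReal_one, one_smul]

lemma IsUnitary.coordForm_smoothAt (h : IsUnitary nab) {σ : Π x : M, V x}
    (hσ : ContMDiff (modelR n) ((modelR n).prod 𝓘(ℝ, ℂ)) ∞ (fun y => TotalSpace.mk' ℂ y (σ y)))
    {x z : M} (hz : z ∈ frameSet V x) (hz' : z ∈ (chartAt (Fin n → ℂ) x).source) :
    OneForm.SmoothAt (coordForm (nab σ) x) z :=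
  (contMDiffAt_hom_iff hz hz').mp
    ((h.smooth.contMDiff.contMDiff (hσ.of_le le_rfl).contMDiffOn).contMDiffAt Filter.univ_mem)

/-- Smoothness of `∇` is tested on global sections. A cut-off frame is such a section, and locality
of `∇` makes it indistinguishable from the frame near the point. -/
lemma IsUnitary.localForm_smoothAt [T2Space M] (h : IsUnitary nab) {x z : M}
    (hz : z ∈ frameSet V x) (hz' : z ∈ (chartAt (Fin n → ℂ) x).source) :
    OneForm.SmoothAt (localForm nab x) z := by
  obtain ⟨σ, hσ, hσx⟩ := exists_section_eventuallyEq_localFrame (n := n) hz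
  refine (h.coordForm_smoothAt hσ hz hz').congr ?_
  filter_upwards [hσx.eventually_nhds, (isOpen_frameSet x).mem_nhds hz] with y hy hy'
  have : nab (localFrame x) y = nab σ y :=
    nab.isCovariantDerivativeOnUniv.congr_of_eventuallyEq (secDiffAt_localFrame hy')
      ((hσ y).mdifferentiableAt (by simp)) Filter.univ_mem (hy.mono fun w hw => hw.symm)
  rw [localForm_eq_coordForm, coordForm, coordForm, this]

lemma eventually_mem_frameSet (x : M) : ∀ᶠ z in 𝓝 x, z ∈ frameSet V x ∧
    z ∈ (chartAt (Fin n → ℂ) x).source :=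
  Filter.Eventually.and ((isOpen_frameSet x).mem_nhds (mem_frameSet x))
    ((chartAt (Fin n → ℂ) x).open_source.mem_nhds (mem_chart_source _ x))

/-- A change of frame alters `θ` by a closed form. This is essential because `curv` uses a different
frame at every point: near `x` all of them can be replaced by the frame at `x`. -/
lemma IsUnitary.extD_localForm [T2Space M] (h : IsUnitary nab) {x z : M}
    (hz : z ∈ frameSet V x) (hz' : z ∈ (chartAt (Fin n → ℂ) x).source) :
    extD (localForm nab z) z = extD (localForm nab x) z := by
  have h0 : coordAt x z (localFrame (V := V) z z) ≠ 0 :=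
    coordAt_localFrame_ne_zero hz (mem_frameSet z)
  obtain ⟨h1, h2⟩ := logDeriv_smoothAt (eventually_contMDiffAt_coordAt_localFrame (n := n) hz
    (mem_frameSet z)) h0
  rw [← add_zero (extD (localForm nab x) z), ← h2, ← extD_add (h.localForm_smoothAt hz hz') h1]
  refine extD_congr ?_
  filter_upwards [(isOpen_frameSet x).mem_nhds hz,
    (isOpen_frameSet z).mem_nhds (mem_frameSet (V := V) z)] with y hy hy'
  exact h.localForm_change hy hy'

lemma IsUnitary.curv_eq [T2Space M] (h : IsUnitary nab) {x z : M}
    (hz : z ∈ frameSet V x) (hz' : z ∈ (chartAt (Fin n → ℂ) x).source) :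
    curv nab z = extD (fun y => reI.comp (localForm nab x y)) z := by
  refine ContinuousLinearMap.ext fun v => ContinuousLinearMap.ext fun w => ?_
  rw [extD_clm reI (h.localForm_smoothAt hz hz'), ← h.extD_localForm hz hz']
  rfl

lemma IsUnitary.curv_locallyExact [T2Space M] (h : IsUnitary nab) :
    TwoForm.LocallyExact (curv nab) := by
  refine fun x => ⟨fun y => reI.comp (localForm nab x y), ?_⟩
  filter_upwards [eventually_mem_frameSet (n := n) (V := V) x] with z hz
  exact ⟨(h.localForm_smoothAt hz.1 hz.2).clm reI, h.curv_eq hz.1 hz.2⟩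

/-- The logarithmic term in a change of frame is the same for both connections and cancels in the
difference, so one fixed frame computes it on a whole neighbourhood. -/
lemma connDiff_eventuallyEq [T2Space M] (h : IsUnitary nab) (h' : IsUnitary nab') (x : M) :
    ∀ᶠ z in 𝓝 x, connDiff nab nab' z
      = reI.comp (localForm nab' x z - localForm nab x z) := by
  filter_upwards [(isOpen_frameSet x).mem_nhds (mem_frameSet (V := V) x)] with z hz
  rw [connDiff, h.localForm_change hz (mem_frameSet z), h'.localForm_change hz (mem_frameSet z),
    add_sub_add_right_eq_sub]

lemma connDiff_smooth [T2Space M] (h : IsUnitary nab) (h' : IsUnitary nab') :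
    (connDiff nab nab').Smooth :=
  OneForm.smooth_iff.mpr fun x => OneForm.SmoothAt.congr
    (((h'.localForm_smoothAt (mem_frameSet x) (mem_chart_source _ x)).sub
      (h.localForm_smoothAt (mem_frameSet x) (mem_chart_source _ x))).clm reI)
    (connDiff_eventuallyEq h h' x)

lemma curv_eq_add_extD_connDiff [T2Space M] (h : IsUnitary nab) (h' : IsUnitary nab') :
    curv nab' = curv nab + extD (connDiff nab nab') := by
  funext x
  have hx := mem_frameSet (V := V) x
  have hx' := mem_chart_source (Fin n → ℂ) x
  rw [Pi.add_apply, h.curv_eq hx hx', h'.curv_eq hx hx',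
    ← extD_add ((h.localForm_smoothAt hx hx').clm reI) ((connDiff_smooth h h').at x)]
  refine extD_congr ?_
  filter_upwards [connDiff_eventuallyEq h h' x] with z hz
  rw [Pi.add_apply, hz, ContinuousLinearMap.comp_sub, add_sub_cancel]

lemma Gauge.contMDiff_coe (g : Gauge n M) : ContMDiff (modelR n) 𝓘(ℝ, ℂ) ∞ (fun y => (g y : ℂ)) := by
  have : Fact (Module.finrank ℝ ℂ = 1 + 1) := finrank_real_complex_fact'
  have h0 : ContMDiff (𝓡 1) 𝓘(ℝ, ℂ) ∞ (fun z : Circle => (z : ℂ)) :=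
    contMDiff_coe_sphere (E := ℂ) (n := 1)
  exact h0.comp g.contMDiff

lemma Gauge.contMDiff_inv (g : Gauge n M) :
    ContMDiff (modelR n) 𝓘(ℝ, ℂ) ∞ (fun y => (g y : ℂ)⁻¹) := by
  have h := Gauge.contMDiff_coe g⁻¹
  have e : (fun y => ((g⁻¹ : Gauge n M) y : ℂ)) = fun y => (g y : ℂ)⁻¹ := by
    funext y
    exact Circle.coe_inv (g y)
  rwa [e] at h

lemma contMDiffCovariantDerivative_of (hn : ∀ (σ : Π x : M, V x),
    ContMDiff (modelR n) ((modelR n).prod 𝓘(ℝ, ℂ)) ∞ (fun y => TotalSpace.mk' ℂ y (σ y)) →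
    ∀ x, OneForm.SmoothAt (coordForm (nab σ) x) x) :
    CovariantDerivative.ContMDiffCovariantDerivative nab ∞ :=
  ⟨⟨fun {σ} hσ => contMDiffOn_univ.mpr fun x =>
    (contMDiffAt_hom_iff (mem_frameSet x) (mem_chart_source _ x)).mpr
      (hn σ (contMDiffOn_univ.mp (hσ.of_le le_rfl)) x)⟩⟩

lemma IsUnitary.gauge (h : IsUnitary nab) (g : Gauge n M) : IsUnitary (g • nab) where
  smooth := contMDiffCovariantDerivative_of fun σ hσ x => by
    have h1 := h.coordForm_smoothAt (fun y => contMDiffAt_smul_section (g.contMDiff_coe y) (hσ y))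
      (mem_frameSet x) (mem_chart_source _ x)
    refine ((OneForm.SmoothAt.cmul (g.contMDiff_inv x) h1)).congr ?_
    filter_upwards [(isOpen_frameSet (V := V) x).mem_nhds (mem_frameSet x)] with y hy
    ext v
    exact coordAt_smul hy _ _
  complexLinear σ x hσ v := by
    have h1 := h.complexLinear _ x (secDiffAt_smul (gauge_mdiff g x) hσ) v
    have e : (fun y => (g y : ℂ) • Complex.I • σ y) = fun y => Complex.I • (g y : ℂ) • σ y := by
      funext y
      exact smul_comm _ _ _
    change (g x : ℂ)⁻¹ • nab (fun y => (g y : ℂ) • Complex.I • σ y) x v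
      = Complex.I • (g x : ℂ)⁻¹ • nab (fun y => (g y : ℂ) • σ y) x v
    rw [e, h1, smul_comm]
  metric σ τ x hσ hτ v := by
    -- Unit modulus of `g` makes multiplication by `g` an isometry of the fibres, so compatibility
    -- with the metric is inherited.
    have hg : ∀ y, starRingEnd ℂ (g y : ℂ) * (g y : ℂ) = 1 := fun y => by
      rw [mul_comm, Complex.mul_conj, Circle.normSq_coe, Complex.ofReal_one]
    have hi : ∀ y, starRingEnd ℂ (g y : ℂ) = (g y : ℂ)⁻¹ := fun y =>
      eq_inv_of_mul_eq_one_left (hg y)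
    have e : (fun y => inner ℂ (σ y) (τ y))
        = fun y => inner ℂ ((g y : ℂ) • σ y) ((g y : ℂ) • τ y) := by
      funext y
      rw [inner_smul_left, inner_smul_right, ← mul_assoc, hg, one_mul]
    rw [e, h.metric _ _ x (secDiffAt_smul (gauge_mdiff g x) hσ)
      (secDiffAt_smul (gauge_mdiff g x) hτ) v]
    change _ = inner ℂ ((g x : ℂ)⁻¹ • nab (fun y => (g y : ℂ) • σ y) x v) (τ x)
      + inner ℂ (σ x) ((g x : ℂ)⁻¹ • nab (fun y => (g y : ℂ) • τ y) x v)
    rw [inner_smul_left, inner_smul_right, inner_smul_left, inner_smul_right, map_inv₀, hi, inv_inv]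

lemma IsUnitary.shift (h : IsUnitary nab) {a : OneForm n M ℝ} (ha : a.Smooth) :
    IsUnitary (shift nab a) where
  smooth := contMDiffCovariantDerivative_of fun σ hσ x => by
    have h1 := h.coordForm_smoothAt hσ (mem_frameSet x) (mem_chart_source _ x)
    have h2 : ContMDiffAt (modelR n) 𝓘(ℝ, ℂ) ∞ (fun y => Complex.I • coordAt x y (σ y)) x :=
      (contDiff_const.mul contDiff_id : ContDiff ℝ ∞ fun z : ℂ => Complex.I * z).contMDiff.contMDiffAt.comp
        x ((contMDiffAt_section_iff_coordAt (mem_frameSet x)).mp (hσ x))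
    have h3 := OneForm.SmoothAt.cmul h2 ((ha.at x).clm Complex.ofRealCLM)
    refine (h1.sub h3).congr ?_
    filter_upwards [(isOpen_frameSet (V := V) x).mem_nhds (mem_frameSet x)] with y hy
    ext v
    change coordAt x y (nab σ y v - a y v • Complex.I • σ y)
      = coordAt x y (nab σ y v) - (Complex.I • coordAt x y (σ y)) * ((a y v : ℝ) : ℂ)
    rw [map_sub, map_smul, coordAt_smul hy, mul_comm _ ((a y v : ℝ) : ℂ), Complex.real_smul]
    rfl
  complexLinear σ x hσ v := by
    change nab (fun y => Complex.I • σ y) x v - a x v • Complex.I • Complex.I • σ x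
      = Complex.I • (nab σ x v - a x v • Complex.I • σ x)
    rw [h.complexLinear σ x hσ v, smul_sub, smul_comm (a x v) Complex.I]
  metric σ τ x hσ hτ v := by
    change _ = inner ℂ (nab σ x v - a x v • Complex.I • σ x) (τ x)
      + inner ℂ (σ x) (nab τ x v - a x v • Complex.I • τ x)
    -- The added terms `-ia` in the two arguments have opposite contributions, because `a` is real
    -- and the inner product is conjugate linear on the left.
    rw [h.metric σ τ x hσ hτ v, ← Complex.coe_smul, ← Complex.coe_smul, inner_sub_left,
      inner_sub_right, smul_smul, smul_smul, inner_smul_left, inner_smul_right, map_mul,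
      Complex.conj_ofReal, Complex.conj_I]
    ring

/-- The connection form changes by `-ia`, and the factor `i` in the normalization of the curvature
turns this into `a`. -/
lemma curv_shift [T2Space M] (h : IsUnitary nab) {a : OneForm n M ℝ} (ha : a.Smooth) :
    curv (shift nab a) = curv nab + extD a := by
  rw [curv_eq_add_extD_connDiff h (h.shift ha)]
  congr 2
  funext x
  refine ContinuousLinearMap.ext fun v => ?_
  change reI (localForm (KahlerFlow.shift nab a) x x v - localForm nab x x v) = _
  rw [localForm_shift nab a (mem_frameSet x)]
  simp [reI]

lemma connDiff_gauge (h : IsUnitary nab) (g : Gauge n M) (x : M) (v : Tan n x) :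
    connDiff nab (g • nab) x v
      = reI ((g x : ℂ)⁻¹ * vdFun (n := n) (fun y => (g y : ℂ)) x v) := by
  rw [connDiff, h.localForm_gauge g (mem_frameSet x), add_sub_cancel_left]
  rfl

lemma curv_gauge [T2Space M] (h : IsUnitary nab) (g : Gauge n M) :
    curv (g • nab) = curv nab := by
  funext x
  have hx := mem_frameSet (V := V) x
  have hx' := mem_chart_source (Fin n → ℂ) x
  obtain ⟨h1, h2⟩ := logDeriv_smoothAt (n := n) (x := x)
    (Filter.Eventually.of_forall g.contMDiff_coe) (Circle.coe_ne_zero (g x))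
  have h3 : extD (localForm (g • nab) x) x = extD (localForm nab x) x := by
    rw [← add_zero (extD (localForm nab x) x), ← h2, ← extD_add (h.localForm_smoothAt hx hx') h1]
    refine extD_congr ?_
    filter_upwards [(isOpen_frameSet x).mem_nhds hx] with y hy
    exact h.localForm_gauge g hy
  rw [curv, curv, h3]

/-- For `g = exp(-itζ)` one has `g⁻¹ dg = -it dζ`, so the connection moves by exactly `t dζ`,
linearly in `t`. -/
lemma isInfinitesimalAction_dFun (h : IsUnitary nab) (ζ : LieGauge n M) :
    IsInfinitesimalAction nab ζ (dFun ζ) := by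
  intro x v
  have hζ : MDifferentiableAt (modelR n) 𝓘(ℝ, ℝ) ζ x := ζ.contMDiff.mdifferentiableAt (by simp)
  have key : ∀ t : ℝ, connDiff nab (expGauge ζ t • nab) x v = t * dFun ζ x v := by
    intro t
    rw [connDiff_gauge h]
    have h1 : HasDerivAt (fun s : ℝ => Complex.exp (-(t * s : ℝ) * Complex.I))
        (Complex.exp (-(t * ζ x : ℝ) * Complex.I) * (-(t : ℂ) * Complex.I)) (ζ x) := by
      have h2 : HasDerivAt (fun s : ℝ => -((t * s : ℝ) : ℂ) * Complex.I)
          (-(t : ℂ) * Complex.I) (ζ x) := by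
        have := (((hasDerivAt_id (ζ x)).const_mul t).ofReal_comp).neg.mul_const Complex.I
        simpa using this
      exact h2.cexp
    have h4 := (h1.hasFDerivAt.hasMFDerivAt).comp x hζ.hasMFDerivAt
    have h5 : (fun y => ((expGauge ζ t) y : ℂ))
        = (fun s : ℝ => Complex.exp (-(t * s : ℝ) * Complex.I)) ∘ ζ := by
      funext y
      change ((Circle.exp (-(t * ζ y)) : Circle) : ℂ) = _
      rw [Circle.coe_exp, Complex.ofReal_neg]
      rfl
    have h6 : vdFun (n := n) (fun y => ((expGauge ζ t) y : ℂ)) x v = dFun ζ x v •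
        (Complex.exp (-(t * ζ x : ℝ) * Complex.I) * (-(t : ℂ) * Complex.I)) := by
      change mfderiv (modelR n) 𝓘(ℝ, ℂ) (fun y => ((expGauge ζ t) y : ℂ)) x v = _
      rw [h5, h4.mfderiv]
      rfl
    have h7 := congrFun h5 x
    rw [h6, h7, Function.comp_apply, Complex.real_smul, mul_left_comm,
      inv_mul_cancel_left₀ (Complex.exp_ne_zero _)]
    simp [reI, mul_comm]
  simp only [key]
  simpa using (hasDerivAt_id (0 : ℝ)).mul_const (dFun ζ x v)

lemma IsInfinitesimalAction.eq (h : IsUnitary nab) {ζ : LieGauge n M} {X : OneForm n M ℝ}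
    (hX : IsInfinitesimalAction nab ζ X) : X = dFun ζ := by
  funext x
  exact ContinuousLinearMap.ext fun v => (hX x v).unique (isInfinitesimalAction_dFun h ζ x v)

/-! ### The connection one-form on the circle bundle -/

lemma norm_unitPoint_snd (x : M) : ‖(unitPoint (V := V) x).snd‖ = 1 := by
  have h := localFrame_ne_zero (mem_frameSet (V := V) x)
  change ‖(((‖localFrame (V := V) x x‖⁻¹ : ℝ)) : ℂ) • localFrame (V := V) x x‖ = 1
  rw [norm_smul, Complex.norm_real, norm_inv, norm_norm, inv_mul_cancel₀ (norm_ne_zero_iff.mpr h)]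

/-- The curve `exp(-itζ) p` stays in one fibre, so its velocity has no base component and its
vertical part is `-iζ p` for every connection. Pairing with the unit vector `p` gives imaginary part
`-ζ`, and the sign in `connForm` gives `ζ`. -/
lemma connForm_vertField (nab : Conn n V) (ζ : M → ℝ) {p : TotalSpace ℂ V} (hp : ‖p.snd‖ = 1) :
    connForm nab p (vertField (n := n) ζ p) = ζ p.proj := by
  let e : TotalSpace ℂ V → ℂ := fun q => (trivializationAt ℂ V p.proj q).2
  let c : ℝ → ℂ := fun t => Complex.exp (-(t * ζ p.proj) * Complex.I) * e p
  let γ : ℝ → TotalSpace ℂ V := fun t =>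
    TotalSpace.mk' ℂ p.proj (Complex.exp (-(t * ζ p.proj) * Complex.I) • p.snd)
  have hc : HasDerivAt c (-(ζ p.proj) * Complex.I * e p) 0 := by
    have h1 : HasDerivAt (fun t : ℝ => -((t : ℂ) * ζ p.proj) * Complex.I)
        (-(ζ p.proj) * Complex.I) 0 := by
      have := (((hasDerivAt_id (0 : ℝ)).ofReal_comp).mul_const ((ζ p.proj : ℝ) : ℂ)).neg.mul_const
        Complex.I
      simpa using this
    have h2 := h1.cexp.mul_const (e p)
    rw [Complex.ofReal_zero, zero_mul, neg_zero, zero_mul, Complex.exp_zero, one_mul] at h2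
    exact h2
  have hγc : e ∘ γ = c := by
    funext t
    have h1 : ∀ z : ℂ, (trivializationAt ℂ V p.proj ⟨p.proj, z • p.snd⟩).2
        = z * (trivializationAt ℂ V p.proj ⟨p.proj, p.snd⟩).2 := fun z => by
      rw [← coordAt_apply (mem_frameSet _), ← coordAt_apply (mem_frameSet _),
        coordAt_smul (mem_frameSet _)]
    exact h1 _
  have hγ0 : γ 0 = p := by
    change TotalSpace.mk' ℂ p.proj _ = p
    rw [Complex.ofReal_zero, zero_mul, neg_zero, zero_mul, Complex.exp_zero, one_smul]
  have hγd : MDifferentiableAt 𝓘(ℝ, ℝ) ((modelR n).prod 𝓘(ℝ, ℂ)) γ 0 := by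
    rw [mdifferentiableAt_totalSpace]
    refine ⟨mdifferentiableAt_const, ?_⟩
    change MDifferentiableAt 𝓘(ℝ, ℝ) 𝓘(ℝ, ℂ) (e ∘ γ) 0
    rw [hγc]
    exact hc.differentiableAt.mdifferentiableAt
  obtain ⟨h1, h2⟩ := (mdifferentiableAt_totalSpace (IB := modelR n)
    (IM := (modelR n).prod 𝓘(ℝ, ℂ)) (id : TotalSpace ℂ V → TotalSpace ℂ V) (x₀ := p)).mp
    mdifferentiableAt_id
  have h3 := mfderiv_comp_of_eq (x := (0 : ℝ)) h2 hγd hγ0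
  have h4 := mfderiv_comp_of_eq (x := (0 : ℝ)) h1 hγd hγ0
  have h5 : mfderiv ((modelR n).prod 𝓘(ℝ, ℂ)) 𝓘(ℝ, ℂ) e p (vertField ζ p)
      = -((ζ p.proj : ℝ) : ℂ) * Complex.I * e p := by
    have h6 : mfderiv 𝓘(ℝ, ℝ) 𝓘(ℝ, ℂ) c 0 (1 : ℝ) = -((ζ p.proj : ℝ) : ℂ) * Complex.I * e p := by
      rw [hc.hasFDerivAt.hasMFDerivAt.mfderiv]
      exact one_smul ℝ (-((ζ p.proj : ℝ) : ℂ) * Complex.I * e p)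
    rw [← h6, ← hγc]
    have h7 := congrArg (fun l => l (1 : ℝ)) h3
    refine Eq.trans ?_ h7.symm
    -- The chain rule yields the differential at `γ 0`, which equals `p` only propositionally. All
    -- tangent spaces are the same model space, so the value can be transported along this equality.
    have key : ∀ q, p = q → ∀ w : (Fin n → ℂ) × ℂ,
        (mfderiv ((modelR n).prod 𝓘(ℝ, ℂ)) 𝓘(ℝ, ℂ) e p : _ → ℂ) w
          = mfderiv ((modelR n).prod 𝓘(ℝ, ℂ)) 𝓘(ℝ, ℂ) e q w := by
      rintro q rfl w
      rfl
    exact key _ hγ0.symm _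
  have h8 : mfderiv ((modelR n).prod 𝓘(ℝ, ℂ)) (modelR n)
      (TotalSpace.proj (F := ℂ) (E := V)) p (vertField ζ p) = 0 := by
    have h6 : mfderiv 𝓘(ℝ, ℝ) (modelR n) ((TotalSpace.proj (F := ℂ) (E := V)) ∘ γ) 0 (1 : ℝ)
        = 0 := by
      have : (TotalSpace.proj (F := ℂ) (E := V)) ∘ γ = fun _ => p.proj := rfl
      rw [this, mfderiv_const]
      rfl
    rw [← h6]
    have h7 := congrArg (fun l => l (1 : ℝ)) h4
    refine Eq.trans ?_ h7.symm
    have key : ∀ q, p = q → ∀ w : (Fin n → ℂ) × ℂ,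
        (mfderiv ((modelR n).prod 𝓘(ℝ, ℂ)) (modelR n) (TotalSpace.proj (F := ℂ) (E := V)) p :
          _ → Fin n → ℂ) w
          = mfderiv ((modelR n).prod 𝓘(ℝ, ℂ)) (modelR n) (TotalSpace.proj (F := ℂ) (E := V)) q w := by
      rintro q rfl w
      rfl
    exact key _ hγ0.symm _
  have h9 : verticalPart nab p (vertField ζ p)
      = (-(ζ p.proj) * Complex.I) • p.snd := by
    rw [verticalPart, h8, map_zero, add_zero]
    have h10 : (trivializationAt ℂ V p.proj).symm p.proj
        (mvfderiv ((modelR n).prod 𝓘(ℝ, ℂ)) e p (vertField ζ p))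
        = (trivializationAt ℂ V p.proj).symm p.proj (-((ζ p.proj : ℝ) : ℂ) * Complex.I * e p) :=
      congrArg _ h5
    refine h10.trans (coordAt_injective (mem_frameSet _) ?_)
    rw [coordAt_smul (mem_frameSet _), coordAt_apply (mem_frameSet _),
      Trivialization.apply_mk_symm _ (mem_frameSet _), coordAt_apply (mem_frameSet _)]
  rw [connForm, h9, inner_smul_right, inner_self_eq_norm_sq_to_K, hp]
  simp

lemma angle_eq (nab : Conn n V) (ζ : M → ℝ) : angle nab ζ = ζ :=
  funext fun x => connForm_vertField nab ζ (norm_unitPoint_snd x)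

end LineBundle

end KahlerFlow

end

noncomputable section

namespace KahlerFlow

/-! ### Symplectic form, moment map and gradient on the space of connections -/

section Symplectic

variable {n : ℕ} {M : Type*} [TopologicalSpace M] [ChartedSpace (Fin n → ℂ) M]
  {V : M → Type*} [TopologicalSpace (TotalSpace ℂ V)] [∀ x, NormedAddCommGroup (V x)]
  [∀ x, InnerProductSpace ℂ (V x)] [FiberBundle ℂ V] [VectorBundle ℂ ℂ V]
  [IsManifold 𝓘(ℂ, Fin n → ℂ) ω M] [T2Space M] [ContMDiffVectorBundle ∞ ℂ V (modelR n)]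
  {nab : Conn n V}

lemma isKahler_curv (h : nab ∈ kahlerConns n V) : IsKahler (curv nab) :=
  ⟨h.1.curv_locallyExact, h.2.1, h.2.2⟩

lemma gauge_mem_kahlerConns (h : nab ∈ kahlerConns n V) (g : Gauge n M) :
    g • nab ∈ kahlerConns n V := by
  have e := curv_gauge h.1 g
  exact ⟨h.1.gauge g, by rw [e]; exact h.2.1, by rw [e]; exact h.2.2⟩

lemma curv_shift_smul (h : IsUnitary nab) {a : OneForm n M ℝ} (ha : a.Smooth) (t : ℝ) :
    curv (shift nab (t • a)) = curv nab + t • extD a := by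
  rw [curv_shift h (ha.smul t)]
  congr 1
  exact funext fun x => extD_smul t (ha.at x)

variable [CompactSpace M] [NeZero n]

lemma nu_eq_nuForm (nab : Conn n V) (a b : OneForm n M ℝ) :
    nu nab a b = nuForm (curv nab) a b := rfl

lemma isInvariantSymplectic_nu : IsInvariantSymplectic n V nu where
  add_left nab h a b c ha hb hc :=
    nuForm_add_left (isKahler_curv h).locallyExact.smooth ha.1 hb.1 hc.1
  smul_left nab _ r a b _ _ := nuForm_smul_left r a b
  antisymm nab _ a b _ _ := nuForm_antisymm a b
  -- Test against `Ia`, again a tangent vector, on which positivity applies.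
  nondegenerate nab h a ha h0 := by
    by_contra hne
    exact (nuForm_pos (isKahler_curv h) ha.1 hne).ne' (h0 _ (isTangent_compI ha))
  closed nab h a b c ha hb hc := by
    simp only [nu_eq_nuForm, curv_shift_smul h.1 ha.1, curv_shift_smul h.1 hb.1,
      curv_shift_smul h.1 hc.1]
    exact exists_hasDerivAt_nuForm (isKahler_curv h).locallyExact ha.1 hb.1 hc.1
  invariant nab h g a b _ _ := by
    rw [nu_eq_nuForm, nu_eq_nuForm, curv_gauge h.1 g]

lemma muBar_eq (Om : TopForm n M) (nab : Conn n V) (ζ : LieGauge n M) :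
    muBar Om nab ζ = integral (TopForm.mulFun ζ (topPow (curv nab) - Om)) := by
  rw [muBar, angle_eq]
  rfl

/-- Only `Fⁿ` varies, since the angle is `ζ` for every connection and `Ω` is fixed. Its derivative
is `n ∫ ζ db ∧ F^{n-1}`, and integration by parts moves the differential onto `ζ`. -/
lemma hasDerivAt_muBar {Om : TopForm n M} (h : nab ∈ kahlerConns n V)
    (hOm : Om.Smooth) (ζ : LieGauge n M) {b : OneForm n M ℝ} (hb : b.Smooth) :
    HasDerivAt (fun t : ℝ => muBar Om (shift nab (t • b)) ζ) (n * nu nab b (dFun ζ)) 0 := by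
  have hK := (isKahler_curv h).locallyExact
  have h1 := hasDerivAt_integral_topPow ζ.contMDiff hK.smooth (extD_smooth hb)
  rw [integral_mulFun_extD hK ζ.contMDiff hb] at h1
  refine (h1.sub_const (integral (TopForm.mulFun ζ Om))).congr_of_eventuallyEq
    (Filter.Eventually.of_forall fun t => ?_)
  have hs : (curv nab + t • extD b).Smooth := by
    rw [← curv_shift_smul h.1 hb]
    exact (h.1.shift (hb.smul t)).curv_locallyExact.smooth
  beta_reduce
  rw [muBar_eq, curv_shift_smul h.1 hb,
    ← integral_sub' ((topPow_smooth hs).mulFun ζ.contMDiff) (hOm.mulFun ζ.contMDiff)]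
  refine integral_congr_frame fun x => ?_
  rw [val_mulFun, val_sub, val_sub, val_mulFun, val_mulFun, mul_sub]

lemma isMomentMap_muBar {Om : TopForm n M} (hOm : Om.Smooth) :
    IsMomentMap n V (fun nab a b => n * nu nab a b) (muBar Om) where
  add nab h ζ ξ := by
    have hs := (topPow_smooth (isKahler_curv h).locallyExact.smooth).sub hOm
    rw [muBar_eq, muBar_eq, muBar_eq,
      ← integral_add' (hs.mulFun ζ.contMDiff) (hs.mulFun ξ.contMDiff)]
    refine integral_congr_frame fun x => ?_
    rw [val_mulFun, val_add, val_mulFun, val_mulFun, ← add_mul]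
    rfl
  smul nab h r ζ := by
    rw [muBar_eq, muBar_eq, ← integral_smul']
    refine integral_congr_frame fun x => ?_
    rw [val_mulFun, val_smul, val_mulFun, ← mul_assoc]
    rfl
  hamiltonian nab h ζ := ⟨dFun ζ, isInfinitesimalAction_dFun h.1 ζ, isTangent_dFun ζ.contMDiff,
    fun b hb => hasDerivAt_muBar h hOm ζ hb.1⟩
  equivariant nab h g ζ := by
    rw [muBar_eq, muBar_eq, curv_gauge h.1 g]

/-- Any two connections have curvatures differing by an exact form, hence the same volume, and the
normalization of `Ω` makes this its total mass. -/
lemma muBar_const {Om : TopForm n M} (hOm : Om.Smooth) {nab₀ : Conn n V}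
    (h₀ : nab₀ ∈ kahlerConns n V) (hvol : integral Om = integral (topPow (curv nab₀)))
    (h : nab ∈ kahlerConns n V) {ζ : LieGauge n M} {c : ℝ} (hζ : ∀ x, ζ x = c) :
    muBar Om nab ζ = 0 := by
  have hK := (isKahler_curv h).locallyExact
  have h1 : muBar Om nab ζ = c * integral (topPow (curv nab) - Om) := by
    rw [muBar_eq, ← integral_smul']
    refine integral_congr_frame fun x => ?_
    rw [val_mulFun, val_smul, hζ]
  rw [h1, integral_sub' (topPow_smooth hK.smooth) hOm, curv_eq_add_extD_connDiff h₀.1 h.1,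
    integral_topPow_add_extD (isKahler_curv h₀).locallyExact (connDiff_smooth h₀.1 h.1), hvol,
    sub_self, mul_zero]

lemma muBar_eq_lieInner (Om : TopForm n M) (h : nab ∈ kahlerConns n V) (ζ : LieGauge n M) :
    muBar Om nab ζ = lieInner nab ζ (muSharp Om nab) := by
  rw [muBar_eq]
  refine integral_congr_frame fun x => ?_
  have h0 := (IsKahler.topPow_pos (isKahler_curv h) x).ne'
  have h1 : TopForm.val (fun x => (ζ x * muSharp Om nab x) • topPow (curv nab) x) x (frame n)
      = (ζ x * muSharp Om nab x) * TopForm.val (topPow (curv nab)) x (frame n) := rfl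
  have h2 : muSharp Om nab x = TopForm.val (topPow (curv nab) - Om) x (frame n)
      / TopForm.val (topPow (curv nab)) x (frame n) := rfl
  rw [h1, h2, val_mulFun, mul_assoc, div_mul_cancel₀ _ h0]

lemma muSharp_smooth {Om : TopForm n M} (hOm : Om.Smooth) (h : nab ∈ kahlerConns n V) :
    ContMDiff (modelR n) 𝓘(ℝ, ℝ) ∞ (muSharp Om nab) := by
  have hs := topPow_smooth (isKahler_curv h).locallyExact.smooth
  exact topRatio_smooth (hs.sub hOm) hs fun x => (IsKahler.topPow_pos (isKahler_curv h) x).ne'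

/-- The gradient of the squared norm of the moment map. -/
lemma isGradient_muNormSq_iff {Om : TopForm n M} (hOm : Om.Smooth) (h : nab ∈ kahlerConns n V)
    (G : OneForm n M ℝ) : IsGradient (fun nab a b => n * nu nab a b) (muNormSq Om nab) nab G ↔
      G = (-2 : ℝ) • compI (dFun (muSharp Om nab)) := by
  have hK := isKahler_curv h
  have hd := isTangent_dFun (n := n) (muSharp_smooth hOm h)
  have hn : (n : ℝ) ≠ 0 := Nat.cast_ne_zero.mpr (NeZero.ne n)
  have hT : IsTangent ((-2 : ℝ) • compI (dFun (muSharp Om nab))) :=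
    isTangent_smul _ (isTangent_compI hd)
  -- The derivative is `2n ν(b, dμ̄♯)`. Invariance under `I` and antisymmetry rewrite it as `n ν(-2
  -- I dμ̄♯, Ib)`, which explains the constant `-2`.
  have key : ∀ b : OneForm n M ℝ, b.Smooth →
      HasDerivAt (fun t : ℝ => muNormSq Om nab (shift nab (t • b)))
        (n * nu nab ((-2 : ℝ) • compI (dFun (muSharp Om nab))) (compI b)) 0 := by
    intro b hb
    have h1 := hasDerivAt_integral_sq hK.locallyExact.smooth (extD_smooth hb) hOm
      fun x => (IsKahler.topPow_pos hK x).ne'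
    have h2 := integral_mulFun_extD hK.locallyExact (muSharp_smooth hOm h) hb
    have h3 : (n * nu nab ((-2 : ℝ) • compI (dFun (muSharp Om nab))) (compI b) : ℝ)
        = 2 * (n * integral (TopForm.mulFun (muSharp Om nab) (wedgePow (extD b) (curv nab)))) := by
      rw [h2, nu_eq_nuForm, nuForm_smul_left, nuForm_compI hK.type11, nuForm_antisymm]
      ring
    rw [h3]
    refine h1.congr_of_eventuallyEq (Filter.Eventually.of_forall fun t => ?_)
    beta_reduce
    rw [muNormSq, curv_shift_smul h.1 hb]
    rfl
  constructor
  · rintro ⟨hG, hG'⟩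
    by_contra hne
    -- Uniqueness: the difference `D` of two gradients is tangent, and comparing derivatives in the
    -- direction `D` forces `ν(D, ID) = 0`, against positivity.
    have h1 : G + (-1 : ℝ) • ((-2 : ℝ) • compI (dFun (muSharp Om nab))) ≠ 0 := fun h0 => hne (by
      rw [neg_one_smul, ← sub_eq_add_neg] at h0
      exact sub_eq_zero.mp h0)
    have hD := isTangent_add hG (isTangent_smul (-1) hT)
    have h2 := (hG' _ hD).unique (key _ hD.1)
    have h3 := mul_left_cancel₀ hn h2
    have h4 := nuForm_pos hK hD.1 h1
    rw [nuForm_add_left hK.locallyExact.smooth hG.1 (isTangent_smul (-1) hT).1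
      (isTangent_compI hD).1, nuForm_smul_left] at h4
    rw [nu_eq_nuForm, nu_eq_nuForm] at h3
    linarith
  · rintro rfl
    exact ⟨hT, fun b hb => key b hb.1⟩

/-- Both gradient flow equations say that `∂ₜ aₜ = ½ I d(μ̄♯)`. -/
lemma isNegGradientFlow_iff {Om : TopForm n M} (hOm : Om.Smooth) {nab₀ : Conn n V} {K : Set ℝ}
    {a : ℝ → OneForm n M ℝ} :
    IsNegGradientFlow (fun nab b c => n * nu nab b c) Om nab₀ K a ↔ IsCurve nab₀ K a ∧
      ∀ t ∈ K, ∀ (x : M) (v : Tan n x), HasDerivWithinAt (fun s => a s x v)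
        (1 / 2 * compI (dFun (muSharp Om (shift nab₀ (a t)))) x v) K t := by
  -- The factor `¼` in the flow is chosen so that `-¼ · (-2) = ½`.
  have key : ∀ (b : OneForm n M ℝ) (x : M) (v : Tan n x),
      -(1 / 4) * ((-2 : ℝ) • b) x v = 1 / 2 * b x v := fun b x v => by
    change -(1 / 4) * (-2 * b x v) = _
    ring
  constructor
  · intro h
    refine ⟨h.toIsCurve, fun t ht x v => ?_⟩
    obtain ⟨G, hG, hf⟩ := h.flow t ht
    rw [isGradient_muNormSq_iff hOm (h.mem t ht)] at hG
    have := hf x v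
    rwa [hG, key] at this
  · rintro ⟨h, hf⟩
    refine ⟨h, fun t ht => ⟨_, (isGradient_muNormSq_iff hOm (h.mem t ht) _).mpr rfl, fun x v => ?_⟩⟩
    rw [key]
    exact hf t ht x v

lemma isMomentFlow_iff {Om : TopForm n M} (hOm : Om.Smooth) {nab₀ : Conn n V} {K : Set ℝ}
    {a : ℝ → OneForm n M ℝ} :
    IsMomentFlow Om nab₀ K a ↔ IsCurve nab₀ K a ∧
      ∀ t ∈ K, ∀ (x : M) (v : Tan n x), HasDerivWithinAt (fun s => a s x v)
        (1 / 2 * compI (dFun (muSharp Om (shift nab₀ (a t)))) x v) K t := by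
  constructor
  · intro h
    refine ⟨h.toIsCurve, fun t ht x v => ?_⟩
    obtain ⟨ζ, X, hζ, hX, hf⟩ := h.flow t ht
    have h1 : (ζ : M → ℝ) = muSharp Om (shift nab₀ (a t)) := funext hζ
    rw [IsInfinitesimalAction.eq (h.mem t ht).1 hX, h1] at hf
    exact hf x v
  · rintro ⟨h, hf⟩
    refine ⟨h, fun t ht => ⟨⟨_, muSharp_smooth hOm (h.mem t ht)⟩, _, fun _ => rfl,
      isInfinitesimalAction_dFun (h.mem t ht).1 _, hf t ht⟩⟩

end Symplectic

end KahlerFlow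

end

noncomputable section

namespace KahlerFlow

/-! ### Smooth families over a time interval -/

lemma isTimeSet_timeInterval {T : EReal} (hT : 0 < T) : IsTimeSet (timeInterval T) := by
  have hoc : (timeInterval T).OrdConnected := ⟨fun s hs t ht r hr =>
    ⟨hs.1.trans hr.1, (EReal.coe_le_coe_iff.mpr hr.2).trans_lt ht.2⟩⟩
  obtain ⟨r, hr0, hrT⟩ := EReal.lt_iff_exists_real_btwn.mp hT
  have hr : (0 : ℝ) < r := EReal.coe_lt_coe_iff.mp hr0
  have hint : (interior (timeInterval T)).Nonempty := by
    have hsub : Ioo 0 r ⊆ timeInterval T := fun s hs =>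
      ⟨hs.1.le, (EReal.coe_lt_coe_iff.mpr hs.2).trans hrT⟩
    exact ⟨r / 2, interior_maximal hsub isOpen_Ioo ⟨by linarith, by linarith⟩⟩
  refine ⟨hoc, ⟨le_rfl, hT⟩, uniqueDiffOn_convex hoc.convex hint, ?_⟩
  rw [Convex.closure_interior_eq_closure_of_nonempty_interior (𝕜 := ℝ) hoc.convex hint]
  exact subset_closure

/-- Differentiability of a family of continuous linear maps, and pointwise derivatives. -/
lemma hasDerivWithinAt_clm_of_apply {E F : Type*} [NormedAddCommGroup E] [NormedSpace ℝ E]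
    [NormedAddCommGroup F] [NormedSpace ℝ F] {K : Set ℝ} {t : ℝ} {f : ℝ → E →L[ℝ] F}
    {b : E →L[ℝ] F} (hK : UniqueDiffWithinAt ℝ K t) (hf : DifferentiableWithinAt ℝ f K t)
    (hb : ∀ v, HasDerivWithinAt (fun s => f s v) (b v) K t) : HasDerivWithinAt f b K t := by
  have h1 := hf.hasDerivWithinAt
  have h2 : derivWithin f K t = b := by
    ext v
    have h3 := h1.clm_apply (hasDerivWithinAt_const t K v)
    rw [map_zero, add_zero] at h3
    exact hK.eq_deriv _ h3 (hb v)
  rwa [h2] at h1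

section Families

variable {n : ℕ} {M : Type*} [TopologicalSpace M] [ChartedSpace (Fin n → ℂ) M]
  [IsManifold 𝓘(ℂ, Fin n → ℂ) ω M] {K : Set ℝ}

/-- Joint smoothness of a family of functions, in charts. -/
def SmoothFun (K : Set ℝ) (φ : ℝ → M → ℝ) : Prop :=
  ∀ c : M, ContDiffOn ℝ ∞ (fun q : ℝ × (Fin n → ℂ) => φ q.1 ((chartAt (Fin n → ℂ) c).symm q.2))
    (K ×ˢ (chartAt (Fin n → ℂ) c).target)

lemma contMDiffOn_iff_smoothFun {φ : ℝ → M → ℝ} :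
    ContMDiffOn (𝓘(ℝ, ℝ).prod (modelR n)) 𝓘(ℝ, ℝ) ∞ (fun q : ℝ × M => φ q.1 q.2) (K ×ˢ univ) ↔
      SmoothFun (n := n) K φ := by
  constructor
  · intro h c
    have h1 : ContMDiffOn (modelR n) (modelR n) ∞ (chartAt (Fin n → ℂ) c).symm
      (chartAt (Fin n → ℂ) c).target := contMDiffOn_chart_symm
    have h2 : ContMDiffOn 𝓘(ℝ, ℝ × (Fin n → ℂ)) (𝓘(ℝ, ℝ).prod (modelR n)) ∞
        (fun q : ℝ × (Fin n → ℂ) => (q.1, (chartAt (Fin n → ℂ) c).symm q.2))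
        (K ×ˢ (chartAt (Fin n → ℂ) c).target) :=
      contDiff_fst.contMDiff.contMDiffOn.prodMk
        (h1.comp contDiff_snd.contMDiff.contMDiffOn fun q hq => hq.2)
    exact contMDiffOn_iff_contDiffOn.mp (h.comp h2 fun q hq => ⟨hq.1, mem_univ _⟩)
  · rintro h ⟨t, x⟩ ⟨ht, -⟩
    have h1 : ContMDiffOn (modelR n) (modelR n) ∞ (chartAt (Fin n → ℂ) x)
      (chartAt (Fin n → ℂ) x).source := contMDiffOn_chart
    have h2 : ContMDiffOn (𝓘(ℝ, ℝ).prod (modelR n)) 𝓘(ℝ, ℝ × (Fin n → ℂ)) ∞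
        (fun q : ℝ × M => (q.1, chartAt (Fin n → ℂ) x q.2))
        (K ×ˢ (chartAt (Fin n → ℂ) x).source) :=
      contMDiff_fst.contMDiffOn.prodMk_space (h1.comp contMDiff_snd.contMDiffOn fun q hq => hq.2)
    have h3 := (h x).contMDiffOn.comp h2 fun q hq => ⟨hq.1, (chartAt _ x).map_source hq.2⟩
    have h4 : ContMDiffOn (𝓘(ℝ, ℝ).prod (modelR n)) 𝓘(ℝ, ℝ) ∞ (fun q : ℝ × M => φ q.1 q.2)
        (K ×ˢ (chartAt (Fin n → ℂ) x).source) := h3.congr fun q hq => by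
      rw [Function.comp_apply, (chartAt (Fin n → ℂ) x).left_inv hq.2]
    refine (h4 (t, x) ⟨ht, mem_chart_source _ x⟩).mono_of_mem_nhdsWithin ?_
    have h5 : K ×ˢ (chartAt (Fin n → ℂ) x).source
        = (K ×ˢ univ) ∩ (univ ×ˢ (chartAt (Fin n → ℂ) x).source) := by
      rw [prod_inter_prod, inter_univ, univ_inter]
    rw [h5]
    exact Filter.inter_mem self_mem_nhdsWithin (mem_nhdsWithin_of_mem_nhds
      ((isOpen_univ.prod (chartAt (Fin n → ℂ) x).open_source).mem_nhds
        ⟨mem_univ _, mem_chart_source _ x⟩))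

lemma SmoothFun.contMDiff {φ : ℝ → M → ℝ} (h : SmoothFun (n := n) K φ) {t : ℝ} (ht : t ∈ K) :
    ContMDiff (modelR n) 𝓘(ℝ, ℝ) ∞ (φ t) :=
  contMDiff_iff_chart.mpr fun c => (h c).comp
    (contDiff_const.prodMk contDiff_id).contDiffOn fun _ hy => ⟨ht, hy⟩

lemma SmoothFamily.smooth {a : ℝ → OneForm n M ℝ} (h : SmoothFamily K a) {t : ℝ} (ht : t ∈ K) :
    (a t).Smooth := fun c => (h c).comp
    (contDiff_const.prodMk contDiff_id).contDiffOn fun _ hy => ⟨ht, hy⟩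

lemma dFun_eq_fderiv {φ : M → ℝ} (h : ContMDiff (modelR n) 𝓘(ℝ, ℝ) ∞ φ) (x : M) :
    OneForm.val (dFun φ) x = fderiv ℝ (fun y => φ ((chartAt (Fin n → ℂ) x).symm y))
      (chartAt (Fin n → ℂ) x x) := by
  rw [← OneForm.inChart_self]
  exact inChart_vdFun (mem_chart_target _ x) ((h _).mdifferentiableAt (by simp))

/-- The family `½ I dφ_t` is smooth. -/
lemma SmoothFun.smoothFamily_compI {φ : ℝ → M → ℝ} (hK : UniqueDiffOn ℝ K)
    (h : SmoothFun (n := n) K φ) :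
    SmoothFamily K fun t => (1 / 2 : ℝ) • compI (dFun (n := n) (φ t)) := by
  intro c
  have h1 := contDiffOn_fderiv_slice hK (chartAt (Fin n → ℂ) c).open_target
    (a := fun t y => φ t ((chartAt (Fin n → ℂ) c).symm y)) (h c)
  refine (((h1.clm_comp (contDiffOn_const (c := mulI n))).neg).const_smul (1 / 2 : ℝ)).congr ?_
  rintro ⟨t, y⟩ ⟨ht, hy⟩
  have h2 := inChart_vdFun hy (((h.contMDiff ht) _).mdifferentiableAt (by simp))
  rw [OneForm.inChart_smul, Pi.smul_apply, inChart_compI _ hy, dFun_eq_vdFun, h2]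

/-- The operator `½ I d` is linear in `φ` and involves only space derivatives, so it commutes with
`∂ₜ`, including at the endpoint of the interval. -/
lemma SmoothFun.hasDerivWithinAt_compI {φ : ℝ → M → ℝ} (hK : IsTimeSet K)
    (h : SmoothFun (n := n) K φ) {ψ : M → ℝ} (hψ : ContMDiff (modelR n) 𝓘(ℝ, ℝ) ∞ ψ) {t : ℝ}
    (ht : t ∈ K) (hd : ∀ x, HasDerivWithinAt (fun s => φ s x) (ψ x) K t) (x : M) (v : Tan n x) :
    HasDerivWithinAt (fun s => ((1 / 2 : ℝ) • compI (dFun (n := n) (φ s))) x v)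
      (1 / 2 * compI (dFun ψ) x v) K t := by
  have h1 := hasDerivWithinAt_fderiv_slice hK (chartAt (Fin n → ℂ) x).open_target
    (a := fun t y => φ t ((chartAt (Fin n → ℂ) x).symm y)) (h x) ht
    (b := fun y => ψ ((chartAt (Fin n → ℂ) x).symm y)) (fun y _ => hd _) (mem_chart_target _ x)
  have h2 := h1.clm_apply (hasDerivWithinAt_const t K (mulI n v))
  rw [map_zero, add_zero, ← dFun_eq_fderiv hψ] at h2
  refine (h2.neg.const_mul (1 / 2)).congr_of_mem (fun s hs => ?_) ht
  rw [Pi.neg_apply, ← dFun_eq_fderiv (h.contMDiff hs)]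
  rfl

/-- The time derivative of `da_t`. -/
lemma SmoothFamily.hasDerivWithinAt_extD {a : ℝ → OneForm n M ℝ} (hK : IsTimeSet K)
    (h : SmoothFamily K a) {b : OneForm n M ℝ} {t : ℝ}
    (ht : t ∈ K) (hd : ∀ x v, HasDerivWithinAt (fun s => a s x v) (b x v) K t) (x : M)
    (v w : Tan n x) : HasDerivWithinAt (fun s => extD (a s) x v w) (extD b x v w) K t := by
  have h0 : ∀ y ∈ (chartAt (Fin n → ℂ) x).target,
      HasDerivWithinAt (fun s => OneForm.inChart (a s) x y) (OneForm.inChart b x y) K t := by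
    intro y hy
    refine hasDerivWithinAt_clm_of_apply (hK.uniqueDiffOn t ht) ?_ fun v => hd _ _
    have h1 := ((h x).differentiableOn (by simp)) (t, y) ⟨ht, hy⟩
    exact h1.comp t (f := fun s : ℝ => (s, y))
      (differentiableWithinAt_id.prodMk (differentiableWithinAt_const y)) fun s hs => ⟨hs, hy⟩
  have h1 := hasDerivWithinAt_fderiv_slice hK (chartAt (Fin n → ℂ) x).open_target
    (a := fun t y => OneForm.inChart (a t) x y) (h x) ht h0 (mem_chart_target _ x)
  have key : ∀ {f : ℝ → (Fin n → ℂ) →L[ℝ] (Fin n → ℂ) →L[ℝ] ℝ} {f'},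
      HasDerivWithinAt f f' K t → ∀ v w,
      HasDerivWithinAt (fun s => antisymm (f s) v w) (antisymm f' v w) K t := by
    intro f f' hf v w
    have e : ∀ v w, HasDerivWithinAt (fun s => f s v w) (f' v w) K t := fun v w => by
      have e1 := (hf.clm_apply (hasDerivWithinAt_const t K v)).clm_apply
        (hasDerivWithinAt_const t K w)
      simpa using e1
    simp only [antisymm_apply]
    exact (e v w).sub (e w v)
  exact key h1 v w

end Families

/-! ### Equivalence of the moment map flow with the `Ω`-Kähler flow -/

section Flow

variable {n : ℕ} {M : Type*} [TopologicalSpace M] [ChartedSpace (Fin n → ℂ) M]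
  {V : M → Type*} [TopologicalSpace (TotalSpace ℂ V)] [∀ x, NormedAddCommGroup (V x)]
  [∀ x, InnerProductSpace ℂ (V x)] [FiberBundle ℂ V] [VectorBundle ℂ ℂ V]
  [IsManifold 𝓘(ℂ, Fin n → ℂ) ω M] [T2Space M] [ContMDiffVectorBundle ∞ ℂ V (modelR n)]
  {nab₀ : Conn n V} {K : Set ℝ} {a : ℝ → OneForm n M ℝ} {Om : TopForm n M}

lemma contDiffOn_inChart_add_extD (hK : UniqueDiffOn ℝ K) {F : TwoForm n M ℝ} (hF : F.Smooth)
    (ha : SmoothFamily K a) (c : M) (v w : Fin n → ℂ) :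
    ContDiffOn ℝ ∞ (fun q : ℝ × (Fin n → ℂ) => TwoForm.inChart (F + extD (a q.1)) c q.2 v w)
      (K ×ˢ (chartAt (Fin n → ℂ) c).target) := by
  have h1 := contDiffOn_fderiv_slice hK (chartAt (Fin n → ℂ) c).open_target
    (a := fun t y => OneForm.inChart (a t) c y) (ha c)
  have h2 : ∀ v w : Fin n → ℂ, ContDiffOn ℝ ∞ (fun q : ℝ × (Fin n → ℂ) =>
      fderiv ℝ (fun y => OneForm.inChart (a q.1) c y) q.2 v w)
      (K ×ˢ (chartAt (Fin n → ℂ) c).target) := fun v w =>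
    (h1.clm_apply contDiffOn_const).clm_apply contDiffOn_const
  have h3 : ContDiffOn ℝ ∞ (fun q : ℝ × (Fin n → ℂ) => TwoForm.inChart F c q.2 v w)
      (K ×ˢ (chartAt (Fin n → ℂ) c).target) :=
    (hF c v w).comp contDiff_snd.contDiffOn fun q hq => hq.2
  refine (h3.add ((h2 v w).sub (h2 w v))).congr ?_
  rintro ⟨t, y⟩ ⟨ht, hy⟩
  have h4 := extD_inChart hy ((ha.smooth ht).at _) v w
  exact congrArg (TwoForm.inChart F c y v w + ·) h4

lemma IsCurve.curv_eq (h₀ : nab₀ ∈ kahlerConns n V) (h : IsCurve nab₀ K a) {t : ℝ} (ht : t ∈ K) :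
    curv (shift nab₀ (a t)) = curv nab₀ + extD (a t) :=
  curv_shift h₀.1 (h.smooth.smooth ht)

variable [NeZero n]

/-- The function `μ̄♯(∇_t)` depends smoothly on `(t, x)`. -/
lemma IsCurve.smoothFun_muSharp (hK : UniqueDiffOn ℝ K) (hOm : Om.Smooth)
    (h₀ : nab₀ ∈ kahlerConns n V) (h : IsCurve nab₀ K a) :
    SmoothFun (n := n) K fun t => muSharp Om (shift nab₀ (a t)) := by
  intro c
  have h1 : ContDiffOn ℝ ∞ (fun q : ℝ × (Fin n → ℂ) =>
      TopForm.coeff (topPow (curv nab₀ + extD (a q.1))) c q.2)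
      (K ×ˢ (chartAt (Fin n → ℂ) c).target) := by
    simp only [topPow_eq, coeff_wedgeTop, wedgeCoeff, wedgeVal]
    refine contDiffOn_const.mul (ContDiffOn.sum fun σ _ => ?_)
    exact ContDiffOn.const_smul _ (contDiffOn_prod fun j _ =>
      contDiffOn_inChart_add_extD hK (isKahler_curv h₀).locallyExact.smooth h.smooth c _ _)
  have h2 : ContDiffOn ℝ ∞ (fun q : ℝ × (Fin n → ℂ) => TopForm.coeff Om c q.2)
      (K ×ˢ (chartAt (Fin n → ℂ) c).target) :=
    (hOm c).comp contDiff_snd.contDiffOn fun q hq => hq.2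
  refine ((h1.sub h2).div h1 ?_).congr ?_
  · rintro ⟨t, y⟩ ⟨ht, hy⟩
    rw [coeff_eq, ← h.curv_eq h₀ ht]
    exact mul_ne_zero (det_jac_pos hy).ne' (IsKahler.topPow_pos (isKahler_curv (h.mem t ht)) _).ne'
  · rintro ⟨t, y⟩ ⟨ht, hy⟩
    have h3 := topRatio_chart (topPow (curv (shift nab₀ (a t))) - Om)
      (topPow (curv (shift nab₀ (a t)))) hy
    rw [coeff_sub] at h3
    change _ = (TopForm.coeff (topPow (curv nab₀ + extD (a t))) c y - TopForm.coeff Om c y)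
      / TopForm.coeff (topPow (curv nab₀ + extD (a t))) c y
    rw [← h.curv_eq h₀ ht]
    exact h3

lemma muSharp_eq_one_sub {nab : Conn n V} (h : nab ∈ kahlerConns n V) (x : M) :
    muSharp Om nab x = 1 - topRatio Om (topPow (curv nab)) x := by
  have h0 := (IsKahler.topPow_pos (isKahler_curv h) x).ne'
  have h1 : muSharp Om nab x = (TopForm.val (topPow (curv nab)) x (frame n)
      - TopForm.val Om x (frame n)) / TopForm.val (topPow (curv nab)) x (frame n) := rfl
  rw [h1, topRatio_eq, sub_div, div_self h0]

/-- A solution of the `Ω`-Kähler flow defines a curve in `𝓜`. -/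
lemma IsOmegaKahlerFlow.isCurve (hK : IsTimeSet K) (h₀ : nab₀ ∈ kahlerConns n V)
    {φ : ℝ → M → ℝ} (hφ : IsOmegaKahlerFlow Om (curv nab₀) K φ)
    (ha : ∀ t ∈ K, a t = (1 / 2 : ℝ) • compI (dFun (φ t))) : IsCurve nab₀ K a where
  smooth := fun c => ((contMDiffOn_iff_smoothFun.mp hφ.smooth).smoothFamily_compI
    hK.uniqueDiffOn c).congr fun q hq => by rw [ha q.1 hq.1]
  zero := by
    have h1 : dFun (n := n) (φ 0) = 0 := by
      rw [hφ.zero]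
      exact funext fun x => mvfderiv_zero
    rw [ha 0 hK.zero_mem, h1]
    refine oneForm_ext fun x v => ?_
    change (1 / 2 : ℝ) * -0 = 0
    simp
  mem t ht := by
    have hs := (contMDiffOn_iff_smoothFun.mp hφ.smooth).contMDiff ht
    have hT : IsTangent (a t) := by
      rw [ha t ht]
      exact isTangent_smul _ (isTangent_compI (isTangent_dFun hs))
    have hc : curv (shift nab₀ (a t)) = curv nab₀ + iddbar (φ t) := by
      rw [curv_shift h₀.1 hT.1, iddbar_eq hs, ha t ht]
    refine ⟨h₀.1.shift hT.1, fun x v w => ?_, ?_⟩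
    · rw [curv_shift h₀.1 hT.1]
      exact congrArg₂ (· + ·) (h₀.2.1 x v w) (hT.2 x v w)
    · rw [hc]
      exact hφ.positive t ht

variable [CompactSpace M]

/-- The moment map flow and the `Ω`-Kähler flow are equivalent. -/
lemma flow_iff_isOmegaKahlerFlow (hK : IsTimeSet K) (hOm : Om.Smooth)
    (h₀ : nab₀ ∈ kahlerConns n V) :
    (IsCurve nab₀ K a ∧ ∀ t ∈ K, ∀ (x : M) (v : Tan n x), HasDerivWithinAt (fun s => a s x v)
        (1 / 2 * compI (dFun (muSharp Om (shift nab₀ (a t)))) x v) K t) ↔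
      ∃ φ : ℝ → M → ℝ, IsOmegaKahlerFlow Om (curv nab₀) K φ ∧
        ∀ t ∈ K, a t = (1 / 2 : ℝ) • compI (dFun (φ t)) ∧
          curv (shift nab₀ (a t)) = curv nab₀ + iddbar (φ t) := by
  constructor
  · rintro ⟨hc, hf⟩
    have hh := hc.smoothFun_muSharp hK.uniqueDiffOn hOm h₀
    -- The potential is forced: its time derivative must be `μ̄♯(∇_t) = 1 - Ω/Fⁿ` and it starts at
    -- zero.
    let φ : ℝ → M → ℝ := fun t x => ∫ s in (0 : ℝ)..t, muSharp Om (shift nab₀ (a s)) x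
    have hφ : SmoothFun (n := n) K φ := fun c =>
      contDiffOn_timeIntegral hK (chartAt (Fin n → ℂ) c).open_target
        (h := fun t y => muSharp Om (shift nab₀ (a t)) ((chartAt (Fin n → ℂ) c).symm y)) (hh c)
    have hφd : ∀ t ∈ K, ∀ x, HasDerivWithinAt (fun s => φ s x)
        (muSharp Om (shift nab₀ (a t)) x) K t := fun t ht x => by
      have h1 := hasDerivWithinAt_timeIntegral hK (chartAt (Fin n → ℂ) x).open_target
        (h := fun t y => muSharp Om (shift nab₀ (a t)) ((chartAt (Fin n → ℂ) x).symm y)) (hh x)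
        ht (mem_chart_target _ x)
      simp only [(chartAt (Fin n → ℂ) x).left_inv (mem_chart_source _ x)] at h1
      exact h1
    have hφ0 : φ 0 = 0 := funext fun x => intervalIntegral.integral_same
    -- Both sides solve `∂ₜ = ½ I dμ̄♯(∇_t)` with the same right-hand side, already fixed by `a`,
    -- and vanish at time `0`; no uniqueness theorem for the nonlinear flow is needed.
    have ha : ∀ t ∈ K, a t = (1 / 2 : ℝ) • compI (dFun (φ t)) := fun t ht => by
      refine oneForm_ext fun x v => ?_
      refine hK.eq_of_hasDerivWithinAt_eq (fun t ht => hf t ht x v) (fun t ht =>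
        hφ.hasDerivWithinAt_compI hK (muSharp_smooth hOm (hc.mem t ht)) ht (hφd t ht) x v) ?_ ht
      have h1 : dFun (n := n) (φ 0) = 0 := by
        rw [hφ0]
        exact funext fun x => mvfderiv_zero
      rw [hc.zero, h1]
      change 0 = (1 / 2 : ℝ) * -0
      simp
    have hcurv : ∀ t ∈ K, curv (shift nab₀ (a t)) = curv nab₀ + iddbar (φ t) := fun t ht => by
      rw [hc.curv_eq h₀ ht, iddbar_eq (hφ.contMDiff ht), ← ha t ht]
    refine ⟨φ, ⟨contMDiffOn_iff_smoothFun.mpr hφ, hφ0, fun t ht => ?_, fun t ht x => ?_⟩,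
      fun t ht => ⟨ha t ht, hcurv t ht⟩⟩
    · rw [← hcurv t ht]
      exact (hc.mem t ht).2.2
    · rw [← hcurv t ht, ← muSharp_eq_one_sub (hc.mem t ht)]
      exact hφd t ht x
  · rintro ⟨φ, hφ, ha⟩
    have hc := hφ.isCurve hK h₀ fun t ht => (ha t ht).1
    refine ⟨hc, fun t ht x v => ?_⟩
    have hφs := contMDiffOn_iff_smoothFun.mp hφ.smooth
    refine (hφs.hasDerivWithinAt_compI hK (muSharp_smooth hOm (hc.mem t ht)) ht (fun x => ?_)
      x v).congr_of_mem (fun s hs => ?_) ht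
    · rw [muSharp_eq_one_sub (hc.mem t ht), (ha t ht).2]
      exact hφ.flow t ht x
    · rw [(ha s hs).1]

/-- The evolution of the curvature. -/
lemma hasDerivWithinAt_curv (hK : IsTimeSet K) (hOm : Om.Smooth) (h₀ : nab₀ ∈ kahlerConns n V)
    (hc : IsCurve nab₀ K a) {t : ℝ} (ht : t ∈ K)
    (hf : ∀ (x : M) (v : Tan n x), HasDerivWithinAt (fun s => a s x v)
        (1 / 2 * compI (dFun (muSharp Om (shift nab₀ (a t)))) x v) K t)
    (x : M) (v w : Tan n x) :
    HasDerivWithinAt (fun s => curv (shift nab₀ (a s)) x v w)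
      (iddbar (muSharp Om (shift nab₀ (a t))) x v w) K t := by
  have h1 := hc.smooth.hasDerivWithinAt_extD hK ht
    (b := (1 / 2 : ℝ) • compI (dFun (muSharp Om (shift nab₀ (a t))))) hf x v w
  rw [iddbar_eq (muSharp_smooth hOm (hc.mem t ht))]
  -- Only `da_s` depends on time in `F_{∇_s} = ω + da_s`.
  refine (h1.const_add (curv nab₀ x v w)).congr_of_mem (fun s hs => ?_) ht
  rw [hc.curv_eq h₀ hs]
  rfl

end Flow

end KahlerFlow

end

/-! ### The theorem -/

theorem mainTheorem11 {n : ℕ} [NeZero n]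
    {M : Type*} [TopologicalSpace M] [ChartedSpace (Fin n → ℂ) M]
    [IsManifold 𝓘(ℂ, Fin n → ℂ) ω M] [T2Space M] [CompactSpace M]
    {V : M → Type*} [TopologicalSpace (TotalSpace ℂ V)] [∀ x, NormedAddCommGroup (V x)]
    [∀ x, InnerProductSpace ℂ (V x)] [FiberBundle ℂ V] [VectorBundle ℂ ℂ V]
    [ContMDiffVectorBundle ∞ ℂ V (KahlerFlow.modelR n)]
    (hV : KahlerFlow.SmoothHermitian n V)
    (Om : KahlerFlow.TopForm n M) (hOm : KahlerFlow.IsVolumeForm Om)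
    (nab₀ : KahlerFlow.Conn n V) (h₀ : nab₀ ∈ KahlerFlow.kahlerConns n V)
    (hvol : KahlerFlow.integral Om
      = KahlerFlow.integral (KahlerFlow.topPow (KahlerFlow.curv nab₀))) :
    -- the gauge group acts on the space of connections
    (∀ (g : KahlerFlow.Gauge n M), ∀ nab ∈ KahlerFlow.kahlerConns n V,
      g • nab ∈ KahlerFlow.kahlerConns n V) ∧
    -- `ν` is an invariant symplectic form
    KahlerFlow.IsInvariantSymplectic n V KahlerFlow.nu ∧
    -- `ν` is compatible with the complex structure `I`, with which it defines a Riemannian metric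
    (∀ a : KahlerFlow.OneForm n M ℝ, KahlerFlow.IsTangent a →
      KahlerFlow.IsTangent (KahlerFlow.compI a)) ∧
    (∀ nab ∈ KahlerFlow.kahlerConns n V, ∀ a b : KahlerFlow.OneForm n M ℝ,
      KahlerFlow.IsTangent a → KahlerFlow.IsTangent b →
      KahlerFlow.nu nab (KahlerFlow.compI a) (KahlerFlow.compI b) = KahlerFlow.nu nab a b ∧
      (a ≠ 0 → 0 < KahlerFlow.nu nab a (KahlerFlow.compI a))) ∧
    -- `μ̄` is a moment map for `n ν`
    KahlerFlow.IsMomentMap n V (fun nab a b => n * KahlerFlow.nu nab a b)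
      (KahlerFlow.muBar Om) ∧
    -- the infinitesimal action is `X_ζ = d⟨A_∇, ζ⟩`
    (∀ nab ∈ KahlerFlow.kahlerConns n V, ∀ ζ : KahlerFlow.LieGauge n M,
      KahlerFlow.IsInfinitesimalAction nab ζ
        (KahlerFlow.dFun (KahlerFlow.angle (n := n) nab ζ))) ∧
    -- `μ̄(∇)` vanishes on constants, and is represented by the function `(F_∇ⁿ - Ω) / F_∇ⁿ`
    (∀ nab ∈ KahlerFlow.kahlerConns n V,
      (∀ (ζ : KahlerFlow.LieGauge n M) (c : ℝ), (∀ x, ζ x = c) →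
        KahlerFlow.muBar Om nab ζ = 0) ∧
      ∀ ζ : KahlerFlow.LieGauge n M, KahlerFlow.muBar Om nab ζ
        = KahlerFlow.lieInner nab ζ (KahlerFlow.muSharp Om nab)) ∧
    -- the negative gradient flow is the `Ω`-Kähler flow
    (∀ T : EReal, 0 < T → ∀ a : ℝ → KahlerFlow.OneForm n M ℝ,
      (KahlerFlow.IsNegGradientFlow (fun nab b c => n * KahlerFlow.nu nab b c) Om nab₀
          (KahlerFlow.timeInterval T) a ↔
        KahlerFlow.IsMomentFlow Om nab₀ (KahlerFlow.timeInterval T) a) ∧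
      (KahlerFlow.IsNegGradientFlow (fun nab b c => n * KahlerFlow.nu nab b c) Om nab₀
          (KahlerFlow.timeInterval T) a ↔
        ∃ φ : ℝ → M → ℝ,
          KahlerFlow.IsOmegaKahlerFlow Om (KahlerFlow.curv nab₀)
            (KahlerFlow.timeInterval T) φ ∧
          ∀ t ∈ KahlerFlow.timeInterval T,
            a t = (1 / 2 : ℝ) • KahlerFlow.compI (KahlerFlow.dFun (φ t)) ∧
            KahlerFlow.curv (KahlerFlow.shift nab₀ (a t))
              = KahlerFlow.curv nab₀ + KahlerFlow.iddbar (φ t)) ∧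
      (KahlerFlow.IsNegGradientFlow (fun nab b c => n * KahlerFlow.nu nab b c) Om nab₀
          (KahlerFlow.timeInterval T) a →
        ∀ t ∈ KahlerFlow.timeInterval T, ∀ (x : M) (v w : KahlerFlow.Tan n x),
          HasDerivWithinAt (fun s => KahlerFlow.curv (KahlerFlow.shift nab₀ (a s)) x v w)
            (KahlerFlow.iddbar (KahlerFlow.muSharp Om (KahlerFlow.shift nab₀ (a t))) x v w)
            (KahlerFlow.timeInterval T) t)) := by
  have hO : Om.Smooth := hOm.smooth
  refine ⟨fun g nab h => KahlerFlow.gauge_mem_kahlerConns h g,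
    KahlerFlow.isInvariantSymplectic_nu, fun a ha => KahlerFlow.isTangent_compI ha,
    fun nab h a b ha _ => ⟨KahlerFlow.nuForm_compI h.2.1 a b,
      KahlerFlow.nuForm_pos (KahlerFlow.isKahler_curv h) ha.1⟩,
    KahlerFlow.isMomentMap_muBar hO, fun nab h ζ => ?_,
    fun nab h => ⟨fun ζ c hζ => KahlerFlow.muBar_const hO h₀ hvol h hζ,
      KahlerFlow.muBar_eq_lieInner Om h⟩, fun T hT a => ?_⟩
  · rw [KahlerFlow.angle_eq]
    exact KahlerFlow.isInfinitesimalAction_dFun h.1 ζ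
  · have hK := KahlerFlow.isTimeSet_timeInterval hT
    -- All formulations pass through the common equation `∂ₜa = ½ I dμ̄♯(∇_t)` for a smooth curve in
    -- `𝓜`.
    refine ⟨(KahlerFlow.isNegGradientFlow_iff hO).trans (KahlerFlow.isMomentFlow_iff hO).symm,
      (KahlerFlow.isNegGradientFlow_iff hO).trans
        (KahlerFlow.flow_iff_isOmegaKahlerFlow hK hO h₀), fun h t ht => ?_⟩
    obtain ⟨hc, hf⟩ := (KahlerFlow.isNegGradientFlow_iff hO).mp h
    exact KahlerFlow.hasDerivWithinAt_curv hK hO h₀ hc ht (hf t ht)
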